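/- Fix $p \in (0,1)$. Let $S_n$ be the number of triangles in the random graph $G(n,p)$ on $n$ labelled vertices, in which each of the $\binom n2$ possible edges is present independently with probability $p$. Let $\mu_n = p^3\binom n3$, let $\sigma_n \ge 0$ be given by $\sigma_n^2 = \operatorname{Var}[S_n]$, and for $n \ge 3$ let $R_n = (S_n - \mu_n)/\sigma_n$ and $\mathbb{L}_n = \{(k-\mu_n)/\sigma_n : k \in \mathbb{Z}\}$. Let $p_n(x) = \Pr(R_n = x)$ for $x\in\mathbb{L}_n$, and $\mathcal{N}(x) = \frac{1}{\sqrt{2\pi}} e^{-x^2/2}$ for $x \in \mathbb{R}$. Then $\mathbb{E}[S_n] = \mu_n$ for all $n$, $\sigma_n^2 = \Theta(n^4)$ as $n \to \infty$ (with constants that may depend on $p$), and, as $n \to \infty$, $$\sup_{x \in \mathbb{L}_n} \left|\sigma_n\, p_n(x) - \mathcal{N}(x)\right| \longrightarrow 0 .$$ Equivalently, uniformly in $k$: there is a sequence $\varepsilon_n \to 0$ (depending only on $p$) such that for all $n \ge 3$ and all $k \in \mathbb{Z}$, $$\left|\Pr[S_n = k] - \frac{1}{\sigma_n}\,\mathcal{N}\!\left(\frac{k-\mu_n}{\sigma_n}\right)\right|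 \le \frac{\varepsilon_n}{n^2} .$$ -/

import Mathlib

open MeasureTheory ProbabilityTheory Filter Asymptotics Topology

noncomputable section

namespace TriangleLLT

/-- The law of the Erdős–Rényi random graph `G(n,p)`: each of the `n choose 2` possible edges is
present independently with probability `p`. -/
abbrev randomGraph (n : ℕ) (p : unitInterval) : Measure (SimpleGraph (Fin n)) :=
  SimpleGraph.binomialRandom (Fin n) p

/-- `S_n`: the number of triangles (unordered triples of pairwise adjacent vertices) of a graph
on `n` vertices. -/
def S (n : ℕ) (G : SimpleGraph (Fin n)) : ℕ := (G.cliqueSet 3).ncard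

/-- `μ_n = p³ · (n choose 3)`. -/
def mu (n : ℕ) (p : unitInterval) : ℝ := (p : ℝ) ^ 3 * (n.choose 3 : ℝ)

/-- `σ_n = √(Var S_n)`, the standard deviation of the number of triangles in `G(n,p)`. -/
def sigma (n : ℕ) (p : unitInterval) : ℝ :=
  Real.sqrt (variance (fun G => (S n G : ℝ)) (randomGraph n p))

/-- The normalized triangle count `R_n = (S_n - p³ (n choose 3)) / σ_n`. -/
def R (n : ℕ) (p : unitInterval) (G : SimpleGraph (Fin n)) : ℝ :=
  ((S n G : ℝ) - mu n p) / sigma n p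

/-- The lattice `𝕃_n = {(k - p³ (n choose 3)) / σ_n : k ∈ ℤ}`. -/
def lattice (n : ℕ) (p : unitInterval) : Set ℝ :=
  {x : ℝ | ∃ k : ℤ, x = ((k : ℝ) - mu n p) / sigma n p}

/-- `p_n(x) = Pr(R_n = x)`. -/
def pointProb (n : ℕ) (p : unitInterval) (x : ℝ) : ℝ :=
  (randomGraph n p).real {G | R n p G = x}

/-- The standard Gaussian density `𝒩(x) = (2π)^(-1/2) exp(-x²/2)`. -/
def gaussian (x : ℝ) : ℝ := (1 / Real.sqrt (2 * Real.pi)) * Real.exp (-x ^ 2 / 2)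

end TriangleLLT

end

/-! The proof is by Fourier inversion. The point probability of $S_n$ at $k$ is an integral over
$[-\pi,\pi]$ of the characteristic function `phi` of $S_n-\mu_n$ against a unimodular phase, and the
Gaussian density is a similar integral over the whole line. Hence $\sigma_n$ times the $L^1$
distance between `phi`, cut off to one period, and $e^{-\sigma_n^2\theta^2/2}$ bounds the error
uniformly in $k$ (`abs_prob_sub_gaussian_le`). With $L=\log n$ this distance is estimated on three
ranges.

For $|\theta|\le L/n^2$: expanding each edge indicator as $p$ plus a centred variable writes
$S_n-\mu_n$ as $p^2(n-2)$ times the centred edge count plus an orthogonal remainder of variance at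
most $n^3$ (`tri_eq`). The linear part has variance of order $n^4$ and a product characteristic
function, so `phi` is close to the Gaussian (`norm_phi_sub_gaussian_le`).

For $L/n^2\le|\theta|\le L/n^{3/2}$: only the $k^2$ edges between two blocks of $k$ vertices are
kept random, with $k$ of order $L/(|\theta|n)$. The count is a quadratic polynomial in them. Its
linear coefficients are at least codegrees, hence of order $n$ with high probability, which gives
decay $e^{-cL^2}$; its quadratic part is so small that $e^{iQ}=1+iQ+O(Q^2)$ suffices
(`norm_ex_exp_quadratic_le`, `norm_phi_le_mid`).

For $L/n^{3/2}\le|\theta|\le\pi$: the quadratic part is no longer small, and decoupling removes it.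
Cauchy–Schwarz with two independent copies of the edges between one block and the far vertices
leaves a difference of triangle counts that is linear in the edges between two blocks
(`tri_mix_cross_sub`, `norm_phi_sq_le`). Its coefficients are differences of binomial variables, and
$1-\cos$ of $\theta$ times such a difference is handled by a second moment argument
(`ex_exp_neg_le`). Independence over the vertices of the first block raises the gain to the power
$m$, of order $n$ (`norm_phi_sq_le_far`).

Altogether the error is $O(\log^4 n/\sqrt n)$ (`fourierErr_le`). -/

noncomputable section

namespace TriangleLLT

set_option linter.unusedSectionVars false

/-! ### Expectations over finite Bernoulli product spaces -/

section Expectation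

variable {ι : Type*} [Fintype ι] [DecidableEq ι] {E : Type*} [AddCommGroup E] [Module ℝ E]

/-- The weight of a single Bernoulli outcome. -/
def bw (p : ℝ) (b : Bool) : ℝ := if b then p else 1 - p

/-- The weight of an outcome of independent Bernoulli variables. -/
def wt (p : ℝ) (x : ι → Bool) : ℝ := ∏ i, bw p (x i)

/-- The expectation of `f` under independent Bernoulli variables. -/
def ex (p : ℝ) (f : (ι → Bool) → E) : E := ∑ x, wt p x • f x

/-- The numerical value of a Bernoulli outcome. -/
def bv (b : Bool) : ℝ := if b then 1 else 0

lemma bv_nonneg (b : Bool) : 0 ≤ bv b := by cases b <;> simp [bv]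

lemma bv_le_one (b : Bool) : bv b ≤ 1 := by cases b <;> simp [bv]

lemma bw_nonneg {p : ℝ} (h0 : 0 ≤ p) (h1 : p ≤ 1) (b : Bool) : 0 ≤ bw p b := by
  cases b <;> simp [bw, h0, h1]

lemma wt_nonneg {p : ℝ} (h0 : 0 ≤ p) (h1 : p ≤ 1) (x : ι → Bool) : 0 ≤ wt p x :=
  Finset.prod_nonneg fun _ _ => bw_nonneg h0 h1 _

lemma ex_add (p : ℝ) (f g : (ι → Bool) → E) : ex p (fun x => f x + g x) = ex p f + ex p g := by
  simp [ex, Finset.sum_add_distrib]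

lemma ex_sub (p : ℝ) (f g : (ι → Bool) → E) : ex p (fun x => f x - g x) = ex p f - ex p g := by
  simp [ex, smul_sub, Finset.sum_sub_distrib]

lemma ex_mul_left {A : Type*} [CommRing A] [Algebra ℝ A] (p : ℝ) (c : A) (f : (ι → Bool) → A) :
    ex p (fun x => c * f x) = c * ex p f := by
  simp [ex, Finset.mul_sum]

lemma ex_mul_right {A : Type*} [CommRing A] [Algebra ℝ A] (p : ℝ) (c : A) (f : (ι → Bool) → A) :
    ex p (fun x => f x * c) = ex p f * c := by
  simp [ex, Finset.sum_mul]

lemma ex_sum {κ : Type*} (p : ℝ) (s : Finset κ) (f : κ → (ι → Bool) → E) :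
    ex p (fun x => ∑ k ∈ s, f k x) = ∑ k ∈ s, ex p (f k) := by
  simp only [ex, Finset.smul_sum]
  exact Finset.sum_comm

lemma ex_prod {A : Type*} [CommRing A] [Algebra ℝ A] (p : ℝ) (g : ι → Bool → A) :
    ex p (fun x => ∏ i, g i (x i)) = ∏ i, (p • g i true + (1 - p) • g i false) := by
  have h : ∀ i, p • g i true + (1 - p) • g i false = ∑ b : Bool, bw p b • g i b := by
    intro i; simp [bw]
  simp_rw [h, Finset.prod_univ_sum, Fintype.piFinset_univ, ex, wt, Finset.prod_smul]

lemma ex_const (p : ℝ) (c : E) : ex (ι := ι) p (fun _ => c) = c := by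
  have h : ∑ x : ι → Bool, wt p x = 1 := by
    have := ex_prod (ι := ι) p (fun _ _ => (1 : ℝ))
    simpa [ex] using this
  simp [ex, ← Finset.sum_smul, h]

lemma ex_mono {p : ℝ} (h0 : 0 ≤ p) (h1 : p ≤ 1) {f g : (ι → Bool) → ℝ} (h : ∀ x, f x ≤ g x) :
    ex p f ≤ ex p g :=
  Finset.sum_le_sum fun x _ => mul_le_mul_of_nonneg_left (h x) (wt_nonneg h0 h1 x)

lemma ex_nonneg {p : ℝ} (h0 : 0 ≤ p) (h1 : p ≤ 1) {f : (ι → Bool) → ℝ} (h : ∀ x, 0 ≤ f x) :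
    0 ≤ ex p f :=
  Finset.sum_nonneg fun x _ => mul_nonneg (wt_nonneg h0 h1 x) (h x)

lemma ex_le_const {p : ℝ} (h0 : 0 ≤ p) (h1 : p ≤ 1) {f : (ι → Bool) → ℝ} {c : ℝ}
    (h : ∀ x, f x ≤ c) : ex p f ≤ c :=
  (ex_mono h0 h1 h).trans_eq (ex_const p c)

lemma norm_ex_le {p : ℝ} (h0 : 0 ≤ p) (h1 : p ≤ 1) (f : (ι → Bool) → ℂ) :
    ‖ex p f‖ ≤ ex p (fun x => ‖f x‖) := by
  refine (norm_sum_le _ _).trans (Finset.sum_le_sum fun x _ => ?_)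
  rw [norm_smul, Real.norm_of_nonneg (wt_nonneg h0 h1 x), smul_eq_mul]

lemma ex_ofReal (p : ℝ) (f : (ι → Bool) → ℝ) :
    ex p (fun x => (f x : ℂ)) = ((ex p f : ℝ) : ℂ) := by
  simp [ex]

lemma ex_re (p : ℝ) (f : (ι → Bool) → ℂ) : (ex p f).re = ex p (fun x => (f x).re) := by
  simp [ex]

lemma ex_comm {κ : Type*} [Fintype κ] [DecidableEq κ] (p : ℝ) (f : (ι → Bool) → (κ → Bool) → E) :
    ex p (fun x => ex p (fun y => f x y)) = ex p (fun y => ex p (fun x => f x y)) := by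
  simp only [ex, Finset.smul_sum]
  rw [Finset.sum_comm]
  simp only [smul_smul, mul_comm]

lemma sq_ex_le {p : ℝ} (h0 : 0 ≤ p) (h1 : p ≤ 1) (f : (ι → Bool) → ℝ) :
    (ex p f) ^ 2 ≤ ex p (fun x => f x ^ 2) := by
  have h := ex_nonneg h0 h1 (f := fun x => (f x - ex p f) ^ 2) (fun x => sq_nonneg _)
  have e : ex p (fun x => (f x - ex p f) ^ 2) = ex p (fun x => f x ^ 2) - (ex p f) ^ 2 := by
    have : (fun x => (f x - ex p f) ^ 2)
        = fun x => f x ^ 2 - (2 * ex p f) * f x + (ex p f) ^ 2 := by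
      ext x; ring
    rw [this, ex_add, ex_sub, ex_mul_left, ex_const]; ring
  linarith

lemma ex_comp_equiv {κ : Type*} [Fintype κ] [DecidableEq κ] (p : ℝ) (e : κ ≃ ι) (f : (κ → Bool) → E) :
    ex p (fun x : ι → Bool => f (fun k => x (e k))) = ex p f := by
  unfold ex
  refine Fintype.sum_equiv (e.arrowCongr (Equiv.refl Bool)).symm _ _ fun x => ?_
  have : wt p x = wt p (fun k => x (e k)) := (Equiv.prod_comp e fun i => bw p (x i)).symm
  rw [this]; rfl

/-- Rows of a Boolean matrix are independent. This and `ex_cols` replace Fubini arguments for the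
edges at different vertices. -/
lemma ex_rows {α β A : Type*} [Fintype α] [Fintype β] [DecidableEq α] [DecidableEq β]
    [CommRing A] [Algebra ℝ A] (p : ℝ) (h : α → (β → Bool) → A) :
    ex p (fun x : α × β → Bool => ∏ a, h a (fun b => x (a, b))) = ∏ a, ex p (h a) := by
  simp only [ex, Finset.prod_univ_sum, Fintype.piFinset_univ]
  refine Fintype.sum_equiv (Equiv.curry α β Bool) _ _ fun x => ?_
  rw [Finset.prod_smul, wt, Fintype.prod_prod_type]
  rfl

lemma ex_cols {α β A : Type*} [Fintype α] [Fintype β] [DecidableEq α] [DecidableEq β]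
    [CommRing A] [Algebra ℝ A] (p : ℝ) (h : β → (α → Bool) → A) :
    ex p (fun x : α × β → Bool => ∏ b, h b (fun a => x (a, b))) = ∏ b, ex p (h b) := by
  rw [← ex_rows p h]
  exact ex_comp_equiv p (Equiv.prodComm β α)
    (fun y : β × α → Bool => ∏ b, h b (fun a => y (b, a)))

/-- Take the coordinates in `F` from `y` and the other ones from `x`. -/
def mix (F : Finset ι) (y x : ι → Bool) : ι → Bool := fun i => if i ∈ F then y i else x i

/-- Conditioning on the coordinates outside `F`: exchanging the `F`-coordinates of two independent
samples is an involution that preserves the product weight. -/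
lemma ex_mix (p : ℝ) (F : Finset ι) (h : (ι → Bool) → E) :
    ex p (fun x => ex p (fun y => h (mix F y x))) = ex p h := by
  have e1 : ∀ k : (ι → Bool) → (ι → Bool) → E, ex p (fun x => ex p (fun y => k x y))
      = ∑ z : (ι → Bool) × (ι → Bool), (wt p z.1 * wt p z.2) • k z.1 z.2 := by
    intro k
    simp only [ex, Finset.smul_sum, smul_smul, Fintype.sum_prod_type]
  have e2 : ex p h = ex p (fun x => ex (ι := ι) p (fun _ => h x)) := by
    simp only [ex_const]
  rw [e2, e1, e1]
  have hinv : Function.Involutive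
      (fun z : (ι → Bool) × (ι → Bool) => (mix F z.2 z.1, mix F z.1 z.2)) := by
    rintro ⟨x, y⟩
    ext i <;> by_cases hi : i ∈ F <;> simp [mix, hi]
  refine Fintype.sum_equiv hinv.toPerm _ _ ?_
  rintro ⟨x, y⟩
  have : wt p x * wt p y = wt p (mix F y x) * wt p (mix F x y) := by
    simp only [wt, ← Finset.prod_mul_distrib]
    refine Finset.prod_congr rfl fun i _ => ?_
    by_cases hi : i ∈ F <;> simp [mix, hi, mul_comm]
  rw [this]; rfl

/-- The product of the centred variables indexed by `A`. -/
def cen (p : ℝ) (A : Finset ι) (x : ι → Bool) : ℝ := ∏ i ∈ A, (bv (x i) - p)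

lemma cen_eq (p : ℝ) (A : Finset ι) (x : ι → Bool) :
    cen p A x = ∏ i, if i ∈ A then bv (x i) - p else 1 := by
  simp [cen, Finset.prod_ite_mem]

/-- Products of centred variables are orthogonal: an index in exactly one of the two sets
contributes a factor of mean zero, an index in both contributes the variance. -/
lemma ex_cen_mul_cen (p : ℝ) (A B : Finset ι) :
    ex p (fun x => cen p A x * cen p B x) = if A = B then (p * (1 - p)) ^ A.card else 0 := by
  have h := ex_prod p (fun (i : ι) (b : Bool) =>
    (if i ∈ A then bv b - p else 1) * (if i ∈ B then bv b - p else 1))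
  simp only [cen_eq, ← Finset.prod_mul_distrib]
  rw [h]
  split_ifs with hAB
  · subst hAB
    rw [← Finset.prod_const, ← Finset.prod_subset (Finset.subset_univ A)]
    · refine Finset.prod_congr rfl fun i hi => ?_
      simp only [hi, if_true, bv, smul_eq_mul]
      simp; ring
    · intro i _ hi
      simp [hi]
  · have : ∃ i, ¬ (i ∈ A ↔ i ∈ B) := by
      by_contra hc
      push Not at hc
      exact hAB (Finset.ext hc)
    obtain ⟨i, hi⟩ := this
    refine Finset.prod_eq_zero (Finset.mem_univ i) ?_
    by_cases hA : i ∈ A <;> by_cases hB : i ∈ B <;> simp_all [bv] <;> ring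

lemma ex_cen {p : ℝ} {A : Finset ι} (hA : A.Nonempty) : ex p (cen p A) = 0 := by
  have := ex_cen_mul_cen p A ∅
  simp only [cen, Finset.prod_empty, mul_one, hA.ne_empty, if_false] at this
  exact this

lemma ex_sq_sum_cen {κ : Type*} (p : ℝ) (J : Finset κ) (T : κ → Finset ι)
    (hT : Set.InjOn T J) (g : κ → ℝ) :
    ex p (fun x => (∑ j ∈ J, g j * cen p (T j) x) ^ 2)
      = ∑ j ∈ J, g j ^ 2 * (p * (1 - p)) ^ (T j).card := by
  have : ∀ x, (∑ j ∈ J, g j * cen p (T j) x) ^ 2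
      = ∑ j ∈ J, ∑ k ∈ J, (g j * g k) * (cen p (T j) x * cen p (T k) x) := by
    intro x
    rw [sq, Finset.sum_mul_sum]
    refine Finset.sum_congr rfl fun j _ => Finset.sum_congr rfl fun k _ => by ring
  simp only [this, ex_sum, ex_mul_left, ex_cen_mul_cen]
  refine Finset.sum_congr rfl fun j hj => ?_
  rw [Finset.sum_eq_single j]
  · simp [sq]
  · intro k hk hkj
    rw [if_neg fun h => hkj (hT hk hj h.symm), mul_zero]
  · exact fun h => absurd hj h

lemma abs_bv_sub_le {p : ℝ} (h0 : 0 ≤ p) (h1 : p ≤ 1) (b : Bool) : |bv b - p| ≤ 1 := by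
  rw [abs_le]; constructor <;> cases b <;> simp [bv] <;> linarith

end Expectation

/-! ### Random graphs from independent Bernoulli variables -/

section Model

variable {n : ℕ}

/-- The graph whose edges `uv`, `u < v`, are the ones with `x (u, v) = true`. -/
def graphOf (x : Fin n × Fin n → Bool) : SimpleGraph (Fin n) where
  Adj u v := (u < v ∧ x (u, v) = true) ∨ (v < u ∧ x (v, u) = true)
  symm := ⟨fun _ _ h => h.symm⟩
  loopless := ⟨fun u h => by simp at h⟩

lemma graphOf_adj {x : Fin n × Fin n → Bool} {u v : Fin n} (h : u < v) :
    (graphOf x).Adj u v ↔ x (u, v) = true := by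
  simp [graphOf, h, h.not_gt]

/-- The pairs `u < v`. -/
def pairs (n : ℕ) : Finset (Fin n × Fin n) := Finset.univ.filter fun e => e.1 < e.2

/-- The triples `u < v < w`. -/
def triples (n : ℕ) : Finset (Fin n × Fin n × Fin n) :=
  Finset.univ.filter fun t => t.1 < t.2.1 ∧ t.2.1 < t.2.2

lemma mem_pairs {e : Fin n × Fin n} : e ∈ pairs n ↔ e.1 < e.2 := by simp [pairs]

lemma mem_triples {t : Fin n × Fin n × Fin n} :
    t ∈ triples n ↔ t.1 < t.2.1 ∧ t.2.1 < t.2.2 := by simp [triples]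

/-- The number of triangles of `graphOf x`, as a real number. -/
def tri (x : Fin n × Fin n → Bool) : ℝ :=
  ∑ t ∈ triples n, bv (x (t.1, t.2.1)) * bv (x (t.1, t.2.2)) * bv (x (t.2.1, t.2.2))

lemma ncard_edgeSet_eq (G : SimpleGraph (Fin n)) [DecidableRel G.Adj] :
    G.edgeSet.ncard = ((pairs n).filter fun e => G.Adj e.1 e.2).card := by
  rw [← Set.ncard_coe_finset]
  symm
  refine Set.ncard_congr (fun e _ => s(e.1, e.2)) ?_ ?_ ?_
  · intro e he
    simp only [Finset.coe_filter, Set.mem_ofPred_eq] at he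
    exact he.2
  · rintro ⟨a, b⟩ ⟨c, d⟩ h1 h2 h
    simp only [Finset.coe_filter, Set.mem_ofPred_eq, mem_pairs] at h1 h2
    rw [Sym2.eq_iff] at h
    rcases h with h | h
    · exact Prod.ext h.1 h.2
    · obtain ⟨rfl, rfl⟩ : a = d ∧ b = c := h
      exact absurd h1.1 (not_lt.2 h2.1.le)
  · intro e he
    induction e using Sym2.ind with
    | _ u v =>
      have hA : G.Adj u v := he
      rcases lt_or_gt_of_ne hA.ne with h | h
      · exact ⟨(u, v), by simp [mem_pairs, h, hA], rfl⟩
      · exact ⟨(v, u), by simp [mem_pairs, h, hA.symm], Sym2.eq_swap⟩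

lemma card_pairs (n : ℕ) : (pairs n).card = n.choose 2 := by
  classical
  have h := ncard_edgeSet_eq (⊤ : SimpleGraph (Fin n))
  have h2 : ((pairs n).filter fun e => (⊤ : SimpleGraph (Fin n)).Adj e.1 e.2) = pairs n := by
    refine Finset.filter_true_of_mem fun e he => ?_
    simpa using (mem_pairs.1 he).ne
  rw [h2] at h
  rw [← h, Set.ncard_eq_toFinset_card' _]
  have := SimpleGraph.card_edgeFinset_top_eq_card_choose_two (V := Fin n)
  simpa [SimpleGraph.edgeFinset] using this

/-- The indicator of a given graph is a product over the pairs $u<v$, so its mean factorizes; the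
coordinates $(u,v)$ with $u\ge v$ contribute factors 1. -/
lemma ex_graphOf_eq (p : ℝ) (G : SimpleGraph (Fin n)) :
    ex p (fun x : Fin n × Fin n → Bool => open Classical in if graphOf x = G then (1 : ℝ) else 0)
      = p ^ G.edgeSet.ncard * (1 - p) ^ (n.choose 2 - G.edgeSet.ncard) := by
  classical
  have h : ∀ x : Fin n × Fin n → Bool, (if graphOf x = G then (1 : ℝ) else 0)
      = ∏ e, (if e.1 < e.2 then (if x e = decide (G.Adj e.1 e.2) then 1 else 0) else 1) := by
    intro x
    split_ifs with hx
    · subst hx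
      symm
      refine Finset.prod_eq_one fun e _ => ?_
      by_cases he : e.1 < e.2
      · simp [he, graphOf_adj he]
      · simp [he]
    · symm
      have : ∃ e : Fin n × Fin n, e.1 < e.2 ∧ x e ≠ decide (G.Adj e.1 e.2) := by
        by_contra hc
        push Not at hc
        refine hx (SimpleGraph.ext ?_)
        ext u v
        rcases lt_trichotomy u v with huv | huv | huv
        · simp [graphOf_adj huv, hc (u, v) huv]
        · simp [huv]
        · rw [SimpleGraph.adj_comm, graphOf_adj huv, G.adj_comm, hc (v, u) huv]
          simp
      obtain ⟨e, he, hxe⟩ := this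
      exact Finset.prod_eq_zero (Finset.mem_univ e) (by simp [he, hxe])
  simp only [h]
  rw [ex_prod p (fun (e : Fin n × Fin n) (b : Bool) =>
    if e.1 < e.2 then (if b = decide (G.Adj e.1 e.2) then (1 : ℝ) else 0) else 1)]
  have h2 : ∀ e : Fin n × Fin n,
      (p • (if e.1 < e.2 then (if true = decide (G.Adj e.1 e.2) then (1 : ℝ) else 0) else 1)
      + (1 - p) • (if e.1 < e.2 then (if false = decide (G.Adj e.1 e.2) then (1 : ℝ) else 0) else 1))
      = if e ∈ pairs n then (if G.Adj e.1 e.2 then p else 1 - p) else 1 := by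
    intro e
    by_cases he : e.1 < e.2 <;> by_cases hG : G.Adj e.1 e.2 <;> simp [mem_pairs, he, hG]
  simp only [h2]
  rw [Finset.prod_ite_mem, Finset.univ_inter, Finset.prod_ite, Finset.prod_const, Finset.prod_const,
    ncard_edgeSet_eq, ← card_pairs, Finset.filter_not, Finset.card_sdiff_of_subset
      (Finset.filter_subset _ _)]

instance : MeasurableSingletonClass (SimpleGraph (Fin n)) where
  measurableSet_singleton G := by
    have : ({G} : Set (SimpleGraph (Fin n))) = SimpleGraph.edgeSet ⁻¹' {G.edgeSet} := by
      ext H; simp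
    rw [this]
    exact SimpleGraph.measurable_edgeSet (MeasurableSet.singleton _)

/-- Transfers everything to independent bits indexed by all of `Fin n × Fin n`. The redundant
coordinates do not affect the graph, but they make the index set a full product, as `ex_rows` and
`ex_cols` require. -/
lemma integral_randomGraph (p : unitInterval) (h : SimpleGraph (Fin n) → ℝ) :
    ∫ G, h G ∂(randomGraph n p) = ex (p : ℝ) (fun x : Fin n × Fin n → Bool => h (graphOf x)) := by
  classical
  rw [integral_fintype (Integrable.of_finite)]
  have hs : ∀ G : SimpleGraph (Fin n), (randomGraph n p).real {G}
      = ex (p : ℝ) (fun x : Fin n × Fin n → Bool => if graphOf x = G then (1 : ℝ) else 0) := by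
    intro G
    rw [ex_graphOf_eq, measureReal_def, SimpleGraph.binomialRandom_singleton]
    simp
  simp only [hs, smul_eq_mul, ← ex_mul_right, ← ex_sum]
  congr 1
  ext x
  simp

lemma measureReal_randomGraph (p : unitInterval) (P : SimpleGraph (Fin n) → Prop) [DecidablePred P] :
    (randomGraph n p).real {G | P G}
      = ex (p : ℝ) (fun x : Fin n × Fin n → Bool => if P (graphOf x) then (1 : ℝ) else 0) := by
  rw [← integral_randomGraph p (fun G => if P G then (1 : ℝ) else 0)]
  have : (fun G => if P G then (1 : ℝ) else 0) = Set.indicator {G | P G} 1 := by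
    ext G; simp [Set.indicator]
  rw [this, integral_indicator_one (Set.toFinite _).measurableSet]

lemma card_S (x : Fin n × Fin n → Bool) : (S n (graphOf x) : ℝ) = tri x := by
  classical
  have h1 : tri x = (((triples n).filter fun t => x (t.1, t.2.1) = true ∧ x (t.1, t.2.2) = true ∧
      x (t.2.1, t.2.2) = true).card : ℝ) := by
    rw [tri, Finset.card_filter, Nat.cast_sum]
    refine Finset.sum_congr rfl fun t _ => ?_
    cases x (t.1, t.2.1) <;> cases x (t.1, t.2.2) <;> cases x (t.2.1, t.2.2) <;> simp [bv]
  rw [h1, S, ← Set.ncard_coe_finset]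
  congr 1
  symm
  refine Set.ncard_congr (fun t _ => {t.1, t.2.1, t.2.2}) ?_ ?_ ?_
  · rintro ⟨u, v, w⟩ ht
    simp only [Finset.coe_filter, Set.mem_ofPred_eq, mem_triples] at ht
    obtain ⟨⟨huv, hvw⟩, h1, h2, h3⟩ := ht
    rw [SimpleGraph.mem_cliqueSet_iff, SimpleGraph.is3Clique_triple_iff]
    exact ⟨(graphOf_adj huv).2 h1, (graphOf_adj (huv.trans hvw)).2 h2, (graphOf_adj hvw).2 h3⟩
  · rintro ⟨u, v, w⟩ ⟨a, b, c⟩ h1 h2 h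
    simp only [Finset.coe_filter, Set.mem_ofPred_eq, mem_triples] at h1 h2
    have e := Finset.ext_iff.1 h
    simp only [Finset.mem_insert, Finset.mem_singleton] at e
    have e1 := e u; have e2 := e v; have e3 := e w
    have e4 := e a; have e5 := e b; have e6 := e c
    simp only [true_or, or_true, true_iff, iff_true] at e1 e2 e3 e4 e5 e6
    obtain ⟨⟨huv, hvw⟩, -⟩ := h1
    obtain ⟨⟨hab, hbc⟩, -⟩ := h2
    simp only [Prod.mk.injEq]
    omega
  · intro s hs
    rw [SimpleGraph.mem_cliqueSet_iff, SimpleGraph.is3Clique_iff] at hs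
    obtain ⟨a, b, c, hab, hac, hbc, rfl⟩ := hs
    have key : ∀ a b c : Fin n, a < b → b < c → (graphOf x).Adj a b → (graphOf x).Adj a c →
        (graphOf x).Adj b c → (a, b, c) ∈ (((triples n).filter fun t => x (t.1, t.2.1) = true ∧
          x (t.1, t.2.2) = true ∧ x (t.2.1, t.2.2) = true : Finset _) : Set _) := by
      intro a b c h1 h2 k1 k2 k3
      simp only [Finset.coe_filter, Set.mem_ofPred_eq, mem_triples]
      exact ⟨⟨h1, h2⟩, (graphOf_adj h1).1 k1, (graphOf_adj (h1.trans h2)).1 k2, (graphOf_adj h2).1 k3⟩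
    -- Of the eight sign patterns two are cyclic, hence impossible; the other six are the orderings
    -- of the three vertices.
    rcases lt_or_gt_of_ne hab.ne with h1 | h1 <;> rcases lt_or_gt_of_ne hac.ne with h2 | h2 <;>
      rcases lt_or_gt_of_ne hbc.ne with h3 | h3
    · exact ⟨(a, b, c), key _ _ _ h1 h3 hab hac hbc, rfl⟩
    · exact ⟨(a, c, b), key _ _ _ h2 h3 hac hab hbc.symm, by ext; simp; tauto⟩
    · omega
    · exact ⟨(c, a, b), key _ _ _ h2 h1 hac.symm hbc.symm hab, by ext; simp; tauto⟩
    · exact ⟨(b, a, c), key _ _ _ h1 h2 hab.symm hbc hac, by ext; simp; tauto⟩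
    · omega
    · exact ⟨(b, c, a), key _ _ _ h3 h2 hbc hab.symm hac.symm, by ext; simp; tauto⟩
    · exact ⟨(c, b, a), key _ _ _ h3 h1 hbc.symm hac.symm hab.symm, by ext; simp; tauto⟩

end Model

/-! ### The orthogonal decomposition of the triangle count -/

section Decomposition

variable {n : ℕ}

lemma sum_triples {E : Type*} [AddCommMonoid E] (f : Fin n → Fin n → Fin n → E) :
    ∑ t ∈ triples n, f t.1 t.2.1 t.2.2
      = ∑ u, ∑ v, ∑ w, if u < v ∧ v < w then f u v w else 0 := by
  rw [triples, Finset.sum_filter, Fintype.sum_prod_type]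
  simp only [Fintype.sum_prod_type]

lemma sum_pairs {E : Type*} [AddCommMonoid E] (f : Fin n → Fin n → E) :
    ∑ e ∈ pairs n, f e.1 e.2 = ∑ u, ∑ v, if u < v then f u v else 0 := by
  rw [pairs, Finset.sum_filter, Fintype.sum_prod_type]

/-- Read off from the complete graph, whose triangles are all the 3-element sets. -/
lemma card_triples (n : ℕ) : (triples n).card = n.choose 3 := by
  classical
  have h1 : tri (n := n) (fun _ => true) = (triples n).card := by simp [tri, bv]
  have h2 := card_S (n := n) (fun _ => true)
  rw [h1] at h2
  have h3 : S n (graphOf (n := n) fun _ => true) = n.choose 3 := by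
    have : graphOf (n := n) (fun _ => true) = ⊤ := by
      ext u v; simp [graphOf]
    rw [S, this]
    have : (⊤ : SimpleGraph (Fin n)).cliqueSet 3
        = ((Finset.univ.powersetCard 3 : Finset (Finset (Fin n))) : Set (Finset (Fin n))) := by
      ext s
      simp [SimpleGraph.mem_cliqueSet_iff, SimpleGraph.isNClique_iff, SimpleGraph.IsClique,
        Set.Pairwise]
    rw [this, Set.ncard_coe_finset, Finset.card_powersetCard, Finset.card_univ, Fintype.card_fin]
  rw [h3] at h2
  exact_mod_cast h2.symm

/-- Each pair $a<b$ lies in $n-2$ triples; the third vertex may come after, between or before, which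
gives the three sums. -/
lemma sum_triples_edges (f : Fin n × Fin n → ℝ) :
    ∑ t ∈ triples n, (f (t.1, t.2.1) + f (t.1, t.2.2) + f (t.2.1, t.2.2))
      = ((n : ℝ) - 2) * ∑ e ∈ pairs n, f e := by
  have e1 : ∑ t ∈ triples n, f (t.1, t.2.1)
      = ∑ a, ∑ b, ∑ c, if a < b ∧ b < c then f (a, b) else 0 :=
    sum_triples (fun u v w => f (u, v))
  have e2 : ∑ t ∈ triples n, f (t.1, t.2.2)
      = ∑ a, ∑ b, ∑ c, if a < c ∧ c < b then f (a, b) else 0 := by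
    rw [sum_triples (fun u v w => f (u, w))]
    exact Finset.sum_congr rfl fun _ _ => Finset.sum_comm
  have e3 : ∑ t ∈ triples n, f (t.2.1, t.2.2)
      = ∑ a, ∑ b, ∑ c, if c < a ∧ a < b then f (a, b) else 0 := by
    rw [sum_triples (fun u v w => f (v, w)), Finset.sum_comm]
    exact Finset.sum_congr rfl fun _ _ => Finset.sum_comm
  have e4 : ∑ e ∈ pairs n, f e = ∑ a, ∑ b, if a < b then f (a, b) else 0 :=
    sum_pairs (fun u v => f (u, v))
  rw [Finset.sum_add_distrib, Finset.sum_add_distrib, e1, e2, e3, e4, Finset.mul_sum]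
  simp only [← Finset.sum_add_distrib, Finset.mul_sum]
  refine Finset.sum_congr rfl fun a _ => Finset.sum_congr rfl fun b _ => ?_
  by_cases hab : a < b
  · have hc : ∀ c : Fin n, ((if a < b ∧ b < c then f (a, b) else 0)
        + (if a < c ∧ c < b then f (a, b) else 0) + (if c < a ∧ a < b then f (a, b) else 0))
        = f (a, b) - (if c = a then f (a, b) else 0) - (if c = b then f (a, b) else 0) := by
      intro c
      rcases lt_trichotomy c a with h | h | h
      · have h' := h.trans hab
        simp [h, hab, h.not_gt, h'.not_gt, h.ne, h'.ne]
      · subst h; simp [hab, hab.not_gt, hab.ne]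
      · rcases lt_trichotomy c b with k | k | k
        · simp [h, k, hab, h.not_gt, k.not_gt, h.ne', k.ne]
        · subst k; simp [h, h.not_gt, h.ne']
        · simp [h, k, hab, h.not_gt, k.not_gt, h.ne', k.ne']
    rw [Finset.sum_congr rfl fun c _ => hc c, if_pos hab]
    simp only [Finset.sum_sub_distrib, Finset.sum_const, Finset.card_univ, Fintype.card_fin,
      Finset.sum_ite_eq', Finset.mem_univ, if_true, nsmul_eq_mul]
    ring
  · have hc : ∀ c : Fin n, ¬ (a < c ∧ c < b) := fun c h => hab (h.1.trans h.2)
    simp [hab, hc]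

/-- The centred number of edges. -/
def lin (p : ℝ) (x : Fin n × Fin n → Bool) : ℝ := ∑ e ∈ pairs n, (bv (x e) - p)

/-- The sets of edges occurring in the quadratic and cubic parts of the triangle count. -/
def remEdges : (Fin n × Fin n × Fin n) × Fin 4 → Finset (Fin n × Fin n)
  | (t, 0) => {(t.1, t.2.1), (t.1, t.2.2)}
  | (t, 1) => {(t.1, t.2.1), (t.2.1, t.2.2)}
  | (t, 2) => {(t.1, t.2.2), (t.2.1, t.2.2)}
  | (t, 3) => {(t.1, t.2.1), (t.1, t.2.2), (t.2.1, t.2.2)}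

/-- The coefficients of the quadratic and cubic parts of the triangle count. -/
def remCoeff (p : ℝ) (j : (Fin n × Fin n × Fin n) × Fin 4) : ℝ := if j.2 = 3 then 1 else p

/-- The quadratic and cubic parts of the triangle count. -/
def rem (p : ℝ) (x : Fin n × Fin n → Bool) : ℝ :=
  ∑ j ∈ triples n ×ˢ Finset.univ, remCoeff p j * cen p (remEdges j) x

/-- Two adjacent edges already determine their triangle, so distinct indices give distinct edge sets
and therefore orthogonal terms. -/
lemma remEdges_injOn :
    Set.InjOn (remEdges (n := n)) ((triples n ×ˢ Finset.univ : Finset ((Fin n × Fin n × Fin n) × Fin 4)) : Set _) := by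
  rintro ⟨⟨u, v, w⟩, i⟩ h1 ⟨⟨a, b, c⟩, j⟩ h2 h
  simp only [Finset.coe_product, Set.mem_prod, Finset.mem_coe, mem_triples] at h1 h2
  obtain ⟨⟨huv, hvw⟩, -⟩ := h1
  obtain ⟨⟨hab, hbc⟩, -⟩ := h2
  have e := Finset.ext_iff.1 h
  have e1 := e (u, v); have e2 := e (u, w); have e3 := e (v, w)
  have e4 := e (a, b); have e5 := e (a, c); have e6 := e (b, c)
  clear e h
  simp only [Prod.mk.injEq]
  fin_cases i <;> fin_cases j <;>
    simp only [remEdges, Finset.mem_insert, Finset.mem_singleton, Prod.mk.injEq, Fin.ext_iff,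
      true_and, and_true, true_or, or_true, iff_def, forall_const,
      implies_true] at e1 e2 e3 e4 e5 e6 ⊢ <;>
    omega

lemma card_remEdges {j : (Fin n × Fin n × Fin n) × Fin 4} (hj : j.1 ∈ triples n) :
    2 ≤ (remEdges j).card := by
  obtain ⟨⟨u, v, w⟩, i⟩ := j
  simp only [mem_triples] at hj
  have h1 := hj.1.ne
  have h2 := hj.2.ne
  fin_cases i <;> simp only [remEdges]
  · rw [Finset.card_pair]; simp [h2]
  · rw [Finset.card_pair]; simp [h1]
  · rw [Finset.card_pair]; simp [h1]
  · rw [← Finset.card_pair (a := (u, v)) (b := (u, w)) (by simp [h2])]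
    refine Finset.card_le_card fun x hx => ?_
    simp only [Finset.mem_insert, Finset.mem_singleton] at hx ⊢
    tauto

/-- The orthogonal (Hoeffding) decomposition: write each indicator as $p$ plus a centred variable
and expand the product over each triangle. The factor $n-2$ counts the triangles through an edge. -/
lemma tri_eq (p : ℝ) (x : Fin n × Fin n → Bool) :
    tri x = p ^ 3 * (n.choose 3 : ℝ) + p ^ 2 * ((n : ℝ) - 2) * lin p x + rem p x := by
  have h1 : rem p x = ∑ t ∈ triples n,
      (p * ((bv (x (t.1, t.2.1)) - p) * (bv (x (t.1, t.2.2)) - p))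
      + p * ((bv (x (t.1, t.2.1)) - p) * (bv (x (t.2.1, t.2.2)) - p))
      + p * ((bv (x (t.1, t.2.2)) - p) * (bv (x (t.2.1, t.2.2)) - p))
      + (bv (x (t.1, t.2.1)) - p) * (bv (x (t.1, t.2.2)) - p) * (bv (x (t.2.1, t.2.2)) - p)) := by
    rw [rem, Finset.sum_product]
    refine Finset.sum_congr rfl fun t ht => ?_
    obtain ⟨u, v, w⟩ := t
    simp only [mem_triples] at ht
    have k1 := ht.1.ne
    have k2 := ht.2.ne
    rw [Fin.sum_univ_four]
    simp only [remCoeff, remEdges, cen]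
    rw [Finset.prod_pair (by simp [k2]), Finset.prod_pair (by simp [k1]),
      Finset.prod_pair (by simp [k1]), Finset.prod_insert (by simp [k1, k2]),
      Finset.prod_pair (by simp [k1])]
    simp
    ring
  have h2 := sum_triples_edges (fun e : Fin n × Fin n => bv (x e) - p)
  have h3 : p ^ 3 * (n.choose 3 : ℝ) = ∑ t ∈ triples n, p ^ 3 := by
    rw [Finset.sum_const, card_triples, nsmul_eq_mul, mul_comm]
  rw [mul_assoc, lin, ← h2, h1, h3, Finset.mul_sum, ← Finset.sum_add_distrib,
    ← Finset.sum_add_distrib, tri]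
  refine Finset.sum_congr rfl fun t _ => ?_
  ring

lemma lin_eq (p : ℝ) (x : Fin n × Fin n → Bool) :
    lin p x = ∑ e ∈ pairs n, 1 * cen p {e} x := by
  simp [lin, cen]

lemma ex_lin (p : ℝ) : ex p (lin (n := n) p) = 0 := by
  simp only [funext (lin_eq (n := n) p), ex_sum, ex_mul_left]
  refine Finset.sum_eq_zero fun e _ => ?_
  have := ex_cen (p := p) (Finset.singleton_nonempty e)
  simp [this]

lemma ex_rem (p : ℝ) : ex p (rem (n := n) p) = 0 := by
  have h : rem (n := n) p = fun x => ∑ j ∈ triples n ×ˢ Finset.univ,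
      remCoeff p j * cen p (remEdges j) x := rfl
  simp only [h, ex_sum, ex_mul_left]
  refine Finset.sum_eq_zero fun j hj => ?_
  have h2 := card_remEdges (Finset.mem_product.1 hj).1
  have := ex_cen (p := p) (A := remEdges j) (Finset.card_pos.1 (by omega))
  simp [this]

lemma ex_lin_sq (p : ℝ) :
    ex p (fun x => lin (n := n) p x ^ 2) = n.choose 2 * (p * (1 - p)) := by
  simp only [lin_eq]
  rw [ex_sq_sum_cen p (pairs n) (fun e => {e}) (by simp [Set.InjOn])]
  simp [card_pairs]

/-- Terms of the linear part live on one edge, those of the remainder on at least two, so the edge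
sets never coincide. -/
lemma ex_lin_mul_rem (p : ℝ) : ex p (fun x => lin (n := n) p x * rem p x) = 0 := by
  simp only [lin_eq, rem, Finset.sum_mul_sum, ex_sum]
  refine Finset.sum_eq_zero fun e _ => Finset.sum_eq_zero fun j hj => ?_
  have : ∀ x : Fin n × Fin n → Bool, 1 * cen p {e} x * (remCoeff p j * cen p (remEdges j) x)
      = remCoeff p j * (cen p {e} x * cen p (remEdges j) x) := fun x => by ring
  simp only [this, ex_mul_left, ex_cen_mul_cen]
  have h2 := card_remEdges (Finset.mem_product.1 hj).1
  rw [if_neg, mul_zero]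
  intro h
  rw [← h] at h2
  simp at h2

/-- There are $4\binom n3\le n^3$ orthogonal terms, each of second moment at most 1. This is smaller
by a factor $n$ than the variance of the linear part. -/
lemma ex_rem_sq_le {p : ℝ} (h0 : 0 ≤ p) (h1 : p ≤ 1) :
    ex p (fun x => rem (n := n) p x ^ 2) ≤ (n : ℝ) ^ 3 := by
  simp only [rem]
  rw [ex_sq_sum_cen p _ _ remEdges_injOn]
  have h2 : ∀ j ∈ triples n ×ˢ (Finset.univ : Finset (Fin 4)),
      remCoeff p j ^ 2 * (p * (1 - p)) ^ (remEdges j).card ≤ 1 := by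
    intro j _
    refine mul_le_one₀ ?_ (by positivity [sub_nonneg.2 h1]) ?_
    · unfold remCoeff; split_ifs
      · simp
      · exact pow_le_one₀ h0 h1
    · exact pow_le_one₀ (mul_nonneg h0 (sub_nonneg.2 h1)) (by nlinarith)
  refine (Finset.sum_le_card_nsmul _ _ 1 h2).trans ?_
  rw [Finset.card_product, card_triples]
  have h3 : n.choose 3 * 6 ≤ n ^ 3 := by
    have := Nat.choose_le_pow_div (α := ℝ) 3 n
    have h6 : ((Nat.factorial 3 : ℕ) : ℝ) = 6 := by norm_num [Nat.factorial]
    rw [h6, le_div_iff₀ (by norm_num)] at this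
    exact_mod_cast this
  have h4 : n.choose 3 * 4 ≤ n ^ 3 := by omega
  simp only [Finset.card_univ, Fintype.card_fin, nsmul_eq_mul, mul_one]
  exact_mod_cast h4

lemma ex_tri (p : ℝ) : ex p (tri (n := n)) = p ^ 3 * (n.choose 3 : ℝ) := by
  simp only [funext (tri_eq (n := n) p), ex_add, ex_mul_left, ex_const]
  have h1 := ex_lin (n := n) p
  have h2 := ex_rem (n := n) p
  simp [h1, h2]

lemma ex_tri_sub_sq (p : ℝ) :
    ex p (fun x => (tri (n := n) x - p ^ 3 * (n.choose 3 : ℝ)) ^ 2)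
      = p ^ 4 * ((n : ℝ) - 2) ^ 2 * (n.choose 2 * (p * (1 - p)))
        + ex p (fun x => rem (n := n) p x ^ 2) := by
  have : ∀ x, (tri (n := n) x - p ^ 3 * (n.choose 3 : ℝ)) ^ 2
      = (p ^ 4 * ((n : ℝ) - 2) ^ 2) * (lin p x ^ 2)
        + (2 * p ^ 2 * ((n : ℝ) - 2)) * (lin p x * rem p x) + rem p x ^ 2 := by
    intro x; rw [tri_eq p]; ring
  simp only [this, ex_add, ex_mul_left, ex_lin_mul_rem, ex_lin_sq]
  ring

lemma mean_S (p : unitInterval) : ∫ G, (S n G : ℝ) ∂(randomGraph n p) = mu n p := by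
  rw [integral_randomGraph p (fun G => (S n G : ℝ))]
  simp only [card_S]
  exact ex_tri (p : ℝ)

lemma variance_S (p : unitInterval) :
    variance (fun G => (S n G : ℝ)) (randomGraph n p)
      = (p : ℝ) ^ 4 * ((n : ℝ) - 2) ^ 2 * (n.choose 2 * ((p : ℝ) * (1 - p)))
        + ex (p : ℝ) (fun x => rem (n := n) p x ^ 2) := by
  rw [variance_eq_integral (measurable_of_finite _).aemeasurable, mean_S,
    integral_randomGraph p (fun G => ((S n G : ℝ) - mu n p) ^ 2), ← ex_tri_sub_sq]
  simp only [card_S, mu]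

lemma sigma_sq (p : unitInterval) :
    sigma n p ^ 2 = (p : ℝ) ^ 4 * ((n : ℝ) - 2) ^ 2 * (n.choose 2 * ((p : ℝ) * (1 - p)))
        + ex (p : ℝ) (fun x => rem (n := n) p x ^ 2) := by
  rw [sigma, Real.sq_sqrt (variance_nonneg _ _), variance_S]

end Decomposition

/-! ### The characteristic function near the origin -/

section Characteristic

variable {n : ℕ}

/-- The characteristic function of the centred triangle count. -/
def phi (n : ℕ) (p θ : ℝ) : ℂ :=
  ex p (fun x : Fin n × Fin n → Bool =>
    Complex.exp ((θ * (tri x - p ^ 3 * (n.choose 3 : ℝ)) : ℝ) * Complex.I))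

lemma norm_exp_sub_le (a b : ℝ) :
    ‖Complex.exp ((a + b : ℝ) * Complex.I) - Complex.exp ((a : ℝ) * Complex.I)‖ ≤ |b| := by
  have : Complex.exp ((a + b : ℝ) * Complex.I) - Complex.exp ((a : ℝ) * Complex.I)
      = Complex.exp ((a : ℝ) * Complex.I) * (Complex.exp (Complex.I * b) - 1) := by
    rw [mul_sub, ← Complex.exp_add]; push_cast; ring_nf
  rw [this, norm_mul, Complex.norm_exp_ofReal_mul_I, one_mul]
  exact Real.norm_exp_I_mul_ofReal_sub_one_le

/-- The characteristic function of a centred Bernoulli variable. -/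
def chi (p s : ℝ) : ℂ :=
  p • Complex.exp ((s * (1 - p) : ℝ) * Complex.I)
    + (1 - p) • Complex.exp ((s * (0 - p) : ℝ) * Complex.I)

lemma norm_chi_le {p : ℝ} (h0 : 0 ≤ p) (h1 : p ≤ 1) (s : ℝ) : ‖chi p s‖ ≤ 1 := by
  refine (norm_add_le _ _).trans ?_
  rw [norm_smul, norm_smul, Complex.norm_exp_ofReal_mul_I, Complex.norm_exp_ofReal_mul_I,
    Real.norm_of_nonneg h0, Real.norm_of_nonneg (sub_nonneg.2 h1)]
  linarith

lemma norm_exp_taylor {x : ℝ} (hx : |x| ≤ 1) :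
    ‖Complex.exp ((x : ℝ) * Complex.I) - (1 + x * Complex.I - x ^ 2 / 2)‖ ≤ |x| ^ 3 := by
  have hn : ‖(x : ℂ) * Complex.I‖ = |x| := by simp
  have h := Complex.exp_bound (x := (x : ℂ) * Complex.I) (by rw [hn]; exact hx) (n := 3) (by norm_num)
  rw [hn] at h
  have e : ∑ m ∈ Finset.range 3, ((x : ℂ) * Complex.I) ^ m / (m.factorial : ℂ)
      = 1 + x * Complex.I - x ^ 2 / 2 := by
    simp [Finset.sum_range_succ, Nat.factorial, mul_pow]
    ring
  rw [e] at h
  refine h.trans ?_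
  have : (0 : ℝ) ≤ |x| ^ 3 := by positivity
  norm_num [Nat.factorial]
  nlinarith

/-- For $|s|\le1$ both functions agree to second order: the mean is zero and the variance is
$p(1-p)$. For $|s|>1$ the trivial bound 2 is enough. -/
lemma norm_chi_sub_le {p : ℝ} (h0 : 0 ≤ p) (h1 : p ≤ 1) (s : ℝ) :
    ‖chi p s - (Real.exp (-(p * (1 - p) * s ^ 2 / 2)) : ℝ)‖ ≤ 2 * |s| ^ 3 := by
  have hq : 0 ≤ 1 - p := sub_nonneg.2 h1
  have hpq : p * (1 - p) ≤ 1 := by nlinarith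
  rcases le_or_gt |s| 1 with hs | hs
  · have hx1 : |s * (1 - p)| ≤ |s| := by
      rw [abs_mul, abs_of_nonneg hq]; exact mul_le_of_le_one_right (abs_nonneg _) (by linarith)
    have hx2 : |s * (0 - p)| ≤ |s| := by
      rw [abs_mul, zero_sub, abs_neg, abs_of_nonneg h0]
      exact mul_le_of_le_one_right (abs_nonneg _) h1
    have t1 := norm_exp_taylor (hx1.trans hs)
    have t2 := norm_exp_taylor (hx2.trans hs)
    set y : ℝ := p * (1 - p) * s ^ 2 / 2 with hy
    have hs2 : s ^ 2 ≤ 1 := by rw [← sq_abs]; exact pow_le_one₀ (abs_nonneg _) hs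
    have hy0 : 0 ≤ y := by positivity
    have hys : y ≤ s ^ 2 / 2 := by
      rw [hy]; nlinarith [sq_nonneg s]
    have t3 : |Real.exp (-y) - 1 - (-y)| ≤ (-y) ^ 2 := by
      have := Real.norm_exp_sub_one_sub_id_le (x := -y) (by
        rw [Real.norm_eq_abs, abs_neg, abs_of_nonneg hy0]; linarith)
      simpa using this
    have t3' : ‖((Real.exp (-y) : ℝ) : ℂ) - (1 - y)‖ ≤ |s| ^ 3 := by
      have : ((Real.exp (-y) : ℝ) : ℂ) - (1 - y) = ((Real.exp (-y) - 1 - (-y) : ℝ) : ℂ) := by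
        push_cast; ring
      rw [this, Complex.norm_real, Real.norm_eq_abs]
      refine t3.trans ?_
      have h4 : (-y) ^ 2 ≤ (s ^ 2 / 2) ^ 2 := by rw [neg_sq]; gcongr
      have h5 : (s ^ 2 / 2) ^ 2 = |s| ^ 3 * (|s| / 4) := by
        rw [← sq_abs s]; ring
      rw [h5] at h4
      refine h4.trans (mul_le_of_le_one_right (by positivity) (by linarith))
    have key : chi p s - ((Real.exp (-y) : ℝ) : ℂ)
        = p • (Complex.exp ((s * (1 - p) : ℝ) * Complex.I)
            - (1 + (s * (1 - p) : ℝ) * Complex.I - ((s * (1 - p) : ℝ) : ℂ) ^ 2 / 2))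
          + (1 - p) • (Complex.exp ((s * (0 - p) : ℝ) * Complex.I)
            - (1 + (s * (0 - p) : ℝ) * Complex.I - ((s * (0 - p) : ℝ) : ℂ) ^ 2 / 2))
          - (((Real.exp (-y) : ℝ) : ℂ) - (1 - y)) := by
      rw [chi, hy]
      simp only [Complex.real_smul]
      push_cast
      ring
    rw [key]
    refine (norm_sub_le _ _).trans ?_
    refine (add_le_add (norm_add_le _ _) t3').trans ?_
    rw [norm_smul, norm_smul, Real.norm_of_nonneg h0, Real.norm_of_nonneg hq]
    have a1 : |s * (1 - p)| ^ 3 ≤ |s| ^ 3 := by gcongr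
    have a2 : |s * (0 - p)| ^ 3 ≤ |s| ^ 3 := by gcongr
    have b1 := mul_le_mul_of_nonneg_left (t1.trans a1) h0
    have b2 := mul_le_mul_of_nonneg_left (t2.trans a2) hq
    linarith
  · refine (norm_sub_le _ _).trans ?_
    have h3 : (1 : ℝ) ≤ |s| ^ 3 := one_le_pow₀ hs.le
    have h4 : Real.exp (-(p * (1 - p) * s ^ 2 / 2)) ≤ 1 := Real.exp_le_one_iff.2 (by
      have : 0 ≤ p * (1 - p) * s ^ 2 := by positivity
      linarith)
    rw [Complex.norm_real, Real.norm_of_nonneg (Real.exp_pos _).le]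
    linarith [norm_chi_le h0 h1 s]

lemma norm_pow_sub_pow_le_of_le_one {𝕜 : Type*} [NormedField 𝕜] {a b : 𝕜} (ha : ‖a‖ ≤ 1) (hb : ‖b‖ ≤ 1) (N : ℕ) :
    ‖a ^ N - b ^ N‖ ≤ N * ‖a - b‖ := by
  induction N with
  | zero => simp
  | succ N ih =>
    have : a ^ (N + 1) - b ^ (N + 1) = a ^ N * (a - b) + (a ^ N - b ^ N) * b := by ring
    rw [this]
    refine (norm_add_le _ _).trans ?_
    rw [norm_mul, norm_mul, norm_pow]
    have h1 : ‖a‖ ^ N * ‖a - b‖ ≤ 1 * ‖a - b‖ := by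
      gcongr; exact pow_le_one₀ (norm_nonneg _) ha
    have h2 : ‖a ^ N - b ^ N‖ * ‖b‖ ≤ (N * ‖a - b‖) * 1 := by gcongr
    push_cast
    linarith

lemma ex_exp_lin (p s : ℝ) :
    ex p (fun x : Fin n × Fin n → Bool => Complex.exp ((s * lin p x : ℝ) * Complex.I))
      = chi p s ^ n.choose 2 := by
  have h : ∀ x : Fin n × Fin n → Bool, Complex.exp ((s * lin p x : ℝ) * Complex.I)
      = ∏ e, if e ∈ pairs n then Complex.exp ((s * (bv (x e) - p) : ℝ) * Complex.I) else 1 := by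
    intro x
    rw [Finset.prod_ite_mem, Finset.univ_inter, ← Complex.exp_sum, lin, Finset.mul_sum]
    push_cast
    rw [Finset.sum_mul]
  simp only [h]
  rw [ex_prod p (fun e b => if e ∈ pairs n then
    Complex.exp ((s * (bv b - p) : ℝ) * Complex.I) else 1)]
  have h2 : ∀ e : Fin n × Fin n,
      (p • (if e ∈ pairs n then Complex.exp ((s * (bv true - p) : ℝ) * Complex.I) else 1)
      + (1 - p) • (if e ∈ pairs n then Complex.exp ((s * (bv false - p) : ℝ) * Complex.I) else 1))
      = if e ∈ pairs n then chi p s else 1 := by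
    intro e
    by_cases he : e ∈ pairs n
    · simp [he, chi, bv]
    · simp [he]
  simp only [h2]
  rw [Finset.prod_ite_mem, Finset.univ_inter, Finset.prod_const, card_pairs]

lemma abs_exp_neg_sub_le {u v : ℝ} (hu : 0 ≤ u) (huv : u ≤ v) :
    |Real.exp (-u) - Real.exp (-v)| ≤ v - u := by
  have h1 : Real.exp (-v) ≤ Real.exp (-u) := Real.exp_le_exp.2 (by linarith)
  rw [abs_of_nonneg (by linarith)]
  have h2 : Real.exp (-u) - Real.exp (-v) = Real.exp (-u) * (1 - Real.exp (-(v - u))) := by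
    rw [mul_sub, ← Real.exp_add]; ring_nf
  have h3 : 1 - Real.exp (-(v - u)) ≤ v - u := by
    have := Real.add_one_le_exp (-(v - u)); linarith
  have h4 : Real.exp (-u) ≤ 1 := Real.exp_le_one_iff.2 (by linarith)
  have h5 : 0 ≤ 1 - Real.exp (-(v - u)) := by
    have : Real.exp (-(v - u)) ≤ 1 := Real.exp_le_one_iff.2 (by linarith)
    linarith
  rw [h2]
  nlinarith [Real.exp_pos (-u)]

/-- The three errors come from discarding the remainder (via $\mathbb E|\mathrm{rem}|\le n^{3/2}$),
from replacing each Bernoulli factor by a Gaussian one, and from correcting the variance. -/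
lemma norm_phi_sub_gaussian_le (hn : 2 ≤ n) (p : unitInterval) (θ : ℝ) :
    ‖phi n p θ - (Real.exp (-(sigma n p ^ 2 * θ ^ 2 / 2)) : ℝ)‖
      ≤ |θ| * Real.sqrt ((n : ℝ) ^ 3) + 2 * (n : ℝ) ^ 5 * |θ| ^ 3 + (n : ℝ) ^ 3 * θ ^ 2 := by
  obtain ⟨p, h0, h1⟩ := p
  set P : unitInterval := ⟨p, h0, h1⟩
  change ‖phi n p θ - (Real.exp (-(sigma n P ^ 2 * θ ^ 2 / 2)) : ℝ)‖ ≤ _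
  have hn' : (2 : ℝ) ≤ n := by exact_mod_cast hn
  have hq : 0 ≤ 1 - p := sub_nonneg.2 h1
  set s : ℝ := θ * (p ^ 2 * ((n : ℝ) - 2)) with hs
  have hsabs : |s| ≤ |θ| * n := by
    rw [hs, abs_mul, abs_of_nonneg (a := p ^ 2 * ((n : ℝ) - 2)) (by
      have := sub_nonneg.2 hn'; positivity)]
    gcongr
    have : p ^ 2 ≤ 1 := pow_le_one₀ h0 h1
    nlinarith
  -- discarding the quadratic and cubic parts
  have a1 : ‖phi n p θ - chi p s ^ n.choose 2‖ ≤ |θ| * Real.sqrt ((n : ℝ) ^ 3) := by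
    rw [← ex_exp_lin p s, phi, ← ex_sub]
    refine (norm_ex_le h0 h1 _).trans ?_
    have b1 : ∀ x : Fin n × Fin n → Bool,
        ‖Complex.exp ((θ * (tri x - p ^ 3 * (n.choose 3 : ℝ)) : ℝ) * Complex.I)
          - Complex.exp ((s * lin p x : ℝ) * Complex.I)‖ ≤ |θ| * |rem p x| := by
      intro x
      have : θ * (tri x - p ^ 3 * (n.choose 3 : ℝ)) = s * lin p x + θ * rem p x := by
        rw [tri_eq p, hs]; ring
      rw [this, ← abs_mul]
      exact norm_exp_sub_le _ _
    refine (ex_mono h0 h1 b1).trans ?_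
    rw [ex_mul_left]
    refine mul_le_mul_of_nonneg_left ?_ (abs_nonneg _)
    refine Real.le_sqrt_of_sq_le ((sq_ex_le h0 h1 _).trans ?_)
    simp only [sq_abs]
    exact ex_rem_sq_le h0 h1
  -- the central limit theorem for the linear part
  set b : ℂ := ((Real.exp (-(p * (1 - p) * s ^ 2 / 2)) : ℝ) : ℂ) with hb
  have hb1 : ‖b‖ ≤ 1 := by
    rw [hb, Complex.norm_real, Real.norm_of_nonneg (Real.exp_pos _).le]
    exact Real.exp_le_one_iff.2 (by have : 0 ≤ p * (1 - p) * s ^ 2 := by positivity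
                                    linarith)
  have hN : (n.choose 2 : ℝ) ≤ (n : ℝ) ^ 2 := by exact_mod_cast Nat.choose_le_pow n 2
  have a2 : ‖chi p s ^ n.choose 2 - b ^ n.choose 2‖ ≤ 2 * (n : ℝ) ^ 5 * |θ| ^ 3 := by
    refine (norm_pow_sub_pow_le_of_le_one (norm_chi_le h0 h1 s) hb1 _).trans ?_
    calc (n.choose 2 : ℝ) * ‖chi p s - b‖ ≤ (n : ℝ) ^ 2 * (2 * (|θ| * n) ^ 3) := by
          refine mul_le_mul hN ((norm_chi_sub_le h0 h1 s).trans ?_) (norm_nonneg _) (by positivity)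
          gcongr
      _ = _ := by ring
  -- The variance of the linear part falls short of $\sigma_n^2$ by the second moment of the
  -- remainder only.
  have a3 : ‖b ^ n.choose 2 - (Real.exp (-(sigma n P ^ 2 * θ ^ 2 / 2)) : ℝ)‖
      ≤ (n : ℝ) ^ 3 * θ ^ 2 := by
    rw [hb, ← Complex.ofReal_pow, ← Complex.ofReal_sub, Complex.norm_real, Real.norm_eq_abs,
      ← Real.exp_nat_mul, mul_neg]
    have hr := ex_rem_sq_le (n := n) h0 h1
    have hr0 := ex_nonneg h0 h1 (f := fun x => rem (n := n) p x ^ 2) (fun x => sq_nonneg _)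
    have hsig := sigma_sq (n := n) P
    change _ = p ^ 4 * ((n : ℝ) - 2) ^ 2 * (n.choose 2 * (p * (1 - p))) + ex p _ at hsig
    have e : sigma n P ^ 2 * θ ^ 2 / 2 = n.choose 2 * (p * (1 - p) * s ^ 2 / 2)
        + θ ^ 2 * ex p (fun x => rem (n := n) p x ^ 2) / 2 := by
      rw [hsig, hs]; ring
    refine (abs_exp_neg_sub_le (by positivity) ?_).trans ?_
    · rw [e]; have : 0 ≤ θ ^ 2 * ex p (fun x => rem (n := n) p x ^ 2) := by positivity
      linarith
    · rw [e]
      nlinarith [sq_nonneg θ]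
  calc _ = ‖(phi n p θ - chi p s ^ n.choose 2) + (chi p s ^ n.choose 2 - b ^ n.choose 2)
        + (b ^ n.choose 2 - (Real.exp (-(sigma n P ^ 2 * θ ^ 2 / 2)) : ℝ))‖ := by ring_nf
    _ ≤ _ := (norm_add_le _ _).trans (add_le_add ((norm_add_le _ _).trans (add_le_add a1 a2)) a3)

end Characteristic

/-! ### Characteristic functions of linear and quadratic forms -/

section Forms

variable {ι : Type*} [Fintype ι] [DecidableEq ι]

/-- $|\chi|^2$ is the characteristic function of the difference of two independent copies, which is
$\pm1$ with total probability $2p(1-p)$ and 0 otherwise. -/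
lemma norm_chi_sq (p s : ℝ) : ‖chi p s‖ ^ 2 = 1 - 2 * (p * (1 - p)) * (1 - Real.cos s) := by
  rw [← Complex.normSq_eq_norm_sq, Complex.normSq_apply, chi]
  simp only [Complex.real_smul, Complex.add_re, Complex.add_im, Complex.re_ofReal_mul,
    Complex.im_ofReal_mul, Complex.exp_ofReal_mul_I_re, Complex.exp_ofReal_mul_I_im]
  have h : Real.cos s = Real.cos (s * (1 - p)) * Real.cos (s * (0 - p))
      + Real.sin (s * (1 - p)) * Real.sin (s * (0 - p)) := by
    rw [← Real.cos_sub]; ring_nf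
  have h1 := Real.sin_sq_add_cos_sq (s * (1 - p))
  have h2 := Real.sin_sq_add_cos_sq (s * (0 - p))
  rw [h]
  linear_combination p ^ 2 * h1 + (1 - p) ^ 2 * h2

lemma norm_chi_le_exp (p s : ℝ) :
    ‖chi p s‖ ≤ Real.exp (-(p * (1 - p) * (1 - Real.cos s))) := by
  refine le_of_sq_le_sq ?_ (Real.exp_pos _).le
  rw [norm_chi_sq, ← Real.exp_nat_mul]
  have := Real.add_one_le_exp (((2 : ℕ) : ℝ) * -(p * (1 - p) * (1 - Real.cos s)))
  push_cast at this ⊢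
  linarith

lemma norm_chi_le_exp_sq {p : ℝ} (h0 : 0 ≤ p) (h1 : p ≤ 1) {s D : ℝ} (hs : |s| ≤ Real.pi)
    (hD : 0 ≤ D) (hDs : D ≤ |s|) :
    ‖chi p s‖ ≤ Real.exp (-(p * (1 - p) * (2 / Real.pi ^ 2 * D ^ 2))) := by
  refine (norm_chi_le_exp p s).trans (Real.exp_le_exp.2 ?_)
  have h := Real.cos_le_one_sub_mul_cos_sq hs
  have h2 : 2 / Real.pi ^ 2 * D ^ 2 ≤ 2 / Real.pi ^ 2 * s ^ 2 := by
    rw [← sq_abs s]; gcongr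
  have hpq : 0 ≤ p * (1 - p) := mul_nonneg h0 (sub_nonneg.2 h1)
  have := mul_le_mul_of_nonneg_left (h2.trans (by linarith : _ ≤ 1 - Real.cos s)) hpq
  linarith

/-- The expectation factorizes over the indices. A prefactor `cen p A` spoils only the factors
indexed by `A`, and these still have norm at most 1. -/
lemma norm_ex_cen_mul_exp_le {p : ℝ} (h0 : 0 ≤ p) (h1 : p ≤ 1) (A F : Finset ι) (l : ι → ℝ) :
    ‖ex p (fun x : ι → Bool => (cen p A x : ℂ)
      * Complex.exp ((∑ i ∈ F, l i * (bv (x i) - p) : ℝ) * Complex.I))‖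
      ≤ ∏ i ∈ F \ A, ‖chi p (l i)‖ := by
  have h : ∀ x : ι → Bool, (cen p A x : ℂ)
      * Complex.exp ((∑ i ∈ F, l i * (bv (x i) - p) : ℝ) * Complex.I)
      = ∏ i, (if i ∈ A then ((bv (x i) - p : ℝ) : ℂ) else 1)
        * (if i ∈ F then Complex.exp ((l i * (bv (x i) - p) : ℝ) * Complex.I) else 1) := by
    intro x
    rw [Finset.prod_mul_distrib, Finset.prod_ite_mem, Finset.univ_inter, Finset.prod_ite_mem,
      Finset.univ_inter, ← Complex.exp_sum, cen]
    push_cast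
    rw [Finset.sum_mul]
  simp only [h]
  rw [ex_prod p (fun i b => (if i ∈ A then ((bv b - p : ℝ) : ℂ) else 1)
        * (if i ∈ F then Complex.exp ((l i * (bv b - p) : ℝ) * Complex.I) else 1)), norm_prod,
    ← Finset.prod_sdiff (Finset.subset_univ (F \ A)), mul_comm]
  have hq := sub_nonneg.2 h1
  refine (mul_le_of_le_one_right (by positivity) ?_).trans
    (Finset.prod_le_prod (fun _ _ => norm_nonneg _) ?_)
  · refine Finset.prod_le_one (fun _ _ => norm_nonneg _) fun i _ => ?_
    refine (norm_add_le _ _).trans ?_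
    have key : ∀ b : Bool, ‖(if i ∈ A then ((bv b - p : ℝ) : ℂ) else 1)
        * (if i ∈ F then Complex.exp ((l i * (bv b - p) : ℝ) * Complex.I) else 1)‖ ≤ 1 := by
      intro b
      rw [norm_mul]
      refine mul_le_one₀ ?_ (norm_nonneg _) ?_
      · split_ifs
        · rw [Complex.norm_real]; exact abs_bv_sub_le h0 h1 b
        · simp
      · split_ifs
        · rw [Complex.norm_exp_ofReal_mul_I]
        · simp
    rw [norm_smul, norm_smul, Real.norm_of_nonneg h0, Real.norm_of_nonneg hq]
    have := mul_le_mul_of_nonneg_left (key true) h0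
    have := mul_le_mul_of_nonneg_left (key false) hq
    linarith
  · intro i hi
    rw [Finset.mem_sdiff] at hi
    simp [hi.1, hi.2, chi, bv]

lemma norm_exp_sub_one_sub_le (a : ℝ) :
    ‖Complex.exp ((a : ℝ) * Complex.I) - 1 - a * Complex.I‖ ≤ 2 * a ^ 2 := by
  have hn : ‖(a : ℂ) * Complex.I‖ = |a| := by simp
  rcases le_or_gt |a| 1 with ha | ha
  · have := Complex.norm_exp_sub_one_sub_id_le (x := (a : ℂ) * Complex.I) (by rw [hn]; exact ha)
    rw [hn, sq_abs] at this
    nlinarith [sq_nonneg a]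
  · refine (norm_sub_le _ _).trans ?_
    have h := norm_exp_sub_le 0 a
    simp only [zero_add, Complex.ofReal_zero, zero_mul, Complex.exp_zero] at h
    rw [hn, ← sq_abs]
    nlinarith

/-- With $Q$ the quadratic part, $e^{iQ}=1+iQ+O(Q^2)$. The first two terms keep the product decay of
the linear part, losing at most the two factors in `T j`; this explains the exponent `F.card - 2`.
The last term has no decay, but $\mathbb E Q^2\le G^2|J|$ by orthogonality. -/
lemma norm_ex_exp_quadratic_le {κ : Type*} {p : ℝ} (h0 : 0 ≤ p) (h1 : p ≤ 1) (K : ℝ) (F : Finset ι)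
    (l : ι → ℝ) (J : Finset κ) (T : κ → Finset ι) (hT : Set.InjOn T J)
    (hT2 : ∀ j ∈ J, (T j).card = 2) (g : κ → ℝ) {G r : ℝ} (hg : ∀ j ∈ J, |g j| ≤ G)
    (hr0 : 0 ≤ r) (hr1 : r ≤ 1) (hr : ∀ i ∈ F, ‖chi p (l i)‖ ≤ r) :
    ‖ex p (fun x : ι → Bool => Complex.exp ((K + ∑ i ∈ F, l i * (bv (x i) - p)
        + ∑ j ∈ J, g j * cen p (T j) x : ℝ) * Complex.I))‖
      ≤ r ^ (F.card - 2) * (1 + G * J.card) + 2 * G ^ 2 * J.card := by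
  have hq := sub_nonneg.2 h1
  set Lf : (ι → Bool) → ℂ := fun x =>
    Complex.exp ((∑ i ∈ F, l i * (bv (x i) - p) : ℝ) * Complex.I) with hLf
  set Q : (ι → Bool) → ℝ := fun x => ∑ j ∈ J, g j * cen p (T j) x with hQ
  have hprod : ∀ A : Finset ι, A.card ≤ 2 →
      ‖ex p (fun x : ι → Bool => (cen p A x : ℂ) * Lf x)‖ ≤ r ^ (F.card - 2) := by
    intro A hA
    refine (norm_ex_cen_mul_exp_le h0 h1 A F l).trans ?_
    refine (Finset.prod_le_prod (fun _ _ => norm_nonneg _)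
      fun i hi => hr i (Finset.mem_sdiff.1 hi).1).trans ?_
    rw [Finset.prod_const]
    refine pow_le_pow_of_le_one hr0 hr1 ?_
    have := Finset.le_card_sdiff A F
    omega
  have e1 : (fun x : ι → Bool => Complex.exp ((K + ∑ i ∈ F, l i * (bv (x i) - p)
        + Q x : ℝ) * Complex.I))
      = fun x => Complex.exp ((K : ℝ) * Complex.I) * ((Lf x + Complex.I *
          ∑ j ∈ J, (g j : ℂ) * ((cen p (T j) x : ℂ) * Lf x))
          + Lf x * (Complex.exp ((Q x : ℝ) * Complex.I) - 1 - Q x * Complex.I)) := by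
    ext x
    have : Complex.I * ∑ j ∈ J, (g j : ℂ) * ((cen p (T j) x : ℂ) * Lf x)
        = Lf x * ((Q x : ℂ) * Complex.I) := by
      rw [hQ]; push_cast
      rw [Finset.sum_mul, Finset.mul_sum, Finset.mul_sum]
      exact Finset.sum_congr rfl fun j _ => by ring
    rw [this]
    push_cast
    rw [add_mul, add_mul, Complex.exp_add, Complex.exp_add, hLf]
    push_cast
    ring
  rw [e1, ex_mul_left, norm_mul, Complex.norm_exp_ofReal_mul_I, one_mul, ex_add, ex_add,
    ex_mul_left, ex_sum]
  have b1 : ‖ex p Lf‖ ≤ r ^ (F.card - 2) := by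
    have := hprod ∅ (by simp)
    simpa [cen] using this
  have b2 : ‖∑ j ∈ J, ex p (fun x => (g j : ℂ) * ((cen p (T j) x : ℂ) * Lf x))‖
      ≤ J.card * (G * r ^ (F.card - 2)) := by
    refine (norm_sum_le _ _).trans ?_
    rw [← nsmul_eq_mul]
    refine Finset.sum_le_card_nsmul _ _ _ fun j hj => ?_
    rw [ex_mul_left, norm_mul, Complex.norm_real]
    exact mul_le_mul (hg j hj) (hprod _ (hT2 j hj).le) (norm_nonneg _)
      ((abs_nonneg _).trans (hg j hj))
  have b3 : ‖ex p (fun x => Lf x * (Complex.exp ((Q x : ℝ) * Complex.I) - 1 - Q x * Complex.I))‖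
      ≤ 2 * G ^ 2 * J.card := by
    refine (norm_ex_le h0 h1 _).trans ?_
    have : ∀ x, ‖Lf x * (Complex.exp ((Q x : ℝ) * Complex.I) - 1 - Q x * Complex.I)‖
        ≤ 2 * Q x ^ 2 := by
      intro x
      rw [norm_mul, hLf, Complex.norm_exp_ofReal_mul_I, one_mul]
      exact norm_exp_sub_one_sub_le _
    refine (ex_mono h0 h1 this).trans ?_
    rw [ex_mul_left, hQ, ex_sq_sum_cen p J T hT, mul_assoc]
    refine mul_le_mul_of_nonneg_left ?_ (by norm_num)
    rw [mul_comm (G ^ 2), ← nsmul_eq_mul]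
    refine Finset.sum_le_card_nsmul _ _ _ fun j hj => ?_
    have k1 : g j ^ 2 ≤ G ^ 2 := by rw [← sq_abs]; gcongr; exact hg j hj
    have k2 : (p * (1 - p)) ^ (T j).card ≤ 1 := pow_le_one₀ (by positivity) (by nlinarith)
    have k3 : 0 ≤ (p * (1 - p)) ^ (T j).card := by positivity
    nlinarith [sq_nonneg (g j)]
  refine (norm_add_le _ _).trans (add_le_add ((norm_add_le _ _).trans ?_) b3)
  rw [norm_mul, Complex.norm_I, one_mul]
  linarith

end Forms

/-! ### Codegrees -/

section Codegree

variable {n : ℕ}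

/-- The number of `c ∈ C` joined to both `a` and `b`. -/
def codeg (C : Finset (Fin n)) (x : Fin n × Fin n → Bool) (a b : Fin n) : ℝ :=
  ∑ c ∈ C, bv (x (a, c)) * bv (x (b, c))

/-- Chernoff's bound with parameter $-1$: distinct `c` use distinct columns, so the exponential
moment factorizes, and $e^{-t}\le1-t/2$ for $t\in\{0,1\}$ bounds each factor by $e^{-p^2/2}$. -/
lemma ex_codeg_lt {p : ℝ} (h0 : 0 ≤ p) (h1 : p ≤ 1) (C : Finset (Fin n)) {a b : Fin n}
    (hab : a ≠ b) (D : ℝ) :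
    ex p (fun x : Fin n × Fin n → Bool => if codeg C x a b < D then (1 : ℝ) else 0)
      ≤ Real.exp (D - p ^ 2 / 2 * C.card) := by
  have e1 : ∀ x : Fin n × Fin n → Bool, (if codeg C x a b < D then (1 : ℝ) else 0)
      ≤ Real.exp D * ∏ c, if c ∈ C then Real.exp (-(bv (x (a, c)) * bv (x (b, c)))) else 1 := by
    intro x
    rw [Finset.prod_ite_mem, Finset.univ_inter, ← Real.exp_sum, ← Real.exp_add,
      Finset.sum_neg_distrib]
    change _ ≤ Real.exp (D + -codeg C x a b)
    split_ifs with h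
    · exact Real.one_le_exp (by linarith)
    · exact (Real.exp_pos _).le
  refine (ex_mono h0 h1 e1).trans ?_
  rw [ex_mul_left, sub_eq_add_neg, Real.exp_add]
  refine mul_le_mul_of_nonneg_left ?_ (Real.exp_pos _).le
  rw [ex_cols p (fun c (v : Fin n → Bool) =>
    if c ∈ C then Real.exp (-(bv (v a) * bv (v b))) else 1)]
  have e2 : ex p (fun v : Fin n → Bool => bv (v a) * bv (v b)) = p ^ 2 := by
    have : ∀ v : Fin n → Bool, bv (v a) * bv (v b)
        = ∏ i, if i ∈ ({a, b} : Finset (Fin n)) then bv (v i) else 1 := by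
      intro v
      rw [Finset.prod_ite_mem, Finset.univ_inter, Finset.prod_pair hab]
    simp only [this]
    rw [ex_prod p (fun i b' => if i ∈ ({a, b} : Finset (Fin n)) then bv b' else 1)]
    have h2 : ∀ i : Fin n, (p • (if i ∈ ({a, b} : Finset (Fin n)) then bv true else 1)
        + (1 - p) • (if i ∈ ({a, b} : Finset (Fin n)) then bv false else 1))
        = if i ∈ ({a, b} : Finset (Fin n)) then p else 1 := by
      intro i
      split_ifs <;> simp [bv]
    simp only [h2]
    rw [Finset.prod_ite_mem, Finset.univ_inter, Finset.prod_pair hab, sq]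
  have e3 : ex p (fun v : Fin n → Bool => Real.exp (-(bv (v a) * bv (v b))))
      ≤ Real.exp (-(p ^ 2 / 2)) := by
    have hb : ∀ v : Fin n → Bool, Real.exp (-(bv (v a) * bv (v b)))
        ≤ 1 - 1 / 2 * (bv (v a) * bv (v b)) := by
      intro v
      have : Real.exp (-1) ≤ 1 / 2 := by
        rw [Real.exp_neg, one_div]
        exact inv_anti₀ (by norm_num) (by linarith [Real.add_one_le_exp (1 : ℝ)])
      cases v a <;> cases v b <;> simp [bv]; linarith
    refine (ex_mono h0 h1 hb).trans ?_
    rw [ex_sub, ex_mul_left, e2, ex_const]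
    have := Real.add_one_le_exp (-(p ^ 2 / 2))
    linarith
  have e4 : ∀ c : Fin n, ex p (fun v : Fin n → Bool =>
      if c ∈ C then Real.exp (-(bv (v a) * bv (v b))) else 1)
      ≤ if c ∈ C then Real.exp (-(p ^ 2 / 2)) else 1 := by
    intro c
    split_ifs
    · exact e3
    · rw [ex_const]
  refine (Finset.prod_le_prod (fun c _ => ?_) fun c _ => e4 c).trans ?_
  · refine ex_nonneg h0 h1 fun v => ?_
    split_ifs
    · exact (Real.exp_pos _).le
    · exact zero_le_one
  · rw [Finset.prod_ite_mem, Finset.univ_inter, Finset.prod_const, ← Real.exp_nat_mul]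
    exact le_of_eq (by ring_nf)

/-- A bounded function of the graph that is small when all the codegrees of the pairs in `F` are
large has small expectation. -/
lemma ex_le_of_codeg {p : ℝ} (h0 : 0 ≤ p) (h1 : p ≤ 1) (C : Finset (Fin n))
    (F : Finset (Fin n × Fin n)) (hF : ∀ e ∈ F, e.1 ≠ e.2) (D r : ℝ) (hr : 0 ≤ r)
    (f : (Fin n × Fin n → Bool) → ℝ) (hf1 : ∀ x, f x ≤ 1)
    (hf : ∀ x, (∀ e ∈ F, D ≤ codeg C x e.1 e.2) → f x ≤ r) :
    ex p f ≤ r + F.card * Real.exp (D - p ^ 2 / 2 * C.card) := by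
  -- Union bound: if some codegree is too small, its indicator already dominates the bound 1 on `f`.
  have e1 : ∀ x, f x ≤ r + ∑ e ∈ F, if codeg C x e.1 e.2 < D then (1 : ℝ) else 0 := by
    intro x
    have hpos : ∀ e ∈ F, (0 : ℝ) ≤ if codeg C x e.1 e.2 < D then (1 : ℝ) else 0 := by
      intro e _; split_ifs <;> simp
    by_cases h : ∀ e ∈ F, D ≤ codeg C x e.1 e.2
    · linarith [hf x h, Finset.sum_nonneg hpos]
    · push Not at h
      obtain ⟨e, he, hlt⟩ := h
      have := Finset.single_le_sum hpos he
      rw [if_pos hlt] at this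
      linarith [hf1 x]
  refine (ex_mono h0 h1 e1).trans ?_
  rw [ex_add, ex_const, ex_sum, ← nsmul_eq_mul]
  exact add_le_add le_rfl (Finset.sum_le_card_nsmul _ _ _ fun e he => ex_codeg_lt h0 h1 C (hF e he) D)

end Codegree

/-! ### The characteristic function in the intermediate range -/

section Block

variable {n : ℕ}

/-- The vertices `u` with `a ≤ u < b`. -/
def vset (n a b : ℕ) : Finset (Fin n) := Finset.univ.filter fun u => a ≤ u.val ∧ u.val < b

lemma mem_vset {a b : ℕ} {u : Fin n} : u ∈ vset n a b ↔ a ≤ u.val ∧ u.val < b := by simp [vset]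

lemma card_vset {a b : ℕ} (hb : b ≤ n) : (vset n a b).card = b - a := by
  rw [← Finset.card_map Fin.valEmbedding, ← Nat.card_Ico]
  congr 1
  ext i
  simp only [Finset.mem_map, mem_vset, Fin.valEmbedding_apply, Finset.mem_Ico]
  constructor
  · rintro ⟨u, hu, rfl⟩; exact hu
  · intro h; exact ⟨⟨i, by omega⟩, h, rfl⟩

/-- The pairs joining the block `[0, k)` to the block `[k, 2k)`. -/
def block (n k : ℕ) : Finset (Fin n × Fin n) := vset n 0 k ×ˢ vset n k (2 * k)

lemma mem_block {k : ℕ} {e : Fin n × Fin n} :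
    e ∈ block n k ↔ e.1.val < k ∧ k ≤ e.2.val ∧ e.2.val < 2 * k := by
  simp [block, Finset.mem_product, mem_vset]

lemma card_block {k : ℕ} (hk : 2 * k ≤ n) : (block n k).card = k ^ 2 := by
  rw [block, Finset.card_product, card_vset (by omega), card_vset hk, sq]
  congr 1; omega

/-- The value of an edge outside the block, and the mean of an edge inside it. -/
def base (k : ℕ) (p : ℝ) (x : Fin n × Fin n → Bool) (e : Fin n × Fin n) : ℝ :=
  if e ∈ block n k then p else bv (x e)

lemma base_nonneg (k : ℕ) {p : ℝ} (h0 : 0 ≤ p) (x : Fin n × Fin n → Bool)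
    (e : Fin n × Fin n) : 0 ≤ base k p x e := by
  unfold base; split_ifs
  exacts [h0, bv_nonneg _]

lemma base_le_one (k : ℕ) {p : ℝ} (h1 : p ≤ 1) (x : Fin n × Fin n → Bool)
    (e : Fin n × Fin n) : base k p x e ≤ 1 := by
  unfold base; split_ifs
  exacts [h1, bv_le_one _]

/-- The coefficient of the centred edge `e` of the block in the triangle count. -/
def blockLin (k : ℕ) (p : ℝ) (x : Fin n × Fin n → Bool) (e : Fin n × Fin n) : ℝ :=
  ∑ t ∈ triples n,
    ((if e = (t.1, t.2.1) then base k p x (t.1, t.2.2) * base k p x (t.2.1, t.2.2) else 0)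
    + (if e = (t.1, t.2.2) then base k p x (t.1, t.2.1) * base k p x (t.2.1, t.2.2) else 0)
    + (if e = (t.2.1, t.2.2) then base k p x (t.1, t.2.1) * base k p x (t.1, t.2.2) else 0))

/-- The coefficient of a pair of adjacent edges of the block in the triangle count. -/
def blockQuad (k : ℕ) (p : ℝ) (x : Fin n × Fin n → Bool) :
    (Fin n × Fin n × Fin n) × Fin 4 → ℝ
  | (t, 0) => base k p x (t.2.1, t.2.2)
  | (t, 1) => base k p x (t.1, t.2.2)
  | (t, 2) => base k p x (t.1, t.2.1)
  | (_, 3) => 0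

/-- The pairs of adjacent edges of the block. -/
def blockWedges (n k : ℕ) : Finset ((Fin n × Fin n × Fin n) × Fin 4) :=
  (triples n ×ˢ Finset.univ).filter fun j => j.2 ≠ 3 ∧ remEdges j ⊆ block n k

lemma abs_blockQuad_le (k : ℕ) {p : ℝ} (h0 : 0 ≤ p) (h1 : p ≤ 1) (x : Fin n × Fin n → Bool)
    (j : (Fin n × Fin n × Fin n) × Fin 4) : |blockQuad k p x j| ≤ 1 := by
  have h : ∀ e, |base k p x e| ≤ 1 := fun e => by
    rw [abs_of_nonneg (base_nonneg k h0 x e)]; exact base_le_one k h1 x e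
  obtain ⟨t, i⟩ := j
  fin_cases i
  exacts [h _, h _, h _, by simp [blockQuad]]

/-- All vertices involved lie below $2k$, and $4(2k)^3=32k^3$. -/
lemma card_blockWedges_le {k : ℕ} (hk : 2 * k ≤ n) : (blockWedges n k).card ≤ 32 * k ^ 3 := by
  have h : blockWedges n k ⊆ (vset n 0 (2 * k) ×ˢ vset n 0 (2 * k) ×ˢ vset n 0 (2 * k))
      ×ˢ (Finset.univ : Finset (Fin 4)) := by
    rintro ⟨⟨u, v, w⟩, i⟩ hj
    simp only [blockWedges, Finset.mem_filter, Finset.mem_product] at hj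
    obtain ⟨-, hi, hs⟩ := hj
    simp only [Finset.mem_product, mem_vset, Finset.mem_univ, and_true]
    fin_cases i <;> simp only [remEdges, Finset.insert_subset_iff, Finset.singleton_subset_iff,
      mem_block] at hs
    · omega
    · omega
    · omega
    · exact absurd rfl hi
  refine (Finset.card_le_card h).trans ?_
  simp only [Finset.card_product, card_vset hk, Finset.card_univ, Fintype.card_fin]
  apply le_of_eq
  simp only [Nat.sub_zero]; ring

/-- Expansion of the triangle count in the centred edges of the block. The block is bipartite, so no
triangle has three edges in it and there is no cubic term. -/
lemma tri_mix_block (k : ℕ) (p : ℝ) (x z : Fin n × Fin n → Bool) :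
    tri (mix (block n k) z x)
      = ∑ t ∈ triples n, base k p x (t.1, t.2.1) * base k p x (t.1, t.2.2) *
          base k p x (t.2.1, t.2.2)
        + ∑ e ∈ block n k, blockLin k p x e * (bv (z e) - p)
        + ∑ j ∈ blockWedges n k, blockQuad k p x j * cen p (remEdges j) z := by
  have e1 : ∑ e ∈ block n k, blockLin k p x e * (bv (z e) - p)
      = ∑ t ∈ triples n,
        ((if (t.1, t.2.1) ∈ block n k then base k p x (t.1, t.2.2) * base k p x (t.2.1, t.2.2)
          * (bv (z (t.1, t.2.1)) - p) else 0)
        + (if (t.1, t.2.2) ∈ block n k then base k p x (t.1, t.2.1) * base k p x (t.2.1, t.2.2)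
          * (bv (z (t.1, t.2.2)) - p) else 0)
        + (if (t.2.1, t.2.2) ∈ block n k then base k p x (t.1, t.2.1) * base k p x (t.1, t.2.2)
          * (bv (z (t.2.1, t.2.2)) - p) else 0)) := by
    simp only [blockLin, Finset.sum_mul]
    rw [Finset.sum_comm]
    refine Finset.sum_congr rfl fun t _ => ?_
    simp only [add_mul, Finset.sum_add_distrib, ite_mul, zero_mul, Finset.sum_ite_eq']
  have e2 : ∑ j ∈ blockWedges n k, blockQuad k p x j * cen p (remEdges j) z
      = ∑ t ∈ triples n, ∑ i : Fin 4, if i ≠ 3 ∧ remEdges (t, i) ⊆ block n k then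
        blockQuad k p x (t, i) * cen p (remEdges (t, i)) z else 0 := by
    rw [blockWedges, Finset.sum_filter, Finset.sum_product]
  rw [e1, e2, ← Finset.sum_add_distrib, ← Finset.sum_add_distrib, tri]
  refine Finset.sum_congr rfl fun t ht => ?_
  obtain ⟨u, v, w⟩ := t
  simp only [mem_triples] at ht
  have k1 := ht.1.ne
  have k2 := ht.2.ne
  rw [Fin.sum_univ_four]
  have c0 : cen p (remEdges ((u, v, w), 0)) z = (bv (z (u, v)) - p) * (bv (z (u, w)) - p) :=
    Finset.prod_pair (by simp [k2])
  have c1 : cen p (remEdges ((u, v, w), 1)) z = (bv (z (u, v)) - p) * (bv (z (v, w)) - p) :=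
    Finset.prod_pair (by simp [k1])
  have c2 : cen p (remEdges ((u, v, w), 2)) z = (bv (z (u, w)) - p) * (bv (z (v, w)) - p) :=
    Finset.prod_pair (by simp [k1])
  -- The middle vertex $v$ would have to lie in both sides of the bipartition.
  have hc : ¬ ((u, v) ∈ block n k ∧ (v, w) ∈ block n k) := by
    simp only [mem_block]; omega
  rw [c0, c1, c2]
  simp only [remEdges, Finset.insert_subset_iff, Finset.singleton_subset_iff, blockQuad, base, mix]
  by_cases m1 : (u, v) ∈ block n k <;> by_cases m2 : (u, w) ∈ block n k <;>
    by_cases m3 : (v, w) ∈ block n k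
  · exact absurd ⟨m1, m3⟩ hc
  · simp [m1, m2, m3]; ring
  · exact absurd ⟨m1, m3⟩ hc
  · simp [m1, m2, m3]; ring
  · simp [m1, m2, m3]; ring
  · simp [m1, m2, m3]; ring
  · simp [m1, m2, m3]; ring
  · simp [m1, m2, m3]

/-- Needed so that $\theta$ times the coefficient stays in $[-\pi,\pi]$, where $1-\cos$ is bounded
below by a quadratic. -/
lemma blockLin_le (k : ℕ) {p : ℝ} (h0 : 0 ≤ p) (h1 : p ≤ 1) (x : Fin n × Fin n → Bool)
    (e : Fin n × Fin n) : blockLin k p x e ≤ n := by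
  have hb : ∀ e f, base k p x e * base k p x f ≤ 1 := fun e f =>
    mul_le_one₀ (base_le_one k h1 x e) (base_nonneg k h0 x f) (base_le_one k h1 x f)
  have h : blockLin k p x e ≤ ∑ t ∈ triples n, ((if e = (t.1, t.2.1) then (1 : ℝ) else 0)
      + (if e = (t.1, t.2.2) then (1 : ℝ) else 0) + (if e = (t.2.1, t.2.2) then (1 : ℝ) else 0)) := by
    refine Finset.sum_le_sum fun t _ => ?_
    refine add_le_add (add_le_add ?_ ?_) ?_ <;> split_ifs <;>
      first | exact hb _ _ | exact le_rfl
  refine h.trans ?_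
  rw [sum_triples_edges (fun f => if e = f then (1 : ℝ) else 0), Finset.sum_ite_eq]
  have : (0 : ℝ) ≤ n := Nat.cast_nonneg n
  split_ifs <;> linarith

/-- All terms are nonnegative; keep only the triangles whose third vertex is at least $2k$. Their
two other edges lie outside the block, where `base` is the actual edge indicator. -/
lemma codeg_le_blockLin (k : ℕ) {p : ℝ} (h0 : 0 ≤ p) (x : Fin n × Fin n → Bool)
    {e : Fin n × Fin n} (he : e ∈ block n k) :
    codeg (vset n (2 * k) n) x e.1 e.2 ≤ blockLin k p x e := by
  obtain ⟨a, b⟩ := e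
  rw [mem_block] at he
  simp only at he
  have hpos : ∀ e f, 0 ≤ base k p x e * base k p x f := fun e f =>
    mul_nonneg (base_nonneg k h0 x e) (base_nonneg k h0 x f)
  have h1 : codeg (vset n (2 * k) n) x a b = ∑ t ∈ (vset n (2 * k) n).image
      (fun c => (a, b, c)), bv (x (t.1, t.2.2)) * bv (x (t.2.1, t.2.2)) := by
    rw [Finset.sum_image (by intro c _ d _ h; simpa using h)]
    rfl
  simp only
  rw [h1, blockLin]
  have hsub : (vset n (2 * k) n).image (fun c => (a, b, c)) ⊆ triples n := by
    intro t ht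
    obtain ⟨c, hc, rfl⟩ := Finset.mem_image.1 ht
    rw [mem_vset] at hc
    rw [mem_triples]
    simp only [Fin.lt_def]
    omega
  refine le_trans (Finset.sum_le_sum fun t ht => ?_) (Finset.sum_le_sum_of_subset_of_nonneg hsub
    fun t _ _ => ?_)
  · obtain ⟨c, hc, rfl⟩ := Finset.mem_image.1 ht
    rw [mem_vset] at hc
    have m1 : (a, c) ∉ block n k := by rw [mem_block]; simp only; omega
    have m2 : (b, c) ∉ block n k := by rw [mem_block]; simp only; omega
    have n1 : b ≠ c := by intro h; subst h; omega
    have n2 : a ≠ b := by intro h; subst h; omega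
    simp [base, m1, m2, n1, n2]
  · refine add_nonneg (add_nonneg ?_ ?_) ?_ <;> split_ifs <;> first | exact hpos _ _ | exact le_rfl

/-- Freeze the edges outside the block. If every block pair has codegree at least `D`, the
quadratic-form bound applies with $G=|\theta|$; the failure of this event costs the last term. -/
lemma norm_phi_le_block {k : ℕ} (hk : 2 * k ≤ n) {p : ℝ} (h0 : 0 ≤ p) (h1 : p ≤ 1) {θ D : ℝ}
    (hθ : |θ| * n ≤ Real.pi) (hD : 0 ≤ D) :
    ‖phi n p θ‖ ≤ Real.exp (-(p * (1 - p) * (2 / Real.pi ^ 2 * (|θ| * D) ^ 2))) ^ (k ^ 2 - 2)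
          * (1 + |θ| * (32 * k ^ 3)) + 2 * θ ^ 2 * (32 * k ^ 3)
        + k ^ 2 * Real.exp (D - p ^ 2 / 2 * (n - 2 * k)) := by
  set r := Real.exp (-(p * (1 - p) * (2 / Real.pi ^ 2 * (|θ| * D) ^ 2))) with hr
  have hq := sub_nonneg.2 h1
  have hr0 : 0 ≤ r := (Real.exp_pos _).le
  have hr1 : r ≤ 1 := Real.exp_le_one_iff.2 (neg_nonpos.2 (by positivity))
  have hcardC : (((vset n (2 * k) n).card : ℕ) : ℝ) = n - 2 * k := by
    rw [card_vset le_rfl, Nat.cast_sub hk]; push_cast; ring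
  have hcardF : (((block n k).card : ℕ) : ℝ) = (k : ℝ) ^ 2 := by
    rw [card_block hk]; push_cast; ring
  have hW : (((blockWedges n k).card : ℕ) : ℝ) ≤ 32 * (k : ℝ) ^ 3 := by
    exact_mod_cast card_blockWedges_le hk
  rw [phi, ← ex_mix p (block n k)]
  refine (norm_ex_le h0 h1 _).trans ?_
  rw [← hcardC, ← hcardF]
  refine ex_le_of_codeg h0 h1 (vset n (2 * k) n) (block n k) ?_ D _ (by positivity) _ ?_ ?_
  · intro e he h
    rw [mem_block, h] at he
    omega
  · intro x
    refine (norm_ex_le h0 h1 _).trans (ex_le_const h0 h1 fun z => ?_)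
    rw [Complex.norm_exp_ofReal_mul_I]
  · intro x hx
    have e1 : ∀ z : Fin n × Fin n → Bool, θ * (tri (mix (block n k) z x) - p ^ 3 * (n.choose 3 : ℝ))
        = θ * ((∑ t ∈ triples n, base k p x (t.1, t.2.1) * base k p x (t.1, t.2.2) *
          base k p x (t.2.1, t.2.2)) - p ^ 3 * (n.choose 3 : ℝ))
          + ∑ e ∈ block n k, (θ * blockLin k p x e) * (bv (z e) - p)
          + ∑ j ∈ blockWedges n k, (θ * blockQuad k p x j) * cen p (remEdges j) z := by
      intro z
      rw [tri_mix_block k p]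
      simp only [mul_assoc, ← Finset.mul_sum]
      ring
    simp only [e1]
    refine (norm_ex_exp_quadratic_le h0 h1 _ (block n k) _ (blockWedges n k) remEdges ?_ ?_ _
      (G := |θ|) (r := r) ?_ hr0 hr1 ?_).trans ?_
    · exact remEdges_injOn.mono (by
        simp only [blockWedges, Finset.coe_filter]; exact fun j hj => hj.1)
    · rintro ⟨⟨u, v, w⟩, i⟩ hj
      simp only [blockWedges, Finset.mem_filter, Finset.mem_product, mem_triples] at hj
      have k1 := hj.1.1.1.ne
      have k2 := hj.1.1.2.ne
      have k3 := hj.2.1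
      fin_cases i <;> simp only [remEdges]
      · rw [Finset.card_pair]; simp [k2]
      · rw [Finset.card_pair]; simp [k1]
      · rw [Finset.card_pair]; simp [k1]
      · exact absurd rfl k3
    · intro j _
      rw [abs_mul]
      exact mul_le_of_le_one_right (abs_nonneg _) (abs_blockQuad_le k h0 h1 x j)
    · intro e he
      have l1 := (hx e he).trans (codeg_le_blockLin k h0 x he)
      have l2 := blockLin_le k h0 h1 x e
      have l3 : |θ * blockLin k p x e| = |θ| * blockLin k p x e := by
        rw [abs_mul, abs_of_nonneg (hD.trans l1)]
      refine norm_chi_le_exp_sq h0 h1 ?_ (by positivity) ?_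
      · rw [l3]; exact le_trans (by gcongr) hθ
      · rw [l3]; gcongr
    · rw [card_block hk, sq_abs]
      gcongr

end Block

/-! ### Differences of binomial variables -/

section Binomial

variable {ι : Type*} [Fintype ι] [DecidableEq ι]

lemma ex_exp_sum (p s : ℝ) (F : Finset ι) :
    ex p (fun x : ι → Bool => Complex.exp ((s * ∑ i ∈ F, (bv (x i) - p) : ℝ) * Complex.I))
      = chi p s ^ F.card := by
  have h : ∀ x : ι → Bool, Complex.exp ((s * ∑ i ∈ F, (bv (x i) - p) : ℝ) * Complex.I)
      = ∏ i, if i ∈ F then Complex.exp ((s * (bv (x i) - p) : ℝ) * Complex.I) else 1 := by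
    intro x
    rw [Finset.prod_ite_mem, Finset.univ_inter, ← Complex.exp_sum, Finset.mul_sum]
    push_cast
    rw [Finset.sum_mul]
  simp only [h]
  rw [ex_prod p (fun i b => if i ∈ F then
    Complex.exp ((s * (bv b - p) : ℝ) * Complex.I) else 1)]
  have h2 : ∀ i : ι,
      (p • (if i ∈ F then Complex.exp ((s * (bv true - p) : ℝ) * Complex.I) else 1)
      + (1 - p) • (if i ∈ F then Complex.exp ((s * (bv false - p) : ℝ) * Complex.I) else 1))
      = if i ∈ F then chi p s else 1 := by
    intro i
    by_cases hi : i ∈ F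
    · simp [hi, chi, bv]
    · simp [hi]
  simp only [h2]
  rw [Finset.prod_ite_mem, Finset.univ_inter, Finset.prod_const]

/-- The difference of two independent binomial variables is symmetric, with characteristic function
$|\chi|^{2d}$, where $d$ is the size of `F`. -/
lemma ex_ex_cos (p s : ℝ) (F : Finset ι) :
    ex p (fun v : ι → Bool => ex p (fun w : ι → Bool =>
      Real.cos (s * ∑ i ∈ F, (bv (v i) - bv (w i))))) = (‖chi p s‖ ^ 2) ^ F.card := by
  have h : ∀ v w : ι → Bool, Real.cos (s * ∑ i ∈ F, (bv (v i) - bv (w i)))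
      = (Complex.exp ((s * ∑ i ∈ F, (bv (v i) - p) : ℝ) * Complex.I)
        * (starRingEnd ℂ) (Complex.exp ((s * ∑ i ∈ F, (bv (w i) - p) : ℝ) * Complex.I))).re := by
    intro v w
    rw [← Complex.exp_conj, ← Complex.exp_add]
    have : ((s * ∑ i ∈ F, (bv (v i) - p) : ℝ) : ℂ) * Complex.I
        + (starRingEnd ℂ) (((s * ∑ i ∈ F, (bv (w i) - p) : ℝ) : ℂ) * Complex.I)
        = ((s * ∑ i ∈ F, (bv (v i) - bv (w i)) : ℝ) : ℂ) * Complex.I := by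
      rw [map_mul, Complex.conj_ofReal, Complex.conj_I]
      have e : ∑ i ∈ F, (bv (v i) - bv (w i))
          = ∑ i ∈ F, (bv (v i) - p) - ∑ i ∈ F, (bv (w i) - p) := by
        rw [← Finset.sum_sub_distrib]
        exact Finset.sum_congr rfl fun i _ => by ring
      rw [e]; push_cast; ring
    rw [this, Complex.exp_ofReal_mul_I_re]
  have hconj : ∀ f : (ι → Bool) → ℂ, ex p (fun w => (starRingEnd ℂ) (f w))
      = (starRingEnd ℂ) (ex p f) := by
    intro f
    simp [ex]
  simp only [h, ← ex_re, ex_mul_left, ex_mul_right, hconj, ex_exp_sum]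
  rw [Complex.mul_conj, Complex.ofReal_re, Complex.normSq_eq_norm_sq, norm_pow]
  ring

/-- Doubling the angle expresses $|\chi(2s)|^2$ through $y=1-|\chi(s)|^2$; this is what makes the
mean of $\cos^2$ comparable with that of $\cos$. -/
lemma norm_chi_two_mul_sq {p : ℝ} (hpq : p * (1 - p) ≠ 0) (s : ℝ) :
    ‖chi p (2 * s)‖ ^ 2 = 1 - 4 * (1 - ‖chi p s‖ ^ 2) + (1 - ‖chi p s‖ ^ 2) ^ 2 / (p * (1 - p)) := by
  rw [norm_chi_sq, norm_chi_sq, Real.cos_two_mul]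
  have e : (1 - (1 - 2 * (p * (1 - p)) * (1 - Real.cos s))) ^ 2 / (p * (1 - p))
      = 4 * (p * (1 - p)) * (1 - Real.cos s) ^ 2 := by
    rw [div_eq_iff hpq]; ring
  rw [e]
  ring

lemma exp_neg_le_quadratic {u : ℝ} (hu : 0 ≤ u) : Real.exp (-u) ≤ 1 - u + u ^ 2 / 2 := by
  have h := Real.quadratic_le_exp_of_nonneg hu
  rw [Real.exp_neg, inv_le_comm₀ (Real.exp_pos _) (by nlinarith [sq_nonneg (u - 1)])]
  refine le_trans ?_ h
  rw [inv_eq_one_div, div_le_iff₀ (by nlinarith [sq_nonneg (u - 1)])]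
  nlinarith [sq_nonneg (u ^ 2)]

/-- From $(1-y)^d\le e^{-dy}$ and $e^{-u}\le1-u/2$ for $0\le u\le1$. -/
lemma half_min_le_one_sub_pow {y : ℝ} (hy0 : 0 ≤ y) (hy1 : y ≤ 1) (d : ℕ) :
    min (d * y) 1 / 2 ≤ 1 - (1 - y) ^ d := by
  have h1 : (1 - y) ^ d ≤ Real.exp (-(min (d * y) 1)) := by
    have : (1 - y) ^ d ≤ Real.exp (-y) ^ d := by
      refine pow_le_pow_left₀ (by linarith) ?_ d
      linarith [Real.add_one_le_exp (-y)]
    refine this.trans ?_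
    rw [← Real.exp_nat_mul, Real.exp_le_exp]
    linarith [min_le_left (d * y) 1]
  have h2 : 0 ≤ min (d * y) 1 := le_min (by positivity) zero_le_one
  have h3 : min (d * y) 1 ≤ 1 := min_le_right _ _
  have h4 := exp_neg_le_quadratic h2
  nlinarith

/-- The second moment of `1 - cos` is controlled by the square of its mean. -/
lemma second_moment_bound {K y : ℝ} (hK : 4 ≤ K) (hy0 : 0 ≤ y) (hy1 : y ≤ 1) {z : ℝ} (hz0 : 0 ≤ z)
    (hz1 : z ≤ 1) (hz : z = 1 - 4 * y + K * y ^ 2) (d : ℕ) :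
    3 / 2 - 2 * (1 - y) ^ d + z ^ d / 2 ≤ (3 + 2 * K) * (1 - (1 - y) ^ d) ^ 2 := by
  set r := (1 - y) ^ d with hr
  have hr0 : 0 ≤ r := pow_nonneg (by linarith) d
  have hr1 : r ≤ 1 := pow_le_one₀ (by linarith) (by linarith)
  have hmin := half_min_le_one_sub_pow hy0 hy1 d
  rw [← hr] at hmin
  -- If $dy\le1$, then $z\le(1-y)^4+Ky^2$ gives $z^d\le r^4+K(dy)^2$, where $dy\le2(1-r)$, and
  -- $r^4-4r+3$ has a double zero at $r=1$. If $dy>1$, then $1-r\ge1/2$ and the left side is at most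
  -- $2(1-r)$.
  rcases le_or_gt (d * y) 1 with h | h
  · rw [min_eq_left h] at hmin
    have hz4 : z ≤ (1 - y) ^ 4 + K * y ^ 2 := by
      have := one_add_mul_le_pow (a := -y) (by linarith) 4
      push_cast at this
      rw [hz, sub_eq_add_neg 1 y]; linarith
    have hpow : z ^ d ≤ r ^ 4 + K * (d * y) ^ 2 := by
      have hr4 : r ^ 4 = ((1 - y) ^ 4) ^ d := by rw [hr, ← pow_mul, ← pow_mul, mul_comm]
      have hKd : 0 ≤ K * (d * y) ^ 2 := by positivity
      have hy4 : (0 : ℝ) ≤ (1 - y) ^ 4 := by positivity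
      rcases le_or_gt z ((1 - y) ^ 4) with hc | hc
      · have := pow_le_pow_left₀ hz0 hc d
        rw [hr4]; linarith
      · have := norm_pow_sub_pow_le_of_le_one (a := z) (b := (1 - y) ^ 4)
          (by rwa [Real.norm_of_nonneg hz0])
          (by rw [Real.norm_of_nonneg hy4]; exact pow_le_one₀ (by linarith) (by linarith)) d
        rw [Real.norm_eq_abs, Real.norm_eq_abs, abs_of_nonneg (a := z - (1 - y) ^ 4) (by linarith)]
          at this
        have h1 := (le_abs_self _).trans this
        have h2 : (d : ℝ) * (z - (1 - y) ^ 4) ≤ d * (K * y ^ 2) := by gcongr; linarith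
        have h3 : (d : ℝ) ≤ (d : ℝ) ^ 2 := by exact_mod_cast Nat.le_self_pow two_ne_zero d
        have h4 : (d : ℝ) * (K * y ^ 2) ≤ (d : ℝ) ^ 2 * (K * y ^ 2) := by gcongr
        rw [hr4]; nlinarith
    have hdy : 0 ≤ d * y := by positivity
    have h5 : (d * y) ^ 2 ≤ (2 * (1 - r)) ^ 2 := by
      refine pow_le_pow_left₀ hdy ?_ 2; linarith
    have h6 : K * (d * y) ^ 2 ≤ K * (2 * (1 - r)) ^ 2 := by gcongr
    have h7 : r ^ 4 - 4 * r + 3 ≤ 6 * (1 - r) ^ 2 := by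
      have : r ^ 4 - 4 * r + 3 = (1 - r) ^ 2 * (r ^ 2 + 2 * r + 3) := by ring
      rw [this, mul_comm]
      exact mul_le_mul_of_nonneg_right (by nlinarith) (sq_nonneg _)
    nlinarith
  · rw [min_eq_right h.le] at hmin
    have hz' : z ^ d ≤ 1 := pow_le_one₀ hz0 hz1
    have h1 : 1 / 4 ≤ (1 - r) ^ 2 := by nlinarith
    nlinarith

/-- A Laplace transform bound for $u=k(1-\cos sT)$, with $T$ a difference of binomials: $\mathbb E
u^2\le C(\mathbb E u)^2$ prevents $u$ from being concentrated near 0. -/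
lemma ex_exp_neg_le {p : ℝ} (h0 : 0 < p) (h1 : p < 1) (s : ℝ) (F : Finset ι) {k : ℝ} (hk : 0 ≤ k) :
    ex p (fun v : ι → Bool => ex p (fun w : ι → Bool =>
      Real.exp (-(k * (1 - Real.cos (s * ∑ i ∈ F, (bv (v i) - bv (w i))))))))
      ≤ 1 - min (k * (min (F.card * (2 * (p * (1 - p)) * (1 - Real.cos s))) 1 / 2))
        (1 / (3 + 2 / (p * (1 - p)))) / 2 := by
  have hpq : 0 < p * (1 - p) := mul_pos h0 (sub_pos.2 h1)
  have hpq4 : p * (1 - p) ≤ 1 / 4 := by nlinarith [sq_nonneg (p - 1 / 2)]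
  set y := 2 * (p * (1 - p)) * (1 - Real.cos s) with hy
  have hcy : ‖chi p s‖ ^ 2 = 1 - y := norm_chi_sq p s
  have hy0 : 0 ≤ y := mul_nonneg (by positivity) (by linarith [Real.cos_le_one s])
  have hy1 : y ≤ 1 := by have := sq_nonneg ‖chi p s‖; linarith
  set K := 1 / (p * (1 - p)) with hK
  have hK4 : 4 ≤ K := by rw [hK, le_div_iff₀ hpq]; linarith
  set z := ‖chi p (2 * s)‖ ^ 2 with hz
  have hz0 : 0 ≤ z := sq_nonneg _
  have hz1 : z ≤ 1 := pow_le_one₀ (norm_nonneg _) (norm_chi_le h0.le h1.le _)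
  have hz2 : z = 1 - 4 * y + K * y ^ 2 := by
    rw [hz, norm_chi_two_mul_sq hpq.ne', hcy, hK]; ring
  set d := F.card
  set r := (1 - y) ^ d with hr
  have hr1 : r ≤ 1 := pow_le_one₀ (by linarith) (by linarith)
  have hsm := second_moment_bound hK4 hy0 hy1 hz0 hz1 hz2 d
  have hlow := half_min_le_one_sub_pow hy0 hy1 d
  rw [← hr] at hsm hlow
  set C := 3 + 2 * K with hC
  have hCe : 3 + 2 / (p * (1 - p)) = C := by rw [hC, hK]; ring
  have hC0 : 0 < C := by linarith
  have m1 : ex p (fun v : ι → Bool => ex p (fun w : ι → Bool =>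
      Real.cos (s * ∑ i ∈ F, (bv (v i) - bv (w i))))) = r := by
    rw [ex_ex_cos, hcy]
  have m2 : ex p (fun v : ι → Bool => ex p (fun w : ι → Bool =>
      Real.cos (2 * s * ∑ i ∈ F, (bv (v i) - bv (w i))))) = z ^ d := ex_ex_cos _ _ _
  -- Scaling $u$ down by $c\le1$ only increases $e^{-u}$ and frees a parameter in
  -- $e^{-cu}\le1-cu+(cu)^2/2$. The choice below is $c=\min(1,1/(CM))$ with $M=\mathbb E u$.
  have hb : ∀ c : ℝ, 0 ≤ c → c ≤ 1 → ex p (fun v : ι → Bool => ex p (fun w : ι → Bool =>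
      Real.exp (-(k * (1 - Real.cos (s * ∑ i ∈ F, (bv (v i) - bv (w i))))))))
      ≤ 1 - c * (k * (1 - r)) + c ^ 2 * C * (k * (1 - r)) ^ 2 / 2 := by
    intro c hc0 hc1
    have e1 : ∀ v w : ι → Bool, Real.exp (-(k * (1 - Real.cos (s * ∑ i ∈ F, (bv (v i) - bv (w i))))))
        ≤ (1 - c * k + 3 / 4 * (c * k) ^ 2)
          + (c * k - (c * k) ^ 2) * Real.cos (s * ∑ i ∈ F, (bv (v i) - bv (w i)))
          + ((c * k) ^ 2 / 4) * Real.cos (2 * s * ∑ i ∈ F, (bv (v i) - bv (w i))) := by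
      intro v w
      set t := s * ∑ i ∈ F, (bv (v i) - bv (w i)) with ht
      have e2 : 2 * s * ∑ i ∈ F, (bv (v i) - bv (w i)) = 2 * t := by rw [ht]; ring
      rw [e2, Real.cos_two_mul]
      have hps : 0 ≤ 1 - Real.cos t := by linarith [Real.cos_le_one t]
      have h3 : 0 ≤ k * (1 - Real.cos t) := by positivity
      have h4 : Real.exp (-(k * (1 - Real.cos t))) ≤ Real.exp (-(c * (k * (1 - Real.cos t)))) := by
        rw [Real.exp_le_exp]
        have := mul_le_of_le_one_left h3 hc1
        linarith
      refine h4.trans ((exp_neg_le_quadratic (by positivity)).trans (le_of_eq ?_))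
      ring
    refine (ex_mono h0.le h1.le fun v => ex_mono h0.le h1.le (e1 v)).trans ?_
    simp only [ex_add, ex_mul_left, ex_const, m1, m2]
    have : (c * k) ^ 2 / 2 * (3 / 2 - 2 * r + z ^ d / 2) ≤ (c * k) ^ 2 / 2 * (C * (1 - r) ^ 2) := by
      gcongr
    nlinarith
  set M := k * (1 - r) with hM
  have hM0 : 0 ≤ M := mul_nonneg hk (by linarith)
  have hfin : ex p (fun v : ι → Bool => ex p (fun w : ι → Bool =>
      Real.exp (-(k * (1 - Real.cos (s * ∑ i ∈ F, (bv (v i) - bv (w i))))))))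
      ≤ 1 - min M (1 / C) / 2 := by
    rcases le_or_gt M (1 / C) with h | h
    · refine (hb 1 zero_le_one le_rfl).trans ?_
      rw [min_eq_left h]
      have : C * M ≤ 1 := by rw [le_div_iff₀ hC0] at h; linarith
      nlinarith
    · have hMp : 0 < M := lt_trans (by positivity) h
      have hCM : 1 ≤ C * M := by rw [div_lt_iff₀ hC0] at h; linarith
      refine (hb (1 / (C * M)) (by positivity) (by rw [div_le_one (by positivity)]; exact hCM)).trans ?_
      rw [min_eq_right h.le]
      apply le_of_eq
      field_simp
      ring
  rw [hCe]
  refine hfin.trans ?_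
  have : min (k * (min (d * y) 1 / 2)) (1 / C) ≤ min M (1 / C) :=
    min_le_min_right _ (by rw [hM]; gcongr)
  linarith

end Binomial

/-! ### Decoupling: the characteristic function away from the origin -/

section Decoupling

variable {n : ℕ}

/-- The pairs joining the block `[0, m)` to `[2m, n)`. -/
def crossBlock (n m : ℕ) : Finset (Fin n × Fin n) := vset n 0 m ×ˢ vset n (2 * m) n

lemma mem_crossBlock {m : ℕ} {e : Fin n × Fin n} :
    e ∈ crossBlock n m ↔ e.1.val < m ∧ 2 * m ≤ e.2.val := by
  simp [crossBlock, Finset.mem_product, mem_vset]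

/-- The coefficient of the edge `e` in the difference of the triangle counts of two graphs that
differ on the cross block only. -/
def diffCoeff (m : ℕ) (x y w : Fin n × Fin n → Bool) (e : Fin n × Fin n) : ℝ :=
  ∑ c ∈ vset n (2 * m) n, (bv (y (e.1, c)) - bv (w (e.1, c))) * bv (x (e.2, c))

/-- The values of the edges after resampling the cross block, with the edges of the block replaced
by their means. -/
def crossBase (m : ℕ) (p : ℝ) (x y : Fin n × Fin n → Bool) (e : Fin n × Fin n) : ℝ :=
  if e ∈ crossBlock n m then bv (y e) else base m p x e

/-- Triangles without a cross edge cancel. A triangle with both a cross edge and a block edge has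
exactly one of each, and its third edge is of neither kind; hence the difference is affine in the
block edges. -/
lemma tri_mix_cross_sub (m : ℕ) (p : ℝ) (x y w z : Fin n × Fin n → Bool) :
    tri (mix (crossBlock n m) y (mix (block n m) z x))
        - tri (mix (crossBlock n m) w (mix (block n m) z x))
      = ∑ t ∈ triples n, (crossBase m p x y (t.1, t.2.1) * crossBase m p x y (t.1, t.2.2) *
          crossBase m p x y (t.2.1, t.2.2) - crossBase m p x w (t.1, t.2.1) *
          crossBase m p x w (t.1, t.2.2) * crossBase m p x w (t.2.1, t.2.2))
        + ∑ e ∈ block n m, diffCoeff m x y w e * (bv (z e) - p) := by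
  have e1 : ∑ e ∈ block n m, diffCoeff m x y w e * (bv (z e) - p)
      = ∑ t ∈ triples n, if (t.1, t.2.1) ∈ block n m ∧ (t.1, t.2.2) ∈ crossBlock n m then
        (bv (y (t.1, t.2.2)) - bv (w (t.1, t.2.2))) * bv (x (t.2.1, t.2.2))
          * (bv (z (t.1, t.2.1)) - p) else 0 := by
    have hsub : (vset n 0 m ×ˢ vset n m (2 * m) ×ˢ vset n (2 * m) n) ⊆ triples n := by
      rintro ⟨a, b, c⟩ h
      simp only [Finset.mem_product, mem_vset] at h
      simp only [mem_triples, Fin.lt_def]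
      omega
    rw [← Finset.sum_subset hsub]
    · rw [block, Finset.sum_product, Finset.sum_product]
      refine Finset.sum_congr rfl fun a ha => ?_
      rw [Finset.sum_product]
      refine Finset.sum_congr rfl fun b hb => ?_
      rw [diffCoeff, Finset.sum_mul]
      refine Finset.sum_congr rfl fun c hc => ?_
      rw [if_pos]
      refine ⟨Finset.mem_product.2 ⟨ha, hb⟩, Finset.mem_product.2 ⟨ha, hc⟩⟩
    · rintro ⟨a, b, c⟩ - h
      rw [if_neg]
      rintro ⟨h1, h2⟩
      rw [block, Finset.mem_product] at h1
      rw [crossBlock, Finset.mem_product] at h2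
      exact h (Finset.mem_product.2 ⟨h1.1, Finset.mem_product.2 ⟨h1.2, h2.2⟩⟩)
  rw [e1, ← Finset.sum_add_distrib, tri, tri, ← Finset.sum_sub_distrib]
  refine Finset.sum_congr rfl fun t ht => ?_
  obtain ⟨u, v, w'⟩ := t
  simp only [mem_triples, Fin.lt_def] at ht
  have f1 := mem_block (k := m) (e := (u, v))
  have f2 := mem_block (k := m) (e := (u, w'))
  have f3 := mem_block (k := m) (e := (v, w'))
  have g1 := mem_crossBlock (m := m) (e := (u, v))
  have g2 := mem_crossBlock (m := m) (e := (u, w'))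
  have g3 := mem_crossBlock (m := m) (e := (v, w'))
  simp only at f1 f2 f3 g1 g2 g3
  simp only [crossBase, base, mix]
  by_cases m1 : (u, v) ∈ block n m
  · have n1 : (u, v) ∉ crossBlock n m := by rw [f1] at m1; rw [g1]; omega
    have m3 : (v, w') ∉ block n m := by rw [f1] at m1; rw [f3]; omega
    have n3 : (v, w') ∉ crossBlock n m := by rw [f1] at m1; rw [g3]; omega
    by_cases n2 : (u, w') ∈ crossBlock n m
    · simp [m1, n1, m3, n3, n2]; ring
    · simp [m1, n1, m3, n3, n2]
  · by_cases m2 : (u, w') ∈ block n m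
    · have n1 : (u, v) ∉ crossBlock n m := by rw [f2] at m2; rw [g1]; omega
      have n2 : (u, w') ∉ crossBlock n m := by rw [f2] at m2; rw [g2]; omega
      have n3 : (v, w') ∉ crossBlock n m := by rw [f2] at m2; rw [g3]; omega
      simp [m1, n1, n2, n3]
    · by_cases m3 : (v, w') ∈ block n m
      · have n1 : (u, v) ∉ crossBlock n m := by rw [f3] at m3; rw [g1]; omega
        have n2 : (u, w') ∉ crossBlock n m := by rw [f3] at m3; rw [g2]; omega
        have n3 : (v, w') ∉ crossBlock n m := by rw [f3] at m3; rw [g3]; omega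
        simp [m1, n1, n2, n3]
      · simp only [m1, m2, m3, if_false, false_and, add_zero, apply_ite bv]

lemma ex_comm₃ {ι E : Type*} [Fintype ι] [DecidableEq ι] [AddCommGroup E] [Module ℝ E] (p : ℝ)
    (k : (ι → Bool) → (ι → Bool) → (ι → Bool) → E) :
    ex p (fun x => ex p (fun y => ex p (fun w => k x y w)))
      = ex p (fun y => ex p (fun w => ex p (fun x => k x y w))) := by
  refine (ex_comm p (fun x y => ex p (fun w => k x y w))).trans ?_
  congr 1; ext y
  exact ex_comm p (fun x w => k x y w)

lemma ofReal_norm_ex_sq {ι : Type*} [Fintype ι] [DecidableEq ι] (p : ℝ) (f : (ι → Bool) → ℂ) :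
    ((‖ex p f‖ ^ 2 : ℝ) : ℂ) = ex p (fun y => ex p (fun w => f y * (starRingEnd ℂ) (f w))) := by
  have hconj : ex p (fun w => (starRingEnd ℂ) (f w)) = (starRingEnd ℂ) (ex p f) := by
    simp [ex]
  rw [← Complex.normSq_eq_norm_sq, ← Complex.mul_conj]
  simp only [ex_mul_left, ex_mul_right, hconj]

/-- Decoupling: average over the cross edges, apply Cauchy–Schwarz and open the square with two
copies `y`, `w`. Averaging over the block edges, which enter affinely, then gives a product. -/
lemma norm_phi_sq_le (m : ℕ) {p : ℝ} (h0 : 0 ≤ p) (h1 : p ≤ 1) (θ : ℝ) :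
    ‖phi n p θ‖ ^ 2 ≤ ex p (fun x : Fin n × Fin n → Bool =>
      ex p (fun y : Fin n × Fin n → Bool => ex p (fun w : Fin n × Fin n → Bool =>
        ∏ e ∈ block n m, ‖chi p (θ * diffCoeff m x y w e)‖))) := by
  set X := crossBlock n m with hX
  set F := block n m with hF
  set μ : ℝ := p ^ 3 * (n.choose 3 : ℝ) with hμ
  set h : (Fin n × Fin n → Bool) → ℂ := fun x =>
    Complex.exp ((θ * (tri x - μ) : ℝ) * Complex.I) with hh
  set g : (Fin n × Fin n → Bool) → ℂ := fun x => ex p (fun y => h (mix X y x)) with hg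
  have a1 : phi n p θ = ex p g := by rw [phi, ← ex_mix p X]
  have a2 : ‖phi n p θ‖ ^ 2 ≤ ex p (fun x => ‖g x‖ ^ 2) := by
    rw [a1]
    refine le_trans ?_ (sq_ex_le h0 h1 fun x => ‖g x‖)
    exact pow_le_pow_left₀ (norm_nonneg _) (norm_ex_le h0 h1 g) 2
  refine a2.trans ?_
  set k : (Fin n × Fin n → Bool) → (Fin n × Fin n → Bool) → (Fin n × Fin n → Bool) → ℂ :=
    fun x y w => Complex.exp ((θ * (tri (mix X y x) - tri (mix X w x)) : ℝ) * Complex.I) with hk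
  have a3 : ∀ x, ((‖g x‖ ^ 2 : ℝ) : ℂ) = ex p (fun y => ex p (fun w => k x y w)) := by
    intro x
    rw [hg]
    refine (ofReal_norm_ex_sq p _).trans ?_
    congr 1; ext y
    congr 1; ext w
    simp only [hh, hk]
    rw [← Complex.exp_conj, ← Complex.exp_add, map_mul, Complex.conj_ofReal, Complex.conj_I]
    congr 1
    push_cast
    ring
  have a4 : ex p (fun x => ‖g x‖ ^ 2)
      = ‖ex p (fun y => ex p (fun w => ex p (fun x => k x y w)))‖ := by
    have b1 : ((ex p (fun x => ‖g x‖ ^ 2) : ℝ) : ℂ)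
        = ex p (fun y => ex p (fun w => ex p (fun x => k x y w))) := by
      rw [← ex_ofReal]
      simp only [a3]
      exact ex_comm₃ p k
    rw [← b1, Complex.norm_real, Real.norm_of_nonneg (ex_nonneg h0 h1 fun x => sq_nonneg _)]
  rw [a4, ex_comm₃ p fun x y w => ∏ e ∈ F, ‖chi p (θ * diffCoeff m x y w e)‖]
  refine (norm_ex_le h0 h1 _).trans ((ex_mono h0 h1 fun y => (norm_ex_le h0 h1 _).trans
    (ex_mono (g := fun w => ex p (fun x => ∏ e ∈ F, ‖chi p (θ * diffCoeff m x y w e)‖)) h0 h1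
      fun w => ?_)))
  · rw [← ex_mix p F]
    refine (norm_ex_le h0 h1 _).trans (ex_mono h0 h1 fun x => ?_)
    have e1 : ∀ z : Fin n × Fin n → Bool, k (mix F z x) y w
        = Complex.exp ((θ * ∑ t ∈ triples n, (crossBase m p x y (t.1, t.2.1) *
          crossBase m p x y (t.1, t.2.2) *
          crossBase m p x y (t.2.1, t.2.2) - crossBase m p x w (t.1, t.2.1) *
          crossBase m p x w (t.1, t.2.2) * crossBase m p x w (t.2.1, t.2.2)) : ℝ) * Complex.I)
        * ((cen p ∅ z : ℂ) * Complex.exp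
          ((∑ e ∈ F, (θ * diffCoeff m x y w e) * (bv (z e) - p) : ℝ) * Complex.I)) := by
      intro z
      rw [hk]
      simp only
      rw [tri_mix_cross_sub m p, cen, Finset.prod_empty, Complex.ofReal_one, one_mul,
        ← Complex.exp_add, mul_add]
      congr 1
      simp only [mul_assoc, ← Finset.mul_sum]
      push_cast
      ring
    simp only [e1]
    rw [ex_mul_left, norm_mul, Complex.norm_exp_ofReal_mul_I, one_mul]
    refine (norm_ex_cen_mul_exp_le h0 h1 ∅ F _).trans ?_
    rw [Finset.sdiff_empty]

/-- The decoupled product over the edges at a single vertex. -/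
def rowEx (n m : ℕ) (p θ : ℝ) (x : Fin n × Fin n → Bool) : ℝ :=
  ex p (fun v : Fin n → Bool => ex p (fun w : Fin n → Bool => ∏ b ∈ vset n m (2 * m),
    ‖chi p (θ * ∑ c ∈ vset n (2 * m) n, (bv (v c) - bv (w c)) * bv (x (b, c)))‖))

/-- For fixed `x` the coefficient at $(a,b)$ depends only on row $a$ of `y` and `w`, so the $m$ rows
contribute independent, identically distributed factors. -/
lemma ex_ex_prod_block {m : ℕ} (hm : m ≤ n) (p θ : ℝ) (x : Fin n × Fin n → Bool) :
    ex p (fun y : Fin n × Fin n → Bool => ex p (fun w : Fin n × Fin n → Bool =>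
        ∏ e ∈ block n m, ‖chi p (θ * diffCoeff m x y w e)‖)) = rowEx n m p θ x ^ m := by
  set H : (Fin n → Bool) → (Fin n → Bool) → ℝ := fun v w => ∏ b ∈ vset n m (2 * m),
    ‖chi p (θ * ∑ c ∈ vset n (2 * m) n, (bv (v c) - bv (w c)) * bv (x (b, c)))‖ with hH
  have e1 : ∀ y w : Fin n × Fin n → Bool,
      ∏ e ∈ block n m, ‖chi p (θ * diffCoeff m x y w e)‖
        = ∏ a, if a ∈ vset n 0 m then H (fun c => y (a, c)) (fun c => w (a, c)) else 1 := by
    intro y w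
    rw [Finset.prod_ite_mem, Finset.univ_inter, block, Finset.prod_product]
    rfl
  simp only [e1]
  have e2 : ∀ y : Fin n × Fin n → Bool, ex p (fun w : Fin n × Fin n → Bool =>
      ∏ a, if a ∈ vset n 0 m then H (fun c => y (a, c)) (fun c => w (a, c)) else 1)
      = ∏ a, ex p (fun w : Fin n → Bool =>
        if a ∈ vset n 0 m then H (fun c => y (a, c)) w else 1) := fun y =>
    ex_rows p (fun a w => if a ∈ vset n 0 m then H (fun c => y (a, c)) w else 1)
  simp only [e2]
  rw [ex_rows p (fun a v => ex p (fun w : Fin n → Bool =>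
        if a ∈ vset n 0 m then H v w else 1))]
  have e3 : ∀ a : Fin n, ex p (fun v : Fin n → Bool => ex p (fun w : Fin n → Bool =>
        if a ∈ vset n 0 m then H v w else 1)) = if a ∈ vset n 0 m then rowEx n m p θ x else 1 := by
    intro a
    split_ifs
    · rfl
    · simp only [ex_const]
  simp only [e3]
  rw [Finset.prod_ite_mem, Finset.univ_inter, Finset.prod_const, card_vset hm, Nat.sub_zero]

lemma rowEx_nonneg (m : ℕ) {p : ℝ} (h0 : 0 ≤ p) (h1 : p ≤ 1) (θ : ℝ)
    (x : Fin n × Fin n → Bool) : 0 ≤ rowEx n m p θ x :=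
  ex_nonneg h0 h1 fun _ => ex_nonneg h0 h1 fun _ => Finset.prod_nonneg fun _ _ => norm_nonneg _

lemma rowEx_le_one (m : ℕ) {p : ℝ} (h0 : 0 ≤ p) (h1 : p ≤ 1) (θ : ℝ)
    (x : Fin n × Fin n → Bool) : rowEx n m p θ x ≤ 1 :=
  ex_le_const h0 h1 fun _ => ex_le_const h0 h1 fun _ =>
    Finset.prod_le_one (fun _ _ => norm_nonneg _) fun _ _ => norm_chi_le h0 h1 _

/-- Jensen's inequality for `exp`. It replaces a product over dependent vertices `b` by an average
in which each `b` can be treated alone. -/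
lemma exp_neg_sum_le {κ : Type*} (B : Finset κ) (hB : B.Nonempty) (u : κ → ℝ) :
    Real.exp (-∑ b ∈ B, u b) ≤ (∑ b ∈ B, Real.exp (-(B.card * u b))) / B.card := by
  have hc : (0 : ℝ) < B.card := by exact_mod_cast hB.card_pos
  have h := convexOn_exp.map_sum_le (t := B) (w := fun _ => (B.card : ℝ)⁻¹)
    (p := fun b => -(B.card * u b)) (fun _ _ => by positivity)
    (by rw [Finset.sum_const, nsmul_eq_mul, mul_inv_cancel₀ hc.ne']) (fun _ _ => Set.mem_univ _)
  simp only [smul_eq_mul, ← Finset.mul_sum] at h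
  rw [div_eq_inv_mul]
  refine le_trans (le_of_eq ?_) h
  rw [Finset.sum_neg_distrib, ← Finset.mul_sum, mul_neg, inv_mul_cancel_left₀ hc.ne']

lemma rowEx_le {m : ℕ} (hm : 2 * m ≤ n) (hm0 : 0 < m) {p : ℝ} (h0 : 0 < p) (h1 : p < 1) (θ : ℝ)
    (x : Fin n × Fin n → Bool) {D : ℝ}
    (hx : ∀ e ∈ block n m, D ≤ codeg (vset n (2 * m) n) x e.1 e.2) :
    rowEx n m p θ x ≤ 1 - min (m * (p * (1 - p)) *
      (min (D * (2 * (p * (1 - p)) * (1 - Real.cos θ))) 1 / 2))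
        (1 / (3 + 2 / (p * (1 - p)))) / 2 := by
  have hpq : 0 < p * (1 - p) := mul_pos h0 (sub_pos.2 h1)
  set R := 1 - min (m * (p * (1 - p)) *
      (min (D * (2 * (p * (1 - p)) * (1 - Real.cos θ))) 1 / 2))
        (1 / (3 + 2 / (p * (1 - p)))) / 2 with hR
  set B := vset n m (2 * m) with hB
  have hBc : B.card = m := by rw [hB, card_vset hm]; omega
  have hBne : B.Nonempty := Finset.card_pos.1 (by omega)
  set C : Fin n → Finset (Fin n) := fun b =>
    (vset n (2 * m) n).filter fun c => x (b, c) = true with hC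
  have hsum : ∀ (b : Fin n) (v w : Fin n → Bool),
      ∑ c ∈ vset n (2 * m) n, (bv (v c) - bv (w c)) * bv (x (b, c))
        = ∑ c ∈ C b, (bv (v c) - bv (w c)) := by
    intro b v w
    rw [hC, Finset.sum_filter]
    refine Finset.sum_congr rfl fun c _ => ?_
    cases x (b, c) <;> simp [bv]
  have hdeg : ∀ b ∈ B, D ≤ (C b).card := by
    intro b hb
    -- The codegree with vertex 0, which lies in the first block, is a lower bound for the degree of
    -- $b$ into the far vertices.
    have hab : ((⟨0, by omega⟩ : Fin n), b) ∈ block n m := by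
      rw [mem_block]; rw [hB, mem_vset] at hb; exact ⟨hm0, hb⟩
    refine (hx _ hab).trans ?_
    rw [hC, Finset.card_filter, Nat.cast_sum, codeg]
    refine Finset.sum_le_sum fun c _ => ?_
    refine (mul_le_of_le_one_left (bv_nonneg _) (bv_le_one _)).trans (le_of_eq ?_)
    cases x (b, c) <;> simp [bv]
  have e1 : rowEx n m p θ x ≤ ex p (fun v : Fin n → Bool => ex p (fun w : Fin n → Bool =>
      (m : ℝ)⁻¹ * ∑ b ∈ B, Real.exp (-(m * (p * (1 - p)) *
        (1 - Real.cos (θ * ∑ c ∈ C b, (bv (v c) - bv (w c)))))))) := by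
    refine ex_mono h0.le h1.le fun v => ex_mono h0.le h1.le fun w => ?_
    simp only [hsum]
    refine (Finset.prod_le_prod (fun _ _ => norm_nonneg _)
      fun b _ => norm_chi_le_exp p _).trans ?_
    rw [← Real.exp_sum, Finset.sum_neg_distrib]
    refine (exp_neg_sum_le B hBne _).trans (le_of_eq ?_)
    rw [hBc, div_eq_inv_mul]
    simp only [mul_assoc]
  refine e1.trans ?_
  simp only [ex_mul_left, ex_sum]
  have hm' : (0 : ℝ) < m := by exact_mod_cast hm0
  rw [inv_mul_le_iff₀ hm']
  have hRm : (m : ℝ) * R = ∑ b ∈ B, R := by rw [Finset.sum_const, hBc, nsmul_eq_mul]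
  rw [hRm]
  refine Finset.sum_le_sum fun b hb => ?_
  refine (ex_exp_neg_le h0 h1 θ (C b) (k := m * (p * (1 - p))) (by positivity)).trans ?_
  rw [hR]
  have hcos : 0 ≤ 2 * (p * (1 - p)) * (1 - Real.cos θ) :=
    mul_nonneg (by positivity) (by linarith [Real.cos_le_one θ])
  gcongr
  exact hdeg b hb

lemma norm_phi_sq_le_exp {m : ℕ} (hm : 2 * m ≤ n) (hm0 : 0 < m) {p : ℝ} (h0 : 0 < p) (h1 : p < 1)
    (θ D : ℝ) :
    ‖phi n p θ‖ ^ 2 ≤ Real.exp (-(m * (min (m * (p * (1 - p)) *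
      (min (D * (2 * (p * (1 - p)) * (1 - Real.cos θ))) 1 / 2))
        (1 / (3 + 2 / (p * (1 - p)))) / 2)))
      + m ^ 2 * Real.exp (D - p ^ 2 / 2 * (n - 2 * m)) := by
  have hcardC : (((vset n (2 * m) n).card : ℕ) : ℝ) = n - 2 * m := by
    rw [card_vset le_rfl, Nat.cast_sub hm]; push_cast; ring
  have hcardF : (((block n m).card : ℕ) : ℝ) = (m : ℝ) ^ 2 := by
    rw [card_block hm]; push_cast; ring
  refine (norm_phi_sq_le m h0.le h1.le θ).trans ?_
  rw [← hcardC, ← hcardF]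
  simp only [ex_ex_prod_block (by omega : m ≤ n)]
  refine ex_le_of_codeg h0.le h1.le _ _ ?_ D _ (Real.exp_pos _).le _ ?_ ?_
  · intro e he h
    rw [mem_block, h] at he
    omega
  · intro x
    exact pow_le_one₀ (rowEx_nonneg m h0.le h1.le θ x) (rowEx_le_one m h0.le h1.le θ x)
  · intro x hx
    have h2 := rowEx_le hm hm0 h0 h1 θ x hx
    set κ := min (m * (p * (1 - p)) *
      (min (D * (2 * (p * (1 - p)) * (1 - Real.cos θ))) 1 / 2))
        (1 / (3 + 2 / (p * (1 - p)))) / 2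
    have h3 : rowEx n m p θ x ≤ Real.exp (-κ) := by linarith [Real.add_one_le_exp (-κ)]
    refine (pow_le_pow_left₀ (rowEx_nonneg m h0.le h1.le θ x) h3 m).trans_eq ?_
    rw [← Real.exp_nat_mul, mul_neg]

end Decoupling

/-! ### Bounds for the characteristic function in terms of a single scale -/

section Scale

lemma norm_phi_le_mid {p : ℝ} (h0 : 0 < p) (h1 : p < 1) :
    ∃ c : ℝ, 0 < c ∧ ∀ (n : ℕ) (L θ : ℝ), 64 ≤ n → 1 ≤ L → L ≤ √(n : ℝ) →
      L / (n : ℝ) ^ 2 ≤ |θ| → |θ| ≤ L / (n * √(n : ℝ)) →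
      ‖phi n p θ‖ ≤ 34 * (n : ℝ) ^ 3 * Real.exp (-(c * L ^ 2)) + L ^ 2 / n := by
  have hpq : 0 < p * (1 - p) := mul_pos h0 (sub_pos.2 h1)
  set c1 := p * (1 - p) * (2 / Real.pi ^ 2 * (p ^ 2 / 32) ^ 2) / 8 with hc1
  set c2 := p ^ 2 / 8 with hc2
  have hc1p : 0 < c1 := by have := Real.pi_pos; positivity
  have hc2p : 0 < c2 := by positivity
  refine ⟨min c1 c2, lt_min hc1p hc2p, fun n L θ hn hL1 hLs hθ1 hθ2 => ?_⟩
  have hn' : (64 : ℝ) ≤ n := by exact_mod_cast hn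
  have hnp : (0 : ℝ) < n := by linarith
  set s := √(n : ℝ) with hs
  have hss : s * s = n := Real.mul_self_sqrt hnp.le
  have hs8 : 8 ≤ s := Real.le_sqrt_of_sq_le (by linarith)
  have hL0 : 0 < L := by linarith
  have hθ0 : 0 < |θ| := lt_of_lt_of_le (by positivity) hθ1
  have hθn : |θ| * (n * s) ≤ L := by rwa [le_div_iff₀ (by positivity)] at hθ2
  have hθn2 : L ≤ |θ| * (n : ℝ) ^ 2 := by rwa [div_le_iff₀ (by positivity)] at hθ1
  -- This block size makes $k|\theta|n$ of order $L$. The bounds on $|\theta|$ keep it between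
  -- $\sqrt n/4\ge2$ and $n/4$.
  set κ := L / (4 * |θ| * n) with hκ
  have hκeq : κ * (|θ| * n) = L / 4 := by rw [hκ]; field_simp
  have hκ0 : 0 < κ := by positivity
  have hκs : s / 4 ≤ κ := by
    rw [hκ, le_div_iff₀ (by positivity)]; linarith
  have hκn : κ ≤ n / 4 := by
    rw [hκ, div_le_iff₀ (by positivity)]; linarith
  set k := ⌊κ⌋₊ with hk
  have hkle : (k : ℝ) ≤ κ := Nat.floor_le hκ0.le
  have hkge : κ - 1 ≤ k := by linarith [Nat.lt_floor_add_one κ]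
  have hk2 : κ / 2 ≤ k := by linarith
  have hk2n : 2 ≤ k := Nat.le_floor (by push_cast; linarith)
  have h2k : 2 * k ≤ n := by
    have : (2 : ℝ) * k ≤ n := by linarith
    exact_mod_cast this
  have hθnle : |θ| * n ≤ 1 := by
    have : |θ| * n * s ≤ 1 * s := by linarith
    exact le_of_mul_le_mul_right this (by linarith)
  -- Half of the guaranteed $p^2(n-2k)/2\ge p^2n/4$, so the Chernoff exponent is at most $-p^2n/8$.
  set D := p ^ 2 / 8 * n with hD
  have hblock := norm_phi_le_block h2k h0.le h1.le (θ := θ) (D := D)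
    (by linarith [Real.pi_gt_three]) (by positivity)
  have hLn : L ^ 2 ≤ n := by rw [← hss, sq]; exact mul_self_le_mul_self hL0.le hLs
  -- the linear part
  have t1 : Real.exp (-(p * (1 - p) * (2 / Real.pi ^ 2 * (|θ| * D) ^ 2))) ^ (k ^ 2 - 2)
      ≤ Real.exp (-(min c1 c2 * L ^ 2)) := by
    rw [← Real.exp_nat_mul, Real.exp_le_exp, mul_neg, neg_le_neg_iff]
    have hcast : κ ^ 2 / 8 ≤ ((k ^ 2 - 2 : ℕ) : ℝ) := by
      have hk4 : 2 ≤ k ^ 2 := by nlinarith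
      rw [Nat.cast_sub hk4]; push_cast
      have : (2 : ℝ) ≤ k := by exact_mod_cast hk2n
      have h3 : (κ / 2) ^ 2 ≤ (k : ℝ) ^ 2 := by gcongr
      have h4 : (2 : ℝ) ^ 2 ≤ (k : ℝ) ^ 2 := by gcongr
      linarith
    have e1 : (κ ^ 2 / 8) * (p * (1 - p) * (2 / Real.pi ^ 2 * (|θ| * D) ^ 2)) = c1 * L ^ 2 := by
      have : |θ| * D = p ^ 2 / 8 * (|θ| * n) := by rw [hD]; ring
      have e2 : κ ^ 2 * (|θ| * D) ^ 2 = (p ^ 2 / 32) ^ 2 * L ^ 2 := by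
        rw [this]
        calc _ = (p ^ 2 / 8) ^ 2 * (κ * (|θ| * n)) ^ 2 := by ring
          _ = _ := by rw [hκeq]; ring
      rw [hc1]
      linear_combination (p * (1 - p) * (2 / Real.pi ^ 2) / 8) * e2
    calc min c1 c2 * L ^ 2 ≤ c1 * L ^ 2 := by gcongr; exact min_le_left _ _
      _ = _ := e1.symm
      _ ≤ _ := by gcongr
  have hk3 : (k : ℝ) ≤ n := by linarith
  have t2 : 1 + |θ| * (32 * (k : ℝ) ^ 3) ≤ 33 * (n : ℝ) ^ 3 := by
    have a1 : |θ| ≤ 1 := by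
      have := mul_le_mul_of_nonneg_left (by linarith : (1 : ℝ) ≤ n) hθ0.le
      linarith
    have a2 : (k : ℝ) ^ 3 ≤ (n : ℝ) ^ 3 := by gcongr
    have a3 : (1 : ℝ) ≤ (n : ℝ) ^ 3 := one_le_pow₀ (by linarith)
    have a4 : |θ| * (32 * (k : ℝ) ^ 3) ≤ 1 * (32 * (n : ℝ) ^ 3) := by gcongr
    linarith
  -- Here $64\theta^2\kappa^3=L^3/(|\theta|n^3)$, and $|\theta|\ge L/n^2$.
  have t3 : 2 * θ ^ 2 * (32 * (k : ℝ) ^ 3) ≤ L ^ 2 / n := by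
    have a1 : (k : ℝ) ^ 3 ≤ κ ^ 3 := by gcongr
    have a2 : θ ^ 2 * κ ^ 3 * (|θ| * (n : ℝ) ^ 3) = L ^ 3 / 64 := by
      calc _ = |θ| ^ 2 * κ ^ 3 * (|θ| * (n : ℝ) ^ 3) := by rw [sq_abs]
        _ = (κ * (|θ| * n)) ^ 3 := by ring
        _ = _ := by rw [hκeq]; ring
    have a3 : 64 * (θ ^ 2 * κ ^ 3) ≤ L ^ 2 / n := by
      rw [le_div_iff₀ hnp]
      have h5 : 0 ≤ θ ^ 2 * κ ^ 3 := by positivity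
      have h6 : θ ^ 2 * κ ^ 3 * n * L ≤ θ ^ 2 * κ ^ 3 * n * (|θ| * (n : ℝ) ^ 2) := by gcongr
      have h7 : θ ^ 2 * κ ^ 3 * n * (|θ| * (n : ℝ) ^ 2) = L ^ 3 / 64 := by rw [← a2]; ring
      have h8 : (64 * (θ ^ 2 * κ ^ 3) * n) * L ≤ L ^ 2 * L := by linarith
      exact le_of_mul_le_mul_right h8 hL0
    have a4 : θ ^ 2 * (k : ℝ) ^ 3 ≤ θ ^ 2 * κ ^ 3 := by gcongr
    linarith
  have t4 : (k : ℝ) ^ 2 * Real.exp (D - p ^ 2 / 2 * (n - 2 * k))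
      ≤ (n : ℝ) ^ 3 * Real.exp (-(min c1 c2 * L ^ 2)) := by
    have a1 : (k : ℝ) ^ 2 ≤ (n : ℝ) ^ 3 := by
      calc (k : ℝ) ^ 2 ≤ (n : ℝ) ^ 2 := by gcongr
        _ ≤ (n : ℝ) ^ 3 := pow_le_pow_right₀ (by linarith) (by norm_num)
    have a2 : D - p ^ 2 / 2 * (n - 2 * k) ≤ -(min c1 c2 * L ^ 2) := by
      have b1 : min c1 c2 * L ^ 2 ≤ c2 * n := by
        have := min_le_right c1 c2
        gcongr
      have b2 : p ^ 2 / 2 * (n / 2) ≤ p ^ 2 / 2 * (n - 2 * k) := by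
        gcongr; linarith
      rw [hD]
      rw [hc2] at b1
      linarith
    gcongr
  calc ‖phi n p θ‖ ≤ _ := hblock
    _ ≤ Real.exp (-(min c1 c2 * L ^ 2)) * (33 * (n : ℝ) ^ 3) + L ^ 2 / n
        + (n : ℝ) ^ 3 * Real.exp (-(min c1 c2 * L ^ 2)) := by gcongr
    _ = _ := by ring

lemma norm_phi_sq_le_far {p : ℝ} (h0 : 0 < p) (h1 : p < 1) :
    ∃ c ε : ℝ, 0 < c ∧ 0 < ε ∧ ∀ (n : ℕ) (L θ : ℝ), 8 ≤ n → 0 ≤ L → L ^ 2 ≤ ε * n →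
      L / (n * √(n : ℝ)) ≤ |θ| → |θ| ≤ Real.pi →
      ‖phi n p θ‖ ^ 2 ≤ 2 * (n : ℝ) ^ 2 * Real.exp (-(c * L ^ 2)) := by
  have hpq : 0 < p * (1 - p) := mul_pos h0 (sub_pos.2 h1)
  have hπ := Real.pi_pos
  set A := p ^ 2 / 8 * (2 * (p * (1 - p)) * (2 / Real.pi ^ 2)) with hA
  set B := p * (1 - p) / 16 * A with hB
  set C := 1 / (3 + 2 / (p * (1 - p))) with hC
  have hA0 : 0 < A := by positivity
  have hB0 : 0 < B := by positivity
  have hC0 : 0 < C := by positivity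
  -- The entries of $\varepsilon$ give $L^2\le n$, $AL^2\le n$ and $BL^2\le Cn$, so that the lower
  -- bounds $AL^2/n^2$ and $BL^2/n$ stay below the cutoffs 1 and $C$ in the two minima.
  refine ⟨min (B / 16) (p ^ 2 / 8), min 1 (min (1 / A) (C / B)), by positivity, by positivity,
    fun n L θ hn hL hLn hθ1 hθ2 => ?_⟩
  set c := min (B / 16) (p ^ 2 / 8) with hc
  have hn' : (8 : ℝ) ≤ n := by exact_mod_cast hn
  have hnp : (0 : ℝ) < n := by linarith
  set s := √(n : ℝ) with hs
  have hss : s * s = n := Real.mul_self_sqrt hnp.le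
  have hs0 : 0 < s := Real.sqrt_pos.2 hnp
  have hLn1 : L ^ 2 ≤ n := by
    refine hLn.trans ?_
    have := min_le_left 1 (min (1 / A) (C / B))
    nlinarith
  have hLA : A * L ^ 2 ≤ n := by
    have h2 : L ^ 2 ≤ 1 / A * n := hLn.trans (by
      gcongr; exact (min_le_right _ _).trans (min_le_left _ _))
    calc A * L ^ 2 ≤ A * (1 / A * n) := by gcongr
      _ = n := by field_simp
  have hLB : B * L ^ 2 ≤ C * n := by
    have h2 : L ^ 2 ≤ C / B * n := hLn.trans (by
      gcongr; exact (min_le_right _ _).trans (min_le_right _ _))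
    calc B * L ^ 2 ≤ B * (C / B * n) := by gcongr
      _ = C * n := by field_simp
  set m := n / 4 with hm
  have hm1 : (n : ℝ) / 8 ≤ m := by
    have : n ≤ 8 * m := by omega
    have : (n : ℝ) ≤ 8 * m := by exact_mod_cast this
    linarith
  have hm2 : (m : ℝ) ≤ n / 4 := by
    have : 4 * m ≤ n := by omega
    have : (4 : ℝ) * m ≤ n := by exact_mod_cast this
    linarith
  set D := p ^ 2 / 8 * n with hD
  have h := norm_phi_sq_le_exp (n := n) (m := m) (by omega) (by omega) h0 h1 θ D
  have hcos : 2 / Real.pi ^ 2 * (L ^ 2 / n ^ 3) ≤ 1 - Real.cos θ := by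
    have h2 := Real.cos_le_one_sub_mul_cos_sq hθ2
    have h3 : L ^ 2 / (n : ℝ) ^ 3 ≤ θ ^ 2 := by
      have h4 : (L / (n * s)) ^ 2 ≤ |θ| ^ 2 := by gcongr
      rw [sq_abs] at h4
      refine le_trans (le_of_eq ?_) h4
      rw [div_pow]
      congr 1
      calc (n : ℝ) ^ 3 = n ^ 2 * n := by ring
        _ = n ^ 2 * (s * s) := by rw [hss]
        _ = _ := by ring
    have h5 : 2 / Real.pi ^ 2 * (L ^ 2 / (n : ℝ) ^ 3) ≤ 2 / Real.pi ^ 2 * θ ^ 2 := by gcongr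
    linarith
  have k1 : A * L ^ 2 / n ^ 2 ≤ min (D * (2 * (p * (1 - p)) * (1 - Real.cos θ))) 1 := by
    refine le_min ?_ ?_
    · calc A * L ^ 2 / n ^ 2
          = D * (2 * (p * (1 - p)) * (2 / Real.pi ^ 2 * (L ^ 2 / n ^ 3))) := by
            rw [hA, hD]; field_simp
        _ ≤ _ := by gcongr
    · rw [div_le_one (by positivity)]
      nlinarith
  have k2 : B * L ^ 2 / n ≤ m * (p * (1 - p)) *
      (min (D * (2 * (p * (1 - p)) * (1 - Real.cos θ))) 1 / 2) := by
    calc B * L ^ 2 / n = (n / 8) * (p * (1 - p)) * (A * L ^ 2 / n ^ 2 / 2) := by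
          rw [hB]; field_simp; ring
      _ ≤ _ := by gcongr
  have k3 : B * L ^ 2 / n ≤ min (m * (p * (1 - p)) *
      (min (D * (2 * (p * (1 - p)) * (1 - Real.cos θ))) 1 / 2)) C := by
    refine le_min k2 ?_
    rw [div_le_iff₀ hnp]; exact hLB
  have t1 : Real.exp (-(m * (min (m * (p * (1 - p)) *
      (min (D * (2 * (p * (1 - p)) * (1 - Real.cos θ))) 1 / 2)) C / 2)))
      ≤ (n : ℝ) ^ 2 * Real.exp (-(c * L ^ 2)) := by
    have a1 : c * L ^ 2 ≤ m * (min (m * (p * (1 - p)) *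
      (min (D * (2 * (p * (1 - p)) * (1 - Real.cos θ))) 1 / 2)) C / 2) := by
      calc c * L ^ 2 ≤ B / 16 * L ^ 2 := by gcongr; exact min_le_left _ _
        _ = (n / 8) * (B * L ^ 2 / n / 2) := by field_simp; ring
        _ ≤ _ := by gcongr
    calc _ ≤ Real.exp (-(c * L ^ 2)) := Real.exp_le_exp.2 (neg_le_neg a1)
      _ ≤ _ := le_mul_of_one_le_left (Real.exp_pos _).le (one_le_pow₀ (by linarith))
  have t2 : (m : ℝ) ^ 2 * Real.exp (D - p ^ 2 / 2 * (n - 2 * m))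
      ≤ (n : ℝ) ^ 2 * Real.exp (-(c * L ^ 2)) := by
    have a1 : (m : ℝ) ≤ n := by linarith
    have a2 : D - p ^ 2 / 2 * (n - 2 * m) ≤ -(c * L ^ 2) := by
      have b1 : c * L ^ 2 ≤ p ^ 2 / 8 * n := by
        have := min_le_right (B / 16) (p ^ 2 / 8)
        gcongr
      have b2 : p ^ 2 / 2 * (n / 2) ≤ p ^ 2 / 2 * (n - 2 * m) := by
        gcongr; linarith
      rw [hD]
      linarith
    gcongr
  refine h.trans ?_
  linarith

end Scale

/-! ### Fourier inversion -/

section Inversion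

variable {n : ℕ}

lemma integral_exp_int (d : ℤ) :
    ∫ θ in (-Real.pi)..Real.pi, Complex.exp ((θ * d : ℝ) * Complex.I)
      = if d = 0 then (2 * Real.pi : ℂ) else 0 := by
  split_ifs with hd
  · subst hd
    simp
    ring
  · have hc : (d : ℂ) * Complex.I ≠ 0 := mul_ne_zero (by exact_mod_cast hd) Complex.I_ne_zero
    have e : ∀ θ : ℝ, Complex.exp ((θ * d : ℝ) * Complex.I)
        = Complex.exp (((d : ℂ) * Complex.I) * θ) := by
      intro θ; congr 1; push_cast; ring
    simp only [e]
    rw [integral_exp_mul_complex hc]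
    have : Complex.exp ((d : ℂ) * Complex.I * (Real.pi : ℝ))
        = Complex.exp ((d : ℂ) * Complex.I * ((-Real.pi : ℝ) : ℂ)) := by
      rw [Complex.exp_eq_exp_iff_exists_int]
      exact ⟨d, by push_cast; ring⟩
    rw [this, sub_self, zero_div]

lemma continuous_phi (n : ℕ) (p : ℝ) : Continuous (phi n p) := by
  unfold phi ex
  fun_prop

/-- Fourier inversion on the integers: $S_n-k$ is an integer, so each outcome contributes $2\pi$ or
0. -/
lemma integral_phi (p : unitInterval) (k : ℤ) :
    ∫ θ in (-Real.pi)..Real.pi,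
      Complex.exp ((-(θ * (k - mu n p)) : ℝ) * Complex.I) * phi n p θ
      = 2 * Real.pi * ((randomGraph n p).real {G | (S n G : ℤ) = k} : ℝ) := by
  classical
  have e1 : ∀ θ : ℝ, Complex.exp ((-(θ * (k - mu n p)) : ℝ) * Complex.I) * phi n p θ
      = ∑ x : Fin n × Fin n → Bool, wt (p : ℝ) x •
        Complex.exp ((θ * (((S n (graphOf x) : ℤ) - k : ℤ) : ℝ) : ℝ) * Complex.I) := by
    intro θ
    rw [phi, ← ex_mul_left, ex]
    refine Finset.sum_congr rfl fun x _ => ?_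
    rw [← Complex.exp_add, ← card_S x]
    congr 2
    rw [mu]; push_cast; ring
  simp only [e1]
  rw [intervalIntegral.integral_finsetSum]
  · rw [measureReal_randomGraph p (fun G => (S n G : ℤ) = k), ex]
    rw [Complex.ofReal_sum, Finset.mul_sum]
    refine Finset.sum_congr rfl fun x _ => ?_
    rw [intervalIntegral.integral_smul]
    have := integral_exp_int ((S n (graphOf x) : ℤ) - k)
    rw [this, Complex.real_smul]
    by_cases h : (S n (graphOf x) : ℤ) = k
    · simp [h]; ring
    · simp [h, sub_eq_zero]
  · intro x _
    apply Continuous.intervalIntegrable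
    fun_prop

lemma integral_gaussian_fourier {s : ℝ} (hs : 0 < s) (y : ℝ) :
    ∫ θ : ℝ, Complex.exp ((-(θ * y) : ℝ) * Complex.I) * (Real.exp (-(s ^ 2 * θ ^ 2 / 2)) : ℝ)
      = 2 * Real.pi * ((1 / s * gaussian (y / s) : ℝ) : ℂ) := by
  have hb : 0 < (((s ^ 2 / 2 : ℝ)) : ℂ).re := by rw [Complex.ofReal_re]; positivity
  have h := fourierIntegral_gaussian hb ((-y : ℝ) : ℂ)
  have e : ∀ θ : ℝ, Complex.exp ((-(θ * y) : ℝ) * Complex.I) * (Real.exp (-(s ^ 2 * θ ^ 2 / 2)) : ℝ)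
      = Complex.exp (Complex.I * ((-y : ℝ) : ℂ) * θ)
        * Complex.exp (-((s ^ 2 / 2 : ℝ) : ℂ) * θ ^ 2) := by
    intro θ
    rw [Complex.ofReal_exp]
    congr 2 <;> push_cast <;> ring
  simp only [e]
  rw [h]
  have hpi := Real.pi_pos
  have e2 : ((Real.pi : ℂ) / ((s ^ 2 / 2 : ℝ) : ℂ)) ^ (1 / 2 : ℂ)
      = ((√(2 * Real.pi) / s : ℝ) : ℂ) := by
    rw [← Complex.ofReal_div]
    have : (1 / 2 : ℂ) = ((1 / 2 : ℝ) : ℂ) := by push_cast; rfl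
    rw [this, ← Complex.ofReal_cpow (by positivity), ← Real.sqrt_eq_rpow]
    congr 1
    have : Real.pi / (s ^ 2 / 2) = 2 * Real.pi / s ^ 2 := by field_simp
    rw [this, Real.sqrt_div (by positivity), Real.sqrt_sq hs.le]
  have e3 : Complex.exp (-((-y : ℝ) : ℂ) ^ 2 / (4 * ((s ^ 2 / 2 : ℝ) : ℂ)))
      = ((Real.exp (-(y / s) ^ 2 / 2) : ℝ) : ℂ) := by
    rw [Complex.ofReal_exp]
    congr 1
    have : (s : ℂ) ≠ 0 := by exact_mod_cast hs.ne'
    push_cast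
    field_simp
    ring
  rw [e2, e3, gaussian]
  have e4 : 2 * Real.pi * (1 / s * (1 / √(2 * Real.pi) * Real.exp (-(y / s) ^ 2 / 2)))
      = √(2 * Real.pi) / s * Real.exp (-(y / s) ^ 2 / 2) := by
    have h2 : 2 * Real.pi = √(2 * Real.pi) * √(2 * Real.pi) :=
      (Real.mul_self_sqrt (by positivity)).symm
    have h3 : √(2 * Real.pi) ≠ 0 := (Real.sqrt_pos.2 (by positivity)).ne'
    nth_rewrite 1 [h2]
    field_simp
  rw [← Complex.ofReal_mul, ← e4]
  push_cast
  ring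

/-- The characteristic function cut off to one period. -/
def cutPhi (n : ℕ) (p : ℝ) (θ : ℝ) : ℂ := (Set.Ioc (-Real.pi) Real.pi).indicator (phi n p) θ

/-- The `L¹` distance between the characteristic functions, scaled by `σ`. -/
def fourierErr (n : ℕ) (p : unitInterval) : ℝ :=
  sigma n p * ∫ θ : ℝ, ‖cutPhi n p θ - (Real.exp (-(sigma n p ^ 2 * θ ^ 2 / 2)) : ℝ)‖

lemma integrable_cutPhi (n : ℕ) (p : ℝ) : Integrable (cutPhi n p) := by
  have h : IntegrableOn (phi n p) (Set.Ioc (-Real.pi) Real.pi) :=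
    ((continuous_phi n p).integrableOn_Icc).mono_set Set.Ioc_subset_Icc_self
  exact h.integrable_indicator measurableSet_Ioc

lemma integrable_gaussian {s : ℝ} (hs : 0 < s) :
    Integrable fun θ : ℝ => Real.exp (-(s ^ 2 * θ ^ 2 / 2)) := by
  have := integrable_exp_neg_mul_sq (b := s ^ 2 / 2) (by positivity)
  refine this.congr (Filter.Eventually.of_forall fun θ => ?_)
  simp only
  congr 1; ring

/-- Both quantities are Fourier integrals with the same phase, and $k$ enters only through that
phase; hence the bound is uniform in $k$. The factor $1/(2\pi)$ is dropped. -/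
lemma abs_prob_sub_gaussian_le (p : unitInterval) (hs : 0 < sigma n p) (k : ℤ) :
    |sigma n p * (randomGraph n p).real {G | (S n G : ℤ) = k}
      - gaussian (((k : ℝ) - mu n p) / sigma n p)| ≤ fourierErr n p := by
  set s := sigma n p with hsdef
  set P := (randomGraph n p).real {G | (S n G : ℤ) = k}
  set y := (k : ℝ) - mu n p with hy
  set N := gaussian (y / s)
  have hpi := Real.pi_pos
  have i1 : ∫ θ : ℝ, Complex.exp ((-(θ * y) : ℝ) * Complex.I) * cutPhi n p θ
      = 2 * Real.pi * (P : ℝ) := by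
    rw [← integral_phi p k, intervalIntegral.integral_of_le (by linarith),
      ← integral_indicator measurableSet_Ioc]
    congr 1; ext θ
    by_cases hθ : θ ∈ Set.Ioc (-Real.pi) Real.pi
    · simp only [cutPhi, Set.indicator_of_mem hθ]
      rfl
    · simp only [cutPhi, Set.indicator_of_notMem hθ, mul_zero]
  have i2 := integral_gaussian_fourier hs y
  have hexp : Continuous fun θ : ℝ => Complex.exp ((-(θ * y) : ℝ) * Complex.I) := by fun_prop
  have hbd : ∀ θ : ℝ, ‖Complex.exp ((-(θ * y) : ℝ) * Complex.I)‖ ≤ 1 := fun θ =>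
    (Complex.norm_exp_ofReal_mul_I _).le
  have j1 : Integrable fun θ : ℝ => Complex.exp ((-(θ * y) : ℝ) * Complex.I) * cutPhi n p θ :=
    (integrable_cutPhi n p).bdd_mul hexp.aestronglyMeasurable (Filter.Eventually.of_forall hbd)
  have j2 : Integrable fun θ : ℝ => Complex.exp ((-(θ * y) : ℝ) * Complex.I)
      * (Real.exp (-(s ^ 2 * θ ^ 2 / 2)) : ℝ) :=
    ((integrable_gaussian hs).ofReal (𝕜 := ℂ)).bdd_mul hexp.aestronglyMeasurable
      (Filter.Eventually.of_forall hbd)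
  have key : ((s * P - N : ℝ) : ℂ) = (s / (2 * Real.pi) : ℝ) * ∫ θ : ℝ,
      Complex.exp ((-(θ * y) : ℝ) * Complex.I)
        * (cutPhi n p θ - (Real.exp (-(s ^ 2 * θ ^ 2 / 2)) : ℝ)) := by
    have : ∀ θ : ℝ, Complex.exp ((-(θ * y) : ℝ) * Complex.I)
        * (cutPhi n p θ - (Real.exp (-(s ^ 2 * θ ^ 2 / 2)) : ℝ))
        = Complex.exp ((-(θ * y) : ℝ) * Complex.I) * cutPhi n p θ
          - Complex.exp ((-(θ * y) : ℝ) * Complex.I) * (Real.exp (-(s ^ 2 * θ ^ 2 / 2)) : ℝ) :=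
      fun θ => mul_sub _ _ _
    simp only [this]
    rw [integral_sub j1 j2, i1, i2]
    have hsc : (s : ℂ) ≠ 0 := by exact_mod_cast hs.ne'
    have hpc : (Real.pi : ℂ) ≠ 0 := by exact_mod_cast hpi.ne'
    push_cast
    field_simp
    rfl
  have hn : |s * P - N| = ‖((s * P - N : ℝ) : ℂ)‖ := by
    rw [Complex.norm_real, Real.norm_eq_abs]
  rw [hn, key, norm_mul, Complex.norm_real, Real.norm_of_nonneg (by positivity), fourierErr]
  have hint : ‖∫ θ : ℝ, Complex.exp ((-(θ * y) : ℝ) * Complex.I)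
        * (cutPhi n p θ - (Real.exp (-(s ^ 2 * θ ^ 2 / 2)) : ℝ))‖
      ≤ ∫ θ : ℝ, ‖cutPhi n p θ - (Real.exp (-(s ^ 2 * θ ^ 2 / 2)) : ℝ)‖ := by
    refine (norm_integral_le_integral_norm _).trans_eq ?_
    congr 1; ext θ
    rw [norm_mul, Complex.norm_exp_ofReal_mul_I, one_mul]
  refine mul_le_mul ?_ hint (norm_nonneg _) hs.le
  exact div_le_self hs.le (by linarith [Real.pi_gt_three])

end Inversion

/-! ### The limit -/

section Limit

variable {n : ℕ}

lemma sigma_sq_ge (hn : 4 ≤ n) (p : unitInterval) :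
    (p : ℝ) ^ 5 * (1 - p) / 16 * (n : ℝ) ^ 4 ≤ sigma n p ^ 2 := by
  have h0 := p.2.1
  have h1 := p.2.2
  have hn' : (4 : ℝ) ≤ n := by exact_mod_cast hn
  rw [sigma_sq, Nat.cast_choose_two]
  have hr := ex_nonneg h0 h1 (f := fun x => rem (n := n) (p : ℝ) x ^ 2) (fun x => sq_nonneg _)
  have a1 : ((n : ℝ) / 2) ^ 2 ≤ ((n : ℝ) - 2) ^ 2 := by gcongr; linarith
  have a2 : (n : ℝ) ^ 2 / 4 ≤ (n : ℝ) * (n - 1) / 2 := by nlinarith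
  have hq : 0 ≤ 1 - (p : ℝ) := sub_nonneg.2 h1
  calc (p : ℝ) ^ 5 * (1 - p) / 16 * (n : ℝ) ^ 4
      = (p : ℝ) ^ 4 * ((n : ℝ) / 2) ^ 2 * ((n : ℝ) ^ 2 / 4 * ((p : ℝ) * (1 - p))) := by ring
    _ ≤ (p : ℝ) ^ 4 * ((n : ℝ) - 2) ^ 2 * ((n : ℝ) * (n - 1) / 2 * ((p : ℝ) * (1 - p))) := by
        gcongr
    _ ≤ _ := by linarith

lemma sigma_sq_le (hn : 2 ≤ n) (p : unitInterval) : sigma n p ^ 2 ≤ 2 * (n : ℝ) ^ 4 := by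
  have h0 := p.2.1
  have h1 := p.2.2
  have hn' : (2 : ℝ) ≤ n := by exact_mod_cast hn
  rw [sigma_sq]
  have hr := ex_rem_sq_le (n := n) h0 h1
  have hq : 0 ≤ 1 - (p : ℝ) := sub_nonneg.2 h1
  have hn2 : (0 : ℝ) ≤ n - 2 := by linarith
  have a1 : (p : ℝ) ^ 4 ≤ 1 := pow_le_one₀ h0 h1
  have a2 : ((n : ℝ) - 2) ^ 2 ≤ (n : ℝ) ^ 2 := by gcongr; linarith
  have a3 : (n.choose 2 : ℝ) ≤ (n : ℝ) ^ 2 := by exact_mod_cast Nat.choose_le_pow n 2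
  have a4 : (p : ℝ) * (1 - p) ≤ 1 := by nlinarith
  have a5 : (p : ℝ) ^ 4 * ((n : ℝ) - 2) ^ 2 * (n.choose 2 * ((p : ℝ) * (1 - p)))
      ≤ 1 * (n : ℝ) ^ 2 * ((n : ℝ) ^ 2 * 1) := by gcongr
  have a6 : (n : ℝ) ^ 3 ≤ (n : ℝ) ^ 4 := pow_le_pow_right₀ (by linarith) (by norm_num)
  nlinarith

lemma sigma_pos (hn : 3 ≤ n) {p : unitInterval} (hp0 : 0 < p) (hp1 : p < 1) : 0 < sigma n p := by
  have h0 : (0 : ℝ) < p := hp0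
  have h1 : (p : ℝ) < 1 := hp1
  have hq : 0 < 1 - (p : ℝ) := sub_pos.2 h1
  have hn' : (3 : ℝ) ≤ n := by exact_mod_cast hn
  have hr := ex_nonneg h0.le h1.le (f := fun x => rem (n := n) (p : ℝ) x ^ 2) (fun x => sq_nonneg _)
  have hs := sigma_sq (n := n) p
  have hc : (0 : ℝ) < n.choose 2 := by exact_mod_cast Nat.choose_pos (by omega)
  have hn2 : (0 : ℝ) < n - 2 := by linarith
  have : 0 < sigma n p ^ 2 := by
    rw [hs]
    have : 0 < (p : ℝ) ^ 4 * ((n : ℝ) - 2) ^ 2 * (n.choose 2 * ((p : ℝ) * (1 - p))) := by positivity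
    linarith
  exact lt_of_le_of_ne (Real.sqrt_nonneg _) fun h => by rw [← h] at this; simp at this

/-- The majorant uses nested intervals rather than annuli, which is harmless since all terms are
nonnegative. Beyond $\delta_1$ half of the Gaussian exponent is spent on smallness and the other
half on integrability. -/
lemma integral_norm_cutPhi_sub_le {p : ℝ} {s δ₁ δ₂ a b c : ℝ} (hs : 0 < s) (hδ₁ : 0 ≤ δ₁)
    (hδ₁π : δ₁ < Real.pi) (hδ₂ : 0 ≤ δ₂) (ha : 0 ≤ a) (hb : 0 ≤ b) (hc : 0 ≤ c)
    (h₁ : ∀ θ : ℝ, |θ| ≤ δ₁ → ‖phi n p θ - (Real.exp (-(s ^ 2 * θ ^ 2 / 2)) : ℝ)‖ ≤ a)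
    (h₂ : ∀ θ : ℝ, δ₁ ≤ |θ| → |θ| ≤ δ₂ → ‖phi n p θ‖ ≤ b)
    (h₃ : ∀ θ : ℝ, δ₂ ≤ |θ| → |θ| ≤ Real.pi → ‖phi n p θ‖ ≤ c) :
    ∫ θ : ℝ, ‖cutPhi n p θ - (Real.exp (-(s ^ 2 * θ ^ 2 / 2)) : ℝ)‖
      ≤ 2 * δ₁ * a + 2 * δ₂ * b + 2 * Real.pi * c
        + Real.exp (-(s ^ 2 * δ₁ ^ 2 / 4)) * (√(4 * Real.pi) / s) := by
  have hπ := Real.pi_pos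
  set I : ℝ → ℝ → ℝ → ℝ := fun δ e θ => (Set.Icc (-δ) δ).indicator (fun _ => e) θ with hI
  have hInn : ∀ δ e θ, 0 ≤ e → 0 ≤ I δ e θ := fun δ e θ he => Set.indicator_nonneg (fun _ _ => he) θ
  have hImem : ∀ δ e θ : ℝ, |θ| ≤ δ → I δ e θ = e := fun δ e θ h =>
    Set.indicator_of_mem (s := Set.Icc (-δ) δ) (Set.mem_Icc.2 (abs_le.1 h)) _
  have hIint : ∀ δ e, Integrable (I δ e) := fun δ e =>
    (integrableOn_const (by simp)).integrable_indicator measurableSet_Icc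
  have hIval : ∀ δ e, 0 ≤ δ → ∫ θ, I δ e θ = 2 * δ * e := by
    intro δ e hδ
    rw [hI]
    simp only
    rw [integral_indicator_const _ measurableSet_Icc, Real.volume_real_Icc_of_le (by linarith),
      smul_eq_mul]
    ring
  set g := Real.exp (-(s ^ 2 * δ₁ ^ 2 / 4)) with hg
  set G : ℝ → ℝ := fun θ => g * Real.exp (-(s ^ 2 / 4) * θ ^ 2) with hG
  have hGint : Integrable G := (integrable_exp_neg_mul_sq (b := s ^ 2 / 4) (by positivity)).const_mul g
  have hGval : ∫ θ, G θ = g * (√(4 * Real.pi) / s) := by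
    rw [hG, integral_const_mul, integral_gaussian]
    congr 1
    have : Real.pi / (s ^ 2 / 4) = 4 * Real.pi / s ^ 2 := by field_simp
    rw [this, Real.sqrt_div (by positivity), Real.sqrt_sq hs.le]
  have hG0 : ∀ θ, 0 ≤ G θ := fun θ => by positivity
  have hpt : ∀ θ : ℝ, ‖cutPhi n p θ - (Real.exp (-(s ^ 2 * θ ^ 2 / 2)) : ℝ)‖
      ≤ I δ₁ a θ + I δ₂ b θ + I Real.pi c θ + G θ := by
    intro θ
    have n1 := hInn δ₁ a θ ha
    have n2 := hInn δ₂ b θ hb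
    have n3 := hInn Real.pi c θ hc
    have n4 := hG0 θ
    rcases le_or_gt |θ| δ₁ with h | h
    · have hmem : θ ∈ Set.Ioc (-Real.pi) Real.pi := by
        have := abs_le.1 h
        exact ⟨by linarith, by linarith⟩
      rw [cutPhi, Set.indicator_of_mem hmem]
      have := h₁ θ h
      rw [hImem δ₁ a θ h]
      linarith
    · refine (norm_sub_le _ _).trans ?_
      have k1 : ‖((Real.exp (-(s ^ 2 * θ ^ 2 / 2)) : ℝ) : ℂ)‖ ≤ G θ := by
        rw [Complex.norm_real, Real.norm_of_nonneg (Real.exp_pos _).le, hG, hg]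
        simp only
        rw [← Real.exp_add, Real.exp_le_exp]
        have h5 : δ₁ ^ 2 ≤ θ ^ 2 := by rw [← sq_abs θ]; gcongr
        have h6 : s ^ 2 * δ₁ ^ 2 ≤ s ^ 2 * θ ^ 2 := by gcongr
        linarith
      have k2 : ‖cutPhi n p θ‖ ≤ I δ₂ b θ + I Real.pi c θ := by
        by_cases hmem : θ ∈ Set.Ioc (-Real.pi) Real.pi
        · rw [cutPhi, Set.indicator_of_mem hmem]
          have hθπ : |θ| ≤ Real.pi := abs_le.2 ⟨hmem.1.le, hmem.2⟩
          rcases le_or_gt |θ| δ₂ with h' | h'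
          · have := h₂ θ h.le h'
            rw [hImem δ₂ b θ h']
            linarith
          · have := h₃ θ h'.le hθπ
            rw [hImem Real.pi c θ hθπ]
            linarith
        · rw [cutPhi, Set.indicator_of_notMem hmem, norm_zero]
          linarith
      linarith
  have hsum : Integrable fun θ => I δ₁ a θ + I δ₂ b θ + I Real.pi c θ + G θ :=
    (((hIint δ₁ a).add (hIint δ₂ b)).add (hIint Real.pi c)).add hGint
  have hleft : Integrable fun θ : ℝ =>
      ‖cutPhi n p θ - (Real.exp (-(s ^ 2 * θ ^ 2 / 2)) : ℝ)‖ :=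
    ((integrable_cutPhi n p).sub ((integrable_gaussian hs).ofReal (𝕜 := ℂ))).norm
  refine (integral_mono hleft hsum hpt).trans_eq ?_
  have q1 : ∫ θ, (I δ₁ a θ + I δ₂ b θ + I Real.pi c θ + G θ)
      = (∫ θ, (I δ₁ a θ + I δ₂ b θ + I Real.pi c θ)) + ∫ θ, G θ :=
    integral_add (((hIint δ₁ a).add (hIint δ₂ b)).add (hIint Real.pi c)) hGint
  have q2 : ∫ θ, (I δ₁ a θ + I δ₂ b θ + I Real.pi c θ)
      = (∫ θ, (I δ₁ a θ + I δ₂ b θ)) + ∫ θ, I Real.pi c θ :=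
    integral_add ((hIint δ₁ a).add (hIint δ₂ b)) (hIint Real.pi c)
  have q3 : ∫ θ, (I δ₁ a θ + I δ₂ b θ) = (∫ θ, I δ₁ a θ) + ∫ θ, I δ₂ b θ :=
    integral_add (hIint δ₁ a) (hIint δ₂ b)
  rw [q1, q2, q3, hIval _ _ hδ₁, hIval _ _ hδ₂, hIval _ _ hπ.le, hGval]

lemma fourierErr_le {p : unitInterval} (hp0 : 0 < p) (hp1 : p < 1) :
    ∀ᶠ n : ℕ in atTop, fourierErr n p ≤ 200 * (Real.log n ^ 4 / √(n : ℝ)) := by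
  have h0 : (0 : ℝ) < p := hp0
  have h1 : (p : ℝ) < 1 := hp1
  have hq : 0 < 1 - (p : ℝ) := sub_pos.2 h1
  obtain ⟨c₁, hc₁, hmid⟩ := norm_phi_le_mid h0 h1
  obtain ⟨c₂, ε, hc₂, hε, hfar⟩ := norm_phi_sq_le_far h0 h1
  -- Chosen so that $\sigma_n^2\delta_1^2/4\ge c_3L^2$ for $\delta_1=L/n^2$.
  set c₃ := (p : ℝ) ^ 5 * (1 - p) / 64 with hc₃def
  have hc₃ : 0 < c₃ := by positivity
  have hlog : Tendsto (fun n : ℕ => Real.log n) atTop atTop :=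
    Real.tendsto_log_atTop.comp tendsto_natCast_atTop_atTop
  have hsmall : ∀ η : ℝ, 0 < η → ∀ᶠ n : ℕ in atTop, Real.log n ^ 2 ≤ η * n := by
    intro η hη
    have h := (Real.isLittleO_pow_log_id_atTop (n := 2)).comp_tendsto
      (tendsto_natCast_atTop_atTop (R := ℝ))
    filter_upwards [h.bound hη] with n hn
    simpa using hn
  filter_upwards [eventually_ge_atTop 64, hlog.eventually_ge_atTop 1,
    hlog.eventually_ge_atTop (8 / c₁), hlog.eventually_ge_atTop (8 / c₂),
    hlog.eventually_ge_atTop (8 / c₃), hsmall 1 one_pos, hsmall ε hε]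
    with n hn hL1 hLc1 hLc2 hLc3 hLn hLε
  set L := Real.log n with hLdef
  have hn' : (64 : ℝ) ≤ n := by exact_mod_cast hn
  have hnp : (0 : ℝ) < n := by linarith
  set t := √(n : ℝ) with ht
  have htt : t * t = n := Real.mul_self_sqrt hnp.le
  have ht8 : 8 ≤ t := Real.le_sqrt_of_sq_le (by linarith)
  have htn : t ≤ n := by nlinarith
  have hL0 : 0 < L := by linarith
  have hLt : L ≤ t := Real.le_sqrt_of_sq_le (by linarith)
  have hσ := sigma_pos (n := n) (by omega) hp0 hp1
  set s := sigma n p with hs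
  -- Since $L=\log n$, the condition $cL\ge8$ turns $e^{-cL^2}$ into at most $n^{-8}$.
  have hexp : ∀ c : ℝ, 0 < c → 8 / c ≤ L → Real.exp (-(c * L ^ 2)) ≤ 1 / (n : ℝ) ^ 8 := by
    intro c hc h
    rw [div_le_iff₀ hc] at h
    have h2 : Real.exp (-(8 * L)) = 1 / (n : ℝ) ^ 8 := by
      rw [Real.exp_neg, one_div, hLdef]
      congr 1
      have := Real.exp_nat_mul (Real.log n) 8
      rw [Real.exp_log hnp] at this
      push_cast at this
      exact this
    rw [← h2, Real.exp_le_exp]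
    nlinarith
  set δ₁ := L / (n : ℝ) ^ 2 with hδ₁
  set δ₂ := L / (n * t) with hδ₂
  have hδ₁0 : 0 ≤ δ₁ := by positivity
  have hδ₁π : δ₁ < Real.pi := by
    have : δ₁ ≤ 1 := by
      rw [hδ₁, div_le_one (by positivity)]; nlinarith
    linarith [Real.pi_gt_three]
  have hL3 : L ^ 2 ≤ L ^ 3 := pow_le_pow_right₀ hL1 (by norm_num)
  have hL34 : L ^ 3 ≤ L ^ 4 := pow_le_pow_right₀ hL1 (by norm_num)
  have hL13 : L ≤ L ^ 3 := by nlinarith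
  have hinv : 1 / (n : ℝ) ≤ 1 / t := one_div_le_one_div_of_le (by linarith) htn
  -- After multiplication by $\sigma_n\le2n^2$, the inner range costs at most $16L^4/\sqrt n$, the
  -- middle one $140L^3/\sqrt n$, and the far range and Gaussian tail at most $36/\sqrt n$.
  have main := integral_norm_cutPhi_sub_le (n := n) (p := p) (s := s) (δ₁ := δ₁) (δ₂ := δ₂)
    (a := 4 * L ^ 3 * (1 / t)) (b := 35 * L ^ 2 * (1 / n)) (c := 2 / (n : ℝ) ^ 3)
    hσ hδ₁0 hδ₁π (by positivity) (by positivity) (by positivity) (by positivity)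
    (by
      intro θ hθ
      refine (norm_phi_sub_gaussian_le (by omega) p θ).trans ?_
      have r1 : √((n : ℝ) ^ 3) = n * t := by
        rw [show (n : ℝ) ^ 3 = n ^ 2 * n by ring, Real.sqrt_mul (by positivity),
          Real.sqrt_sq hnp.le]
      have r2 : |θ| * √((n : ℝ) ^ 3) ≤ L * (1 / t) := by
        rw [r1]
        calc |θ| * (n * t) ≤ L / (n : ℝ) ^ 2 * (n * t) := by gcongr
          _ = L * (1 / t) := by
            rw [← htt]; field_simp
      have r3 : 2 * (n : ℝ) ^ 5 * |θ| ^ 3 ≤ 2 * L ^ 3 * (1 / n) := by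
        calc 2 * (n : ℝ) ^ 5 * |θ| ^ 3 ≤ 2 * (n : ℝ) ^ 5 * (L / (n : ℝ) ^ 2) ^ 3 := by gcongr
          _ = _ := by field_simp
      have r4 : (n : ℝ) ^ 3 * θ ^ 2 ≤ L ^ 2 * (1 / n) := by
        calc (n : ℝ) ^ 3 * θ ^ 2 = (n : ℝ) ^ 3 * |θ| ^ 2 := by rw [sq_abs]
          _ ≤ (n : ℝ) ^ 3 * (L / (n : ℝ) ^ 2) ^ 2 := by gcongr
          _ = _ := by field_simp
      have r2' : L * (1 / t) ≤ L ^ 3 * (1 / t) := by gcongr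
      have r3' : 2 * L ^ 3 * (1 / n) ≤ 2 * L ^ 3 * (1 / t) := by gcongr
      have r4' : L ^ 2 * (1 / n) ≤ L ^ 3 * (1 / t) := by gcongr
      linarith)
    (by
      intro θ hθ1 hθ2
      refine (hmid n L θ hn hL1 hLt hθ1 hθ2).trans ?_
      have r1 := hexp c₁ hc₁ hLc1
      have r2 : 34 * (n : ℝ) ^ 3 * Real.exp (-(c₁ * L ^ 2)) ≤ 34 * (1 / n) := by
        calc 34 * (n : ℝ) ^ 3 * Real.exp (-(c₁ * L ^ 2))
            ≤ 34 * (n : ℝ) ^ 3 * (1 / (n : ℝ) ^ 8) := by gcongr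
          _ = 34 * (1 / (n : ℝ) ^ 5) := by field_simp
          _ ≤ 34 * (1 / (n : ℝ) ^ 1) := by
            gcongr
            · linarith
            · norm_num
          _ = _ := by rw [pow_one]
      have r3 : 34 * (1 / (n : ℝ)) ≤ 34 * L ^ 2 * (1 / n) := by
        have : 1 ≤ L ^ 2 := one_le_pow₀ hL1
        have h6 : 34 * 1 * (1 / (n : ℝ)) ≤ 34 * L ^ 2 * (1 / n) := by gcongr
        linarith
      have r4 : L ^ 2 / n = L ^ 2 * (1 / n) := by ring
      rw [r4]; linarith)
    (by
      intro θ hθ1 hθ2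
      have r1 := hexp c₂ hc₂ hLc2
      have r2 := hfar n L θ (by omega) hL0.le hLε hθ1 hθ2
      refine le_of_sq_le_sq ?_ (by positivity)
      refine r2.trans ?_
      calc 2 * (n : ℝ) ^ 2 * Real.exp (-(c₂ * L ^ 2))
          ≤ 2 * (n : ℝ) ^ 2 * (1 / (n : ℝ) ^ 8) := by gcongr
        _ = 2 / (n : ℝ) ^ 6 := by field_simp
        _ ≤ 4 / (n : ℝ) ^ 6 := by gcongr; norm_num
        _ = _ := by field_simp; norm_num)
  have hs2 : s ≤ 2 * (n : ℝ) ^ 2 := by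
    refine le_of_sq_le_sq ?_ (by positivity)
    refine (sigma_sq_le (by omega) p).trans ?_
    have : (0 : ℝ) ≤ (n : ℝ) ^ 4 := by positivity
    nlinarith
  have hg : Real.exp (-(s ^ 2 * δ₁ ^ 2 / 4)) ≤ 1 / (n : ℝ) ^ 8 := by
    refine le_trans (Real.exp_le_exp.2 (neg_le_neg ?_)) (hexp c₃ hc₃ hLc3)
    have r1 := sigma_sq_ge (n := n) (by omega) p
    have r2 : c₃ * L ^ 2 = ((p : ℝ) ^ 5 * (1 - p) / 16 * (n : ℝ) ^ 4) * δ₁ ^ 2 / 4 := by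
      rw [hc₃def, hδ₁]; field_simp; norm_num
    rw [r2]
    gcongr
  have h4π : √(4 * Real.pi) ≤ 4 := by
    rw [Real.sqrt_le_left (by norm_num)]
    linarith [Real.pi_lt_four]
  have hlast : s * (Real.exp (-(s ^ 2 * δ₁ ^ 2 / 4)) * (√(4 * Real.pi) / s)) ≤ 4 * (1 / t) := by
    calc s * (Real.exp (-(s ^ 2 * δ₁ ^ 2 / 4)) * (√(4 * Real.pi) / s))
        = √(4 * Real.pi) * Real.exp (-(s ^ 2 * δ₁ ^ 2 / 4)) := by field_simp
      _ ≤ 4 * (1 / (n : ℝ) ^ 8) := by gcongr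
      _ ≤ 4 * (1 / (n : ℝ) ^ 1) := by
          gcongr
          · linarith
          · norm_num
      _ ≤ 4 * (1 / t) := by rw [pow_one]; gcongr
  have hfirst : s * (2 * δ₁ * (4 * L ^ 3 * (1 / t)) + 2 * δ₂ * (35 * L ^ 2 * (1 / n))
      + 2 * Real.pi * (2 / (n : ℝ) ^ 3)) ≤ 16 * L ^ 4 * (1 / t) + 140 * L ^ 3 * (1 / t)
        + 32 * (1 / t) := by
    calc _ ≤ (2 * (n : ℝ) ^ 2) * (2 * δ₁ * (4 * L ^ 3 * (1 / t)) + 2 * δ₂ * (35 * L ^ 2 * (1 / n))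
      + 2 * Real.pi * (2 / (n : ℝ) ^ 3)) := by gcongr
      _ = 16 * L ^ 4 * (1 / t) + 140 * L ^ 3 * (1 / t) + 8 * Real.pi * (1 / n) := by
        rw [hδ₁, hδ₂]; field_simp; ring
      _ ≤ _ := by
        have : 8 * Real.pi * (1 / (n : ℝ)) ≤ 8 * 4 * (1 / t) := by
          have := Real.pi_lt_four.le
          gcongr
        linarith
  have hL4 : 1 ≤ L ^ 4 := one_le_pow₀ hL1
  have f1 : 140 * L ^ 3 * (1 / t) ≤ 140 * L ^ 4 * (1 / t) := by gcongr
  have f2 : 1 * (1 / t) ≤ L ^ 4 * (1 / t) := by gcongr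
  have f3 : L ^ 4 / t = L ^ 4 * (1 / t) := by ring
  have hmain := mul_le_mul_of_nonneg_left main hσ.le
  rw [mul_add] at hmain
  rw [fourierErr, f3]
  have f4 : 0 ≤ L ^ 4 * (1 / t) := by positivity
  linarith

lemma fourierErr_nonneg (n : ℕ) (p : unitInterval) : 0 ≤ fourierErr n p :=
  mul_nonneg (Real.sqrt_nonneg _) (integral_nonneg fun _ => norm_nonneg _)

lemma tendsto_fourierErr {p : unitInterval} (hp0 : 0 < p) (hp1 : p < 1) :
    Tendsto (fun n => fourierErr n p) atTop (𝓝 0) := by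
  have h1 : Tendsto (fun n : ℕ => 200 * (Real.log n ^ 4 / √(n : ℝ))) atTop (𝓝 0) := by
    -- Substitute $x=\tfrac12\log n$, so that $\log^4n/\sqrt n=16x^4e^{-x}$.
    have h2 : Tendsto (fun x : ℝ => 200 * (16 * (x ^ 4 * Real.exp (-x)))) atTop (𝓝 0) := by
      have := ((Real.tendsto_pow_mul_exp_neg_atTop_nhds_zero 4).const_mul 16).const_mul 200
      simpa using this
    have h3 : Tendsto (fun n : ℕ => Real.log n / 2) atTop atTop :=
      (Real.tendsto_log_atTop.comp tendsto_natCast_atTop_atTop).atTop_div_const two_pos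
    refine (h2.comp h3).congr' ?_
    filter_upwards [eventually_gt_atTop 0] with n hn
    have hnp : (0 : ℝ) < n := by exact_mod_cast hn
    have : Real.exp (-(Real.log n / 2)) = 1 / √(n : ℝ) := by
      rw [Real.exp_neg, ← Real.log_sqrt hnp.le, Real.exp_log (Real.sqrt_pos.2 hnp), one_div]
    simp only [Function.comp_apply]
    rw [this]
    ring
  exact tendsto_of_tendsto_of_tendsto_of_le_of_le' tendsto_const_nhds h1
    (Filter.Eventually.of_forall fun n => fourierErr_nonneg n p) (fourierErr_le hp0 hp1)

lemma isTheta_variance {p : unitInterval} (hp0 : 0 < p) (hp1 : p < 1) :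
    (fun n : ℕ => variance (fun G => (S n G : ℝ)) (randomGraph n p))
      =Θ[atTop] fun n : ℕ => (n : ℝ) ^ 4 := by
  have h0 : (0 : ℝ) < p := hp0
  have hq : 0 < 1 - (p : ℝ) := sub_pos.2 hp1
  have hv : ∀ n : ℕ, variance (fun G => (S n G : ℝ)) (randomGraph n p) = sigma n p ^ 2 := fun n => by
    rw [sigma, Real.sq_sqrt (variance_nonneg _ _)]
  simp only [hv]
  constructor
  · refine IsBigO.of_bound 2 ?_
    filter_upwards [eventually_ge_atTop 2] with n hn
    rw [Real.norm_of_nonneg (by positivity), Real.norm_of_nonneg (by positivity)]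
    exact sigma_sq_le hn p
  · refine IsBigO.of_bound ((p : ℝ) ^ 5 * (1 - p) / 16)⁻¹ ?_
    filter_upwards [eventually_ge_atTop 4] with n hn
    rw [Real.norm_of_nonneg (by positivity), Real.norm_of_nonneg (by positivity),
      le_inv_mul_iff₀ (by positivity)]
    exact sigma_sq_ge hn p

lemma pointProb_eq (p : unitInterval) (hs : 0 < sigma n p) (k : ℤ) :
    pointProb n p (((k : ℝ) - mu n p) / sigma n p)
      = (randomGraph n p).real {G | (S n G : ℤ) = k} := by
  rw [pointProb]
  congr 1
  ext G
  simp only [Set.mem_ofPred_eq, R]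
  rw [div_left_inj' hs.ne', sub_left_inj]
  exact ⟨fun h => by exact_mod_cast h, fun h => by exact_mod_cast h⟩

end Limit

end TriangleLLT

end

/-! ### The local limit theorem -/

theorem theorem1 (p : unitInterval) (hp0 : 0 < p) (hp1 : p < 1) :
    -- the mean of `S_n` is `p³ (n choose 3)` and its variance is `Θ(n⁴)`
    (∀ n : ℕ, ∫ G, (TriangleLLT.S n G : ℝ) ∂(TriangleLLT.randomGraph n p) = TriangleLLT.mu n p) ∧
    ((fun n : ℕ => variance (fun G => (TriangleLLT.S n G : ℝ)) (TriangleLLT.randomGraph n p))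
      =Θ[atTop] fun n : ℕ => (n : ℝ) ^ 4) ∧
    -- the supremum over the lattice (taken in `[0,∞]`) tends to `0`
    Tendsto (fun n : ℕ => ⨆ x ∈ TriangleLLT.lattice n p,
        ENNReal.ofReal
          |TriangleLLT.sigma n p * TriangleLLT.pointProb n p x - TriangleLLT.gaussian x|)
      atTop (𝓝 0) ∧
    -- the equivalent form, with an error `o(1/n²)` uniform in `k`
    (∃ ε : ℕ → ℝ, Tendsto ε atTop (𝓝 0) ∧
      ∀ n : ℕ, 3 ≤ n → ∀ k : ℤ,
        |(TriangleLLT.randomGraph n p).real {G | (TriangleLLT.S n G : ℤ) = k}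
          - 1 / TriangleLLT.sigma n p *
            TriangleLLT.gaussian (((k : ℝ) - TriangleLLT.mu n p) / TriangleLLT.sigma n p)|
          ≤ ε n / (n : ℝ) ^ 2) := by
  have herr := TriangleLLT.tendsto_fourierErr hp0 hp1
  -- The witness rescales the Fourier error by $n^2/\sigma_n$, which is eventually at most $1/\sqrt
  -- c$ by the lower bound on the variance.
  refine ⟨fun n => TriangleLLT.mean_S p, TriangleLLT.isTheta_variance hp0 hp1, ?_,
    fun n => (n : ℝ) ^ 2 / TriangleLLT.sigma n p * TriangleLLT.fourierErr n p, ?_, ?_⟩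
  · have hlim : Tendsto (fun n => ENNReal.ofReal (TriangleLLT.fourierErr n p)) atTop (𝓝 0) := by
      simpa using ENNReal.tendsto_ofReal herr
    refine tendsto_of_tendsto_of_tendsto_of_le_of_le' tendsto_const_nhds hlim
      (Filter.Eventually.of_forall fun n => zero_le) ?_
    filter_upwards [eventually_ge_atTop 3] with n hn
    have hs := TriangleLLT.sigma_pos hn hp0 hp1
    refine iSup₂_le fun x hx => ENNReal.ofReal_le_ofReal ?_
    obtain ⟨k, rfl⟩ := hx
    rw [TriangleLLT.pointProb_eq p hs k]
    exact TriangleLLT.abs_prob_sub_gaussian_le p hs k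
  · have h0 : (0 : ℝ) < p := hp0
    have hq : 0 < 1 - (p : ℝ) := sub_pos.2 hp1
    set c := (p : ℝ) ^ 5 * (1 - p) / 16 with hc
    have hc0 : 0 < c := by positivity
    have hlim : Tendsto (fun n => 1 / √c * TriangleLLT.fourierErr n p) atTop (𝓝 0) := by
      simpa using herr.const_mul (1 / √c)
    refine tendsto_of_tendsto_of_tendsto_of_le_of_le' tendsto_const_nhds hlim
      (Filter.Eventually.of_forall fun n => mul_nonneg (div_nonneg (sq_nonneg _)
        (Real.sqrt_nonneg _)) (TriangleLLT.fourierErr_nonneg n p)) ?_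
    filter_upwards [eventually_ge_atTop 4] with n hn
    have hs := TriangleLLT.sigma_pos (by omega : 3 ≤ n) hp0 hp1
    refine mul_le_mul_of_nonneg_right ?_ (TriangleLLT.fourierErr_nonneg n p)
    have hge := TriangleLLT.sigma_sq_ge hn p
    have hsc : 0 < √c := Real.sqrt_pos.2 hc0
    rw [div_le_div_iff₀ hs hsc, one_mul]
    refine le_of_sq_le_sq ?_ hs.le
    rw [mul_pow, Real.sq_sqrt hc0.le]
    calc ((n : ℝ) ^ 2) ^ 2 * c = c * (n : ℝ) ^ 4 := by ring
      _ ≤ _ := hge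
  · intro n hn k
    have hs := TriangleLLT.sigma_pos hn hp0 hp1
    have hn0 : (0 : ℝ) < n := by exact_mod_cast (by omega : 0 < n)
    have h := TriangleLLT.abs_prob_sub_gaussian_le p hs k
    set s := TriangleLLT.sigma n p
    set P := (TriangleLLT.randomGraph n p).real {G | (TriangleLLT.S n G : ℤ) = k}
    set N := TriangleLLT.gaussian (((k : ℝ) - TriangleLLT.mu n p) / s)
    have e1 : P - 1 / s * N = (s * P - N) / s := by field_simp
    have e2 : (n : ℝ) ^ 2 / s * TriangleLLT.fourierErr n p / (n : ℝ) ^ 2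
        = TriangleLLT.fourierErr n p / s := by field_simp
    rw [e1, e2, abs_div, abs_of_pos hs]
    gcongr
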